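/- Let $\Omega\subset\mathbb R^3$ be a bounded domain with Liapunov boundary (that is, of class $C^{1,\alpha}$ for some $0<\alpha\le 1$), let $\lambda\in\mathbb C\setminus\{0\}$, $1<p<\infty$, $1/p+1/q=1$, and let $\vec g\in W^{p,\operatorname{div}}(\Omega)$, i.e. $\vec g\in L^p(\Omega;\mathbb C^3)$ with weak divergence $\operatorname{div}\vec g\in L^p(\Omega)$. Put $\theta(\vec x)=-\dfrac{e^{i\lambda|\vec x|}}{4\pi|\vec x|}$ and $$\vec T_{2,\lambda}[\vec g](\vec x)=\int_\Omega\big[\lambda\,\theta(\vec x-\vec y)\,\vec g(\vec y)-(\operatorname{grad}\theta)(\vec x-\vec y)\times\vec g(\vec y)\big]\,d\vec y .$$ Call $\vec w\in L^p(\Omega;\mathbb C^3)$ a weak solution of $$\operatorname{curl}\vec w+\lambda\vec w=\vec g\qquad(*)$$ if $\int_\Omega \operatorname{grad}v\times\vec w\,d\vec y=\int_\Omega(\lambda\vec w-\vec g)\,v\,d\vec y$ for all $v\in W^{1,q}_0(\Omega)$. Call $\vec u\in C^1(\Omega;\mathbb C^3)$ a force-free field if $\operatorname{curl}\vec u+\lambda\vec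 u=0$ in $\Omega$. Then the integral defining $\vec T_{2,\lambda}[\vec g]$ converges absolutely for almost every $\vec x\in\Omega$, the field $\vec T_{2,\lambda}[\vec g]$ belongs to $L^p(\Omega;\mathbb C^3)$ and has a weak curl in $L^p(\Omega;\mathbb C^3)$, and: 1. The weak solutions of $(*)$ are exactly the fields (up to equality almost everywhere) $$\vec w=\frac1\lambda\big(\vec g-\operatorname{curl}\vec T_{2,\lambda}[\vec g]\big)+\vec u,\qquad(**)$$ where $\vec u$ is an arbitrary force-free field belonging to $L^p(\Omega;\mathbb C^3)$. 2. A field is a weak solution of $(*)$ if and only if it is a weak solution of the system $-\operatorname{div}\vec w=g_0$, $\operatorname{curl}\vec w+\lambda\vec w=\vec g$ with $g_0=-\frac1\lambda\operatorname{div}\vec g$; that is, it satisfies in addition $\int_\Omega\operatorname{grad}v\cdot\vec w\,d\vec y=\int_\Omega g_0\,v\,d\vec y$ for all $v\in W_0^{1,q}(\Omega)$. 3. The locally integrable fields $\vec w$ on $\Omega$ that satisfy $(*)$ in the sense of distributions are exactly the fields $(**)$ with $\vec u$ an arbitrary force-free field. -/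

import Mathlib

open MeasureTheory TopologicalSpace Filter
open scoped ENNReal NNReal Distributions

/-- Euclidean space `ℝ³`. -/
abbrev E3 : Type := EuclideanSpace ℝ (Fin 3)

/-- Complex vectors, the values of the (biquaternionic) vector fields. The choice of the norm on
this finite-dimensional space plays no role. -/
abbrev C3 : Type := Fin 3 → ℂ

/-- The set `Ω` has a Liapunov boundary: its boundary is of class `C^{1,α}` for some `0 < α ≤ 1`.
Near each boundary point, in suitable Cartesian coordinates, `Ω` is the part of a ball that lies
above the graph of a `C¹` function whose derivative is Hölder continuous with exponent `α`. -/
def HasLiapunovBoundary (Ω : Set E3) : Prop :=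
  ∃ α : ℝ≥0, 0 < α ∧ α ≤ 1 ∧ ∀ x ∈ frontier Ω,
    ∃ r : ℝ, 0 < r ∧ ∃ e : E3 ≃ᵃⁱ[ℝ] E3, ∃ φ : EuclideanSpace ℝ (Fin 2) → ℝ,
      ContDiff ℝ 1 φ ∧ (∃ C : ℝ≥0, HolderWith C α (fderiv ℝ φ)) ∧
      ∀ y ∈ Metric.ball x r, y ∈ Ω ↔ φ !₂[e y 0, e y 1] < e y 2

/-- The partial derivative `∂ⱼ f` at `x`. -/
noncomputable def pderiv3 {F : Type*} [NormedAddCommGroup F] [NormedSpace ℝ F]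
    (j : Fin 3) (f : E3 → F) (x : E3) : F :=
  fderiv ℝ f x (EuclideanSpace.single j 1)

/-- The gradient of a complex-valued function. -/
noncomputable def grad3 (f : E3 → ℂ) (x : E3) : C3 := fun j => pderiv3 j f x

/-- The classical curl of a differentiable field. -/
noncomputable def curl3 (u : E3 → C3) (x : E3) : C3 :=
  ![pderiv3 1 u x 2 - pderiv3 2 u x 1,
    pderiv3 2 u x 0 - pderiv3 0 u x 2,
    pderiv3 0 u x 1 - pderiv3 1 u x 0]

/-- `d` is the weak (distributional) divergence of `f` in `Ω`. The product `⬝ᵥ` is bilinear. -/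
def HasWeakDiv (Ω : Opens E3) (f : E3 → C3) (d : E3 → ℂ) : Prop :=
  LocallyIntegrableOn f (Ω : Set E3) ∧ LocallyIntegrableOn d (Ω : Set E3) ∧
  ∀ φ : 𝓓(Ω, ℂ), ∫ x in (Ω : Set E3), grad3 φ x ⬝ᵥ f x = -∫ x in (Ω : Set E3), φ x * d x

/-- `c` is the weak (distributional) curl of `f` in `Ω`. -/
def HasWeakCurl (Ω : Opens E3) (f c : E3 → C3) : Prop :=
  LocallyIntegrableOn f (Ω : Set E3) ∧ LocallyIntegrableOn c (Ω : Set E3) ∧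
  ∀ φ : 𝓓(Ω, ℂ), ∫ x in (Ω : Set E3), crossProduct (grad3 φ x) (f x)
    = -∫ x in (Ω : Set E3), φ x • c x

/-- The space `W^{p,div}(Ω)` of fields in `L^p` whose weak divergence is in `L^p`. -/
def MemWDiv (Ω : Opens E3) (p : ℝ≥0∞) (g : E3 → C3) : Prop :=
  MemLp g p (volume.restrict (Ω : Set E3)) ∧
  ∃ d : E3 → ℂ, MemLp d p (volume.restrict (Ω : Set E3)) ∧ HasWeakDiv Ω g d

/-- `v ∈ W₀^{1,q}(Ω)` with gradient `V`: the pair `(v, V)` is a limit in `L^q` of pairs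
`(φₙ, grad φₙ)` with `φₙ ∈ C_c^∞(Ω)`. -/
def MemW01 (Ω : Opens E3) (q : ℝ≥0∞) (v : E3 → ℂ) (V : E3 → C3) : Prop :=
  MemLp v q (volume.restrict (Ω : Set E3)) ∧ MemLp V q (volume.restrict (Ω : Set E3)) ∧
  ∃ φ : ℕ → 𝓓(Ω, ℂ),
    Tendsto (fun n => eLpNorm (fun x => φ n x - v x) q (volume.restrict (Ω : Set E3)))
      atTop (nhds 0) ∧
    Tendsto (fun n => eLpNorm (fun x => grad3 (φ n) x - V x) q (volume.restrict (Ω : Set E3)))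
      atTop (nhds 0)

/-- `w ∈ L^p(Ω)` is a weak solution of `curl w + lam w = g`:
`∫ grad v × w = ∫ (lam w - g) v` for all `v ∈ W₀^{1,q}(Ω)`, where `1/p + 1/q = 1`. -/
def IsWeakSolution (Ω : Opens E3) (p q : ℝ≥0∞) (lam : ℂ) (g w : E3 → C3) : Prop :=
  MemLp w p (volume.restrict (Ω : Set E3)) ∧
  ∀ (v : E3 → ℂ) (V : E3 → C3), MemW01 Ω q v V →
    ∫ x in (Ω : Set E3), crossProduct (V x) (w x)
      = ∫ x in (Ω : Set E3), v x • (lam • w x - g x)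

/-- `w ∈ L^p(Ω)` is a weak solution of the system `-div w = g₀`, `curl w + lam w = g`. These are the
scalar and the vector part of the biquaternionic identity
`∫ (grad v) w = ∫ (lam w - (g₀ + g)) v`, for all `v ∈ W₀^{1,q}(Ω)`. -/
def IsWeakSystemSolution (Ω : Opens E3) (p q : ℝ≥0∞) (lam : ℂ) (g₀ : E3 → ℂ) (g w : E3 → C3) :
    Prop :=
  MemLp w p (volume.restrict (Ω : Set E3)) ∧
  ∀ (v : E3 → ℂ) (V : E3 → C3), MemW01 Ω q v V →
    ∫ x in (Ω : Set E3), V x ⬝ᵥ w x = ∫ x in (Ω : Set E3), g₀ x * v x ∧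
    ∫ x in (Ω : Set E3), crossProduct (V x) (w x)
      = ∫ x in (Ω : Set E3), v x • (lam • w x - g x)

/-- A force-free field in `Ω`: a classical (`C¹`) solution of `curl u + lam u = 0`. -/
def IsForceFree (Ω : Opens E3) (lam : ℂ) (u : E3 → C3) : Prop :=
  ContDiffOn ℝ 1 u (Ω : Set E3) ∧ ∀ x ∈ Ω, curl3 u x + lam • u x = 0

/-- The fundamental solution `-e^{i lam |x|} / (4 π |x|)` of the Helmholtz operator
`Δ + lam²`. -/
noncomputable def helmholtzFund (lam : ℂ) (x : E3) : ℂ :=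
  -Complex.exp (Complex.I * lam * (‖x‖ : ℂ)) / (4 * (Real.pi : ℂ) * (‖x‖ : ℂ))

/-- The integrand of `T₂`: with `E = lam θ - grad θ` the fundamental solution of `D + lam`, it is
`Sc E (x - y) g(y) + Vec E (x - y) × g(y)`. -/
noncomputable def T2Integrand (lam : ℂ) (g : E3 → C3) (x y : E3) : C3 :=
  (lam * helmholtzFund lam (x - y)) • g y
    - crossProduct (grad3 (helmholtzFund lam) (x - y)) (g y)

/-- The vector component `T₂` of the Teodorescu transform of a purely vectorial field. -/
noncomputable def T2 (Ω : Opens E3) (lam : ℂ) (g : E3 → C3) (x : E3) : C3 :=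
  ∫ y in (Ω : Set E3), T2Integrand lam g x y

/-! ### A Bellman function for bilinear estimates of heat flows -/

/-! Particular solution. Extend g by zero and let N be its Helmholtz volume potential, so that (Δ +
λ²)N = g in Ω. The gradient of the fundamental solution θ is locally integrable, so T = λN − curl N
on Ω. From curl curl = grad div − Δ it follows that curl T = g − λT − grad div N. Put w₀ = (g − curl
T)/λ = T + (grad div N)/λ. A gradient has no curl, so curl w₀ = curl T = g − λw₀. All this is done
in weak form in `exists_weakCurl_T2`; the identity for curl T is
`IsParametrix.integral_curl_potential`.

The whole calculation uses a parametrix instead of θ: E is θ times a cutoff, hence integrable with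
compact support, and (Δ + λ²)E = δ + η with η smooth and zero near the origin. If the cutoff radius
exceeds the diameter of Ω, then E agrees with θ on all differences of points of Ω, and η contributes
nothing there. That θ is fundamental is shown by replacing |x| with √(|x|² + ε²): the defect of the
Helmholtz equation then rescales to an approximate identity.

The one deep estimate is that grad div N belongs to L^p, i.e. ‖∂ᵢ∂ⱼφ‖_q ≤ C‖Δφ‖_q for test functions
(`exists_integral_pderiv3_pderiv3_le`). It is obtained from the heat flow and a Bellman function.
For positive heat flows u, v the energy ∫B(u,v), with B(u,v) = u²(u^p + v^q)^(1−2/p) + K v^q,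
decreases at the rate of the integrated Hessian of B, and this Hessian dominates 2|∂ᵢu ∂ⱼv|. So the
space-time integral of |∂ᵢu ∂ⱼv| is at most a multiple of ‖f‖_p^p + ‖h‖_q^q for initial data f, h.
On the other hand, d/dt of ∫ e^{tΔ}f · e^{tΔ}∂ᵢ∂ⱼφ is −2∫ ∂ᵢe^{tΔ}f · ∂ⱼe^{tΔ}Δφ. Integrating from t
= 0 to ∞ bounds ∫ f ∂ᵢ∂ⱼφ (`exists_bilinear_bound`), and duality gives the inequality.

General solution. The difference u of two distributional solutions satisfies curl u = −λu weakly.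
Since λ ≠ 0, u is divergence-free, so each component solves the Helmholtz equation; Weyl's lemma,
again by the parametrix, makes u smooth (`exists_isForceFree`). By density of test functions in
W₀^{1,q} and Hölder's inequality, weak solutions are exactly the distributional solutions in L^p
(`isWeakSolution_iff`). The divergence condition is automatic: testing the equation with ∂ⱼφ and
summing over the components removes the curl and leaves λ div w = div g. -/

/-- The leading part `u² (u^p + v^q)^(1 - 2/p)` of the Bellman function. -/
noncomputable def belX (p q u v : ℝ) : ℝ := u ^ 2 * (u ^ p + v ^ q) ^ (1 - 2 / p)

/-- The Bellman function. -/
noncomputable def bel (p q K u v : ℝ) : ℝ := belX p q u v + K * v ^ q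

/-- The logarithmic derivative `u ∂ᵤ` of the Bellman function. -/
noncomputable def bel1 (p q u v : ℝ) : ℝ :=
  belX p q u v * (2 + (1 - 2 / p) * p * (u ^ p / (u ^ p + v ^ q)))

/-- The logarithmic derivative `v ∂ᵥ` of the Bellman function. -/
noncomputable def bel2 (p q K u v : ℝ) : ℝ :=
  belX p q u v * ((1 - 2 / p) * q * (v ^ q / (u ^ p + v ^ q))) + K * q * v ^ q

/-- The Hessian form of the Bellman function at `(u, v)`, applied to the vector `(u U, v V)`. -/
noncomputable def belQ (p q K u v U V : ℝ) : ℝ :=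
  let X := belX p q u v
  let ρ := u ^ p / (u ^ p + v ^ q)
  let σ := v ^ q / (u ^ p + v ^ q)
  let γ := 1 - 2 / p
  let X' := X * (2 * U + γ * (p * ρ * U + q * σ * V))
  let ρ' := ρ * σ * (p * U - q * V)
  (X' * (2 + γ * p * ρ) + X * (γ * p * ρ')) * U
    + (X' * (γ * q * σ) - X * (γ * q * ρ') + K * q ^ 2 * v ^ q * V) * V
    - bel1 p q u v * U ^ 2 - bel2 p q K u v * V ^ 2

/-! ### First and second derivatives of the Bellman function along curves -/

section Calculus

variable {p q K : ℝ} {u v : ℝ → ℝ} {u1 v1 s : ℝ}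

/-- Derivatives are written through u'/u throughout: logarithmic differentiation keeps every formula
a polynomial in the Bellman function's leading part, the two fractions ρ, σ, and the logarithmic
derivatives. -/
theorem HasDerivAt.rpow_log (hu : HasDerivAt u u1 s) (h : 0 < u s) (p : ℝ) :
    HasDerivAt (fun s => u s ^ p) (p * u s ^ p * (u1 / u s)) s := by
  refine (hu.rpow_const (p := p) (Or.inl h.ne')).congr_deriv ?_
  rw [Real.rpow_sub_one h.ne']; field_simp

theorem hasDerivAt_belX (hu : HasDerivAt u u1 s) (hv : HasDerivAt v v1 s)
    (h : 0 < u s) (h' : 0 < v s) :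
    HasDerivAt (fun s => belX p q (u s) (v s))
      (belX p q (u s) (v s) * (2 * (u1 / u s) + (1 - 2 / p) *
        (p * (u s ^ p / (u s ^ p + v s ^ q)) * (u1 / u s)
          + q * (v s ^ q / (u s ^ p + v s ^ q)) * (v1 / v s)))) s := by
  have hM : 0 < u s ^ p + v s ^ q := by positivity
  have := (hu.pow 2).mul (((hu.rpow_log h p).add (hv.rpow_log h' q)).rpow_log hM (1 - 2 / p))
  refine this.congr_deriv ?_
  simp only [belX, Pi.add_apply, Pi.pow_apply]
  field_simp
  ring

theorem hasDerivAt_bel (hu : HasDerivAt u u1 s) (hv : HasDerivAt v v1 s)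
    (h : 0 < u s) (h' : 0 < v s) :
    HasDerivAt (fun s => bel p q K (u s) (v s))
      (bel1 p q (u s) (v s) * (u1 / u s) + bel2 p q K (u s) (v s) * (v1 / v s)) s := by
  refine ((hasDerivAt_belX (p := p) (q := q) hu hv h h').add
    ((hv.rpow_log h' q).const_mul K)).congr_deriv ?_
  simp only [bel1, bel2]; ring

theorem hasDerivAt_rho (hu : HasDerivAt u u1 s) (hv : HasDerivAt v v1 s)
    (h : 0 < u s) (h' : 0 < v s) :
    HasDerivAt (fun s => u s ^ p / (u s ^ p + v s ^ q))
      (u s ^ p / (u s ^ p + v s ^ q) * (v s ^ q / (u s ^ p + v s ^ q)) *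
        (p * (u1 / u s) - q * (v1 / v s))) s := by
  have hM : u s ^ p + v s ^ q ≠ 0 := by positivity
  refine ((hu.rpow_log h p).div ((hu.rpow_log h p).add (hv.rpow_log h' q)) hM).congr_deriv ?_
  simp only [Pi.add_apply]
  field_simp
  ring

theorem hasDerivAt_sigma (hu : HasDerivAt u u1 s) (hv : HasDerivAt v v1 s)
    (h : 0 < u s) (h' : 0 < v s) :
    HasDerivAt (fun s => v s ^ q / (u s ^ p + v s ^ q))
      (-(u s ^ p / (u s ^ p + v s ^ q) * (v s ^ q / (u s ^ p + v s ^ q)) *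
        (p * (u1 / u s) - q * (v1 / v s)))) s := by
  have hM : u s ^ p + v s ^ q ≠ 0 := by positivity
  refine ((hv.rpow_log h' q).div ((hu.rpow_log h p).add (hv.rpow_log h' q)) hM).congr_deriv ?_
  simp only [Pi.add_apply]
  field_simp
  ring

/-- The second derivative along a curve splits into the Hessian form on the velocity plus the
gradient on the acceleration. Along a heat flow the latter sums, over the coordinates, to the time
derivative, which is why the two pieces are kept apart. -/
theorem hasDerivAt_bel_deriv {u' v' : ℝ → ℝ} {u2 v2 : ℝ}
    (hu : HasDerivAt u (u' s) s) (hv : HasDerivAt v (v' s) s)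
    (hu' : HasDerivAt u' u2 s) (hv' : HasDerivAt v' v2 s) (h : 0 < u s) (h' : 0 < v s) :
    HasDerivAt (fun s => bel1 p q (u s) (v s) * (u' s / u s)
        + bel2 p q K (u s) (v s) * (v' s / v s))
      (belQ p q K (u s) (v s) (u' s / u s) (v' s / v s)
        + (bel1 p q (u s) (v s) * (u2 / u s) + bel2 p q K (u s) (v s) * (v2 / v s))) s := by
  have hX := hasDerivAt_belX (p := p) (q := q) hu hv h h'
  have hρ := hasDerivAt_rho (p := p) (q := q) hu hv h h'
  have hσ := hasDerivAt_sigma (p := p) (q := q) hu hv h h'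
  have h1 := hX.mul ((hρ.const_mul ((1 - 2 / p) * p)).const_add 2)
  have h2 := (hX.mul (hσ.const_mul ((1 - 2 / p) * q))).add ((hv.rpow_log h' q).const_mul (K * q))
  have hU := hu'.div hu h.ne'
  have hV := hv'.div hv h'.ne'
  refine ((h1.mul hU).add (h2.mul hV)).congr_deriv ?_
  have eU : (u2 * u s - u' s * u' s) / u s ^ 2 = u2 / u s - (u' s / u s) ^ 2 := by
    field_simp
  have eV : (v2 * v s - v' s * v' s) / v s ^ 2 = v2 / v s - (v' s / v s) ^ 2 := by
    field_simp
  rw [eU, eV]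
  simp only [belQ, bel1, bel2, Pi.mul_apply, Pi.add_apply, Pi.div_apply]
  ring

end Calculus

/-! ### Convexity and size of the Bellman function -/

section Bounds

variable {p q u v : ℝ}

theorem belX_nonneg (hu : 0 < u) (hv : 0 < v) : 0 ≤ belX p q u v := by
  unfold belX; positivity

theorem sq_mul_rpow_le (hp : 2 ≤ p) (hu : 0 < u) (hv : 0 < v) :
    u ^ 2 ≤ (u ^ p + v ^ q) ^ (2 / p) := by
  have hp0 : 0 < p := by linarith
  calc u ^ 2 = (u ^ p) ^ (2 / p) := by
        rw [← Real.rpow_mul hu.le, mul_div_cancel₀ _ hp0.ne']; norm_num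
    _ ≤ _ := Real.rpow_le_rpow (by positivity) (by linarith [Real.rpow_pos_of_pos hv q])
        (by positivity)

theorem belX_le (hp : 2 ≤ p) (hu : 0 < u) (hv : 0 < v) :
    belX p q u v ≤ u ^ p + v ^ q := by
  have hM : 0 < u ^ p + v ^ q := by positivity
  calc belX p q u v ≤ (u ^ p + v ^ q) ^ (2 / p) * (u ^ p + v ^ q) ^ (1 - 2 / p) :=
        mul_le_mul_of_nonneg_right (sq_mul_rpow_le hp hu hv) (by positivity)
    _ = _ := by rw [← Real.rpow_add hM]; simp

theorem belX_mul_sigma_le (hp : 2 ≤ p) (hu : 0 < u) (hv : 0 < v) :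
    belX p q u v * (v ^ q / (u ^ p + v ^ q)) ≤ v ^ q := by
  have hM : 0 < u ^ p + v ^ q := by positivity
  have hw : 0 < v ^ q := by positivity
  rw [mul_div_assoc', div_le_iff₀ hM, mul_comm]
  exact mul_le_mul_of_nonneg_left (belX_le hp hu hv) hw.le

/-- Conjugacy gives q(1 − 2/p) + q = 2, so v² = (v^q)^(1−2/p) v^q, and v^q may be enlarged to u^p +
v^q in the first factor. This is what turns the two diagonal terms of the Hessian bound into the
product uv. -/
theorem sq_mul_sq_le_belX_mul (hp : 2 ≤ p) (hpq : 1 / p + 1 / q = 1) (hq : 1 < q)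
    (hu : 0 < u) (hv : 0 < v) : u ^ 2 * v ^ 2 ≤ belX p q u v * v ^ q := by
  have hp0 : 0 < p := by linarith
  have hq0 : 0 < q := by linarith
  have hγ : 0 ≤ 1 - 2 / p := by rw [sub_nonneg, div_le_one hp0]; exact hp
  have e : q * (1 - 2 / p) + q = 2 := by
    have : 1 / p = 1 - 1 / q := by linarith
    have h2 : 2 / p = 2 * (1 - 1 / q) := by rw [← this]; ring
    rw [h2]; field_simp; ring
  have : v ^ 2 ≤ (u ^ p + v ^ q) ^ (1 - 2 / p) * v ^ q := by
    calc v ^ 2 = (v ^ q) ^ (1 - 2 / p) * v ^ q := by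
          rw [← Real.rpow_mul hv.le, ← Real.rpow_add hv, e]; norm_num
      _ ≤ _ := mul_le_mul_of_nonneg_right (Real.rpow_le_rpow (by positivity)
          (by linarith [Real.rpow_pos_of_pos hu p]) hγ) (by positivity)
  unfold belX
  nlinarith [sq_nonneg u]

/-- The constant in the Bellman function. -/
noncomputable def belK (q : ℝ) : ℝ := 1 + (4 * q ^ 2 + 1) / (q * (q - 1))

theorem belK_pos (hq : 1 < q) : 0 < belK q := by
  have : 0 < q - 1 := by linarith
  have : 0 < q := by linarith
  unfold belK; positivity

/-- For conjugate exponents (1 − 2/p)p = p − 2, (1 − 2/p)q = 2 − q and pq = p + q. With ρ = 1 − σ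
the Hessian becomes an explicit quadratic form in U, V, and the last identity simplifies the mixed
coefficient. -/
theorem belQ_eq (K : ℝ) (hp : 2 ≤ p) (hpq : 1 / p + 1 / q = 1) (hq : 1 < q)
    (hu : 0 < u) (hv : 0 < v) (U V : ℝ) :
    belQ p q K u v U V =
      belX p q u v * (2 + (p - 2) * (1 - v ^ q / (u ^ p + v ^ q))
          * (1 + p + 2 * (v ^ q / (u ^ p + v ^ q)))) * U ^ 2
        + 4 * (2 - q) * (v ^ q / (u ^ p + v ^ q)) ^ 2 * belX p q u v * U * V
        + belX p q u v * ((2 - q) * (q - 1)) * (v ^ q / (u ^ p + v ^ q))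
          * (1 - 2 * (v ^ q / (u ^ p + v ^ q))) * V ^ 2
        + K * (q * (q - 1)) * v ^ q * V ^ 2 := by
  have hp0 : 0 < p := by linarith
  have hq0 : 0 < q := by linarith
  have hM : 0 < u ^ p + v ^ q := by positivity
  have eγq : (1 - 2 / p) * q = 2 - q := by
    have : 1 / p = 1 - 1 / q := by linarith
    have h2 : 2 / p = 2 * (1 - 1 / q) := by rw [← this]; ring
    rw [h2]; field_simp; ring
  have eγp : (1 - 2 / p) * p = p - 2 := by field_simp
  have hρσ : u ^ p / (u ^ p + v ^ q) = 1 - v ^ q / (u ^ p + v ^ q) := by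
    field_simp; ring
  have e4 : p * q = p + q := by field_simp at hpq; linarith
  simp only [belQ, bel1, bel2]
  rw [hρσ]
  generalize belX p q u v = X
  generalize v ^ q / (u ^ p + v ^ q) = σ
  generalize 1 - 2 / p = γ at *
  generalize v ^ q = w
  have e3 : γ * (p * (1 - σ) * U + q * σ * V) = (p - 2) * (1 - σ) * U + (2 - q) * σ * V := by
    rw [← eγp, ← eγq]; ring
  rw [e3, eγp, eγq]
  linear_combination (-2 * X * U * V * σ * (1 - σ)) * e4

/-- The U² coefficient is at least 2X. The mixed term costs at most XU² + 4wV² by completing the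
square, and the remaining V² term costs at most (q − 1)wV²; both use Xσ ≤ w. The multiple of v^q in
the Bellman function must therefore supply at least 4 + (q − 1) + 1 times wV², and `hK` is chosen
for this. -/
theorem bellman_quadratic_ge {X σ w K U V : ℝ} (hp : 2 ≤ p) (hq1 : 1 < q) (hq2 : q ≤ 2)
    (hX : 0 ≤ X) (hσ0 : 0 ≤ σ) (hσ1 : σ ≤ 1) (hw : 0 ≤ w) (hXσ : X * σ ≤ w)
    (hK : K * (q * (q - 1)) = q * (q - 1) + (4 * q ^ 2 + 1)) :
    X * U ^ 2 + w * V ^ 2 ≤ X * (2 + (p - 2) * (1 - σ) * (1 + p + 2 * σ)) * U ^ 2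
        + 4 * (2 - q) * σ ^ 2 * X * U * V
        + X * ((2 - q) * (q - 1)) * σ * (1 - 2 * σ) * V ^ 2
        + K * (q * (q - 1)) * w * V ^ 2 := by
  have hq0 : 0 ≤ q - 1 := by linarith
  have hXs0 : 0 ≤ X * σ := by positivity
  have t1 : 2 * X * U ^ 2 ≤ X * (2 + (p - 2) * (1 - σ) * (1 + p + 2 * σ)) * U ^ 2 := by
    have : 0 ≤ (p - 2) * (1 - σ) * (1 + p + 2 * σ) :=
      mul_nonneg (mul_nonneg (by linarith) (by linarith)) (by linarith)
    have := mul_nonneg hX (mul_nonneg this (sq_nonneg U))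
    linarith
  have t2 : -(X * U ^ 2 + 4 * (w * V ^ 2)) ≤ 4 * (2 - q) * σ ^ 2 * X * U * V := by
    have a1 : 0 ≤ X * (U + 2 * (2 - q) * σ ^ 2 * V) ^ 2 := by positivity
    have a2 : X * ((2 - q) * σ ^ 2) ^ 2 ≤ w := by
      have h0 : 0 ≤ (2 - q) * σ ^ 2 := mul_nonneg (by linarith) (by positivity)
      have h2 : σ ^ 2 ≤ σ := by nlinarith
      have h1 : (2 - q) * σ ^ 2 ≤ σ :=
        (mul_le_of_le_one_left (sq_nonneg σ) (by linarith)).trans h2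
      calc X * ((2 - q) * σ ^ 2) ^ 2 ≤ X * σ ^ 2 :=
            mul_le_mul_of_nonneg_left (pow_le_pow_left₀ h0 h1 2) hX
        _ ≤ X * σ := mul_le_mul_of_nonneg_left h2 hX
        _ ≤ w := hXσ
    have := mul_le_mul_of_nonneg_right a2 (sq_nonneg V)
    linarith
  have t3 : -(w * V ^ 2 * (q - 1)) ≤ X * ((2 - q) * (q - 1)) * σ * (1 - 2 * σ) * V ^ 2 := by
    have b1 : -1 ≤ (2 - q) * (1 - 2 * σ) := by
      have := mul_nonneg (by linarith : 0 ≤ 2 - q) (by linarith : 0 ≤ 1 - σ)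
      linarith
    have b2 : 0 ≤ X * σ * ((q - 1) * V ^ 2) := by positivity
    have b3 := mul_le_mul_of_nonneg_right hXσ (by positivity : 0 ≤ (q - 1) * V ^ 2)
    have := mul_le_mul_of_nonneg_left b1 b2
    linarith
  have t4 : K * (q * (q - 1)) * w * V ^ 2 = (q * (q - 1) + (4 * q ^ 2 + 1)) * (w * V ^ 2) := by
    rw [hK]; ring
  have hwV : 0 ≤ w * V ^ 2 := by positivity
  have : 4 + (q - 1) + 1 ≤ q * (q - 1) + (4 * q ^ 2 + 1) := by nlinarith
  have := mul_le_mul_of_nonneg_right this hwV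
  linarith

/-- A crude upper bound for the same form; it serves only to make the Hessian integrable along the
flow. -/
theorem bellman_quadratic_le {X σ w K U V M : ℝ} (hp : 2 ≤ p) (hq1 : 1 < q) (hq2 : q ≤ 2)
    (hX : 0 ≤ X) (hσ0 : 0 ≤ σ) (hσ1 : σ ≤ 1) (hXM : X ≤ M) (hwM : w ≤ M)
    (hK : 0 ≤ K) :
    X * (2 + (p - 2) * (1 - σ) * (1 + p + 2 * σ)) * U ^ 2
        + 4 * (2 - q) * σ ^ 2 * X * U * V
        + X * ((2 - q) * (q - 1)) * σ * (1 - 2 * σ) * V ^ 2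
        + K * (q * (q - 1)) * w * V ^ 2
      ≤ (2 + p * (3 + p) + 3 + K * (q * (q - 1))) * M * (U ^ 2 + V ^ 2) := by
  have hq0 : 0 ≤ q - 1 := by linarith
  have t1 : X * (2 + (p - 2) * (1 - σ) * (1 + p + 2 * σ)) * U ^ 2
      ≤ M * (2 + p * (3 + p)) * U ^ 2 := by
    have h1 : (p - 2) * (1 - σ) ≤ p * 1 :=
      mul_le_mul (by linarith) (by linarith) (by linarith) (by linarith)
    have h2 : (p - 2) * (1 - σ) * (1 + p + 2 * σ) ≤ p * 1 * (3 + p) :=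
      mul_le_mul h1 (by linarith) (by linarith) (by linarith)
    have h0 : 0 ≤ (p - 2) * (1 - σ) * (1 + p + 2 * σ) :=
      mul_nonneg (mul_nonneg (by linarith) (by linarith)) (by linarith)
    refine mul_le_mul_of_nonneg_right (mul_le_mul hXM (by linarith) (by linarith)
      (by linarith)) (by positivity)
  have hσ2 : σ ^ 2 ≤ 1 := by nlinarith
  have t2 : 4 * (2 - q) * σ ^ 2 * X * U * V ≤ M * (2 * (U ^ 2 + V ^ 2)) := by
    have h1 : (2 - q) * σ ^ 2 ≤ 1 := by nlinarith
    have h0 : 0 ≤ (2 - q) * σ ^ 2 := mul_nonneg (by linarith) (by positivity)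
    have h2 : (2 - q) * σ ^ 2 * X ≤ 1 * M := mul_le_mul h1 hXM hX (by norm_num)
    have h3 : 4 * (U * V) ≤ 2 * (U ^ 2 + V ^ 2) := by linarith [sq_nonneg (U - V)]
    have h4 : 0 ≤ (2 - q) * σ ^ 2 * X := by positivity
    have h5 : 0 ≤ 2 * (U ^ 2 + V ^ 2) := by positivity
    calc 4 * (2 - q) * σ ^ 2 * X * U * V = (2 - q) * σ ^ 2 * X * (4 * (U * V)) := by ring
      _ ≤ (2 - q) * σ ^ 2 * X * (2 * (U ^ 2 + V ^ 2)) := mul_le_mul_of_nonneg_left h3 h4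
      _ ≤ 1 * M * (2 * (U ^ 2 + V ^ 2)) := mul_le_mul_of_nonneg_right h2 h5
      _ = _ := by ring
  have t3 : X * ((2 - q) * (q - 1)) * σ * (1 - 2 * σ) * V ^ 2 ≤ M * V ^ 2 := by
    have h1 : (2 - q) * (q - 1) ≤ 1 := by nlinarith
    have h0 : 0 ≤ (2 - q) * (q - 1) := mul_nonneg (by linarith) hq0
    have h2 : σ * (1 - 2 * σ) ≤ 1 := by nlinarith
    have h3 : (2 - q) * (q - 1) * (σ * (1 - 2 * σ)) ≤ 1 := by nlinarith
    have h4 : X * ((2 - q) * (q - 1) * (σ * (1 - 2 * σ))) ≤ X := mul_le_of_le_one_right hX h3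
    have := mul_le_mul_of_nonneg_right (h4.trans hXM) (sq_nonneg V)
    linarith
  have t4 : K * (q * (q - 1)) * w * V ^ 2 ≤ K * (q * (q - 1)) * M * V ^ 2 := by
    gcongr
  have hM : 0 ≤ M := hX.trans hXM
  have p1 : 0 ≤ M * U ^ 2 := by positivity
  have p2 : 0 ≤ (2 + p * (3 + p)) * (M * V ^ 2) := by
    have : 0 < p := by linarith
    positivity
  have p3 : 0 ≤ K * (q * (q - 1)) * M * U ^ 2 := by positivity
  linarith

theorem conj_le_two (hp : 2 ≤ p) (hpq : 1 / p + 1 / q = 1) (hq : 1 < q) : q ≤ 2 := by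
  field_simp at hpq
  nlinarith

theorem belK_mul (hq : 1 < q) : belK q * (q * (q - 1)) = q * (q - 1) + (4 * q ^ 2 + 1) := by
  have : q - 1 ≠ 0 := by linarith
  unfold belK; field_simp

theorem belQ_ge (hp : 2 ≤ p) (hpq : 1 / p + 1 / q = 1) (hq : 1 < q)
    (hu : 0 < u) (hv : 0 < v) (U V : ℝ) :
    belX p q u v * U ^ 2 + v ^ q * V ^ 2 ≤ belQ p q (belK q) u v U V := by
  have hM : 0 < u ^ p + v ^ q := by positivity
  rw [belQ_eq _ hp hpq hq hu hv]
  refine bellman_quadratic_ge hp hq (conj_le_two hp hpq hq) (belX_nonneg hu hv) (by positivity) ?_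
    (by positivity) (belX_mul_sigma_le hp hu hv) (belK_mul hq)
  rw [div_le_one hM]; linarith [Real.rpow_pos_of_pos hu p]

theorem abs_bel1_le (hp : 2 ≤ p) (hu : 0 < u) (hv : 0 < v) :
    |bel1 p q u v| ≤ p * (u ^ p + v ^ q) := by
  have hp0 : 0 < p := by linarith
  have hM : 0 < u ^ p + v ^ q := by positivity
  have hX := belX_nonneg (p := p) (q := q) hu hv
  have eγp : (1 - 2 / p) * p = p - 2 := by field_simp
  have hρ0 : 0 ≤ u ^ p / (u ^ p + v ^ q) := by positivity
  have hρ1 : u ^ p / (u ^ p + v ^ q) ≤ 1 := by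
    rw [div_le_one hM]; linarith [Real.rpow_pos_of_pos hv q]
  unfold bel1
  rw [eγp, abs_mul, abs_of_nonneg hX, mul_comm]
  have h2 : 0 ≤ (p - 2) * (u ^ p / (u ^ p + v ^ q)) := mul_nonneg (by linarith) hρ0
  rw [abs_of_nonneg (by linarith)]
  exact mul_le_mul (by nlinarith) (belX_le hp hu hv) hX hp0.le

theorem abs_bel2_le (hp : 2 ≤ p) (hq : 1 < q) (hu : 0 < u) (hv : 0 < v) :
    |bel2 p q (belK q) u v| ≤ (1 + belK q) * q * (u ^ p + v ^ q) := by
  have hp0 : 0 < p := by linarith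
  have hq0 : 0 < q := by linarith
  have hM : 0 < u ^ p + v ^ q := by positivity
  have hK := belK_pos hq
  have hγ0 : 0 ≤ 1 - 2 / p := by rw [sub_nonneg, div_le_one hp0]; exact hp
  have hγ1 : 1 - 2 / p ≤ 1 := by have : 0 < 2 / p := by positivity
                                 linarith
  have hX := belX_nonneg (p := p) (q := q) hu hv
  have hXσ := belX_mul_sigma_le (q := q) hp hu hv
  have hw : 0 < v ^ q := by positivity
  have hw' : v ^ q ≤ u ^ p + v ^ q := by linarith [Real.rpow_pos_of_pos hu p]
  have h0 : 0 ≤ bel2 p q (belK q) u v := by unfold bel2; positivity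
  rw [abs_of_nonneg h0]
  unfold bel2
  have : (1 - 2 / p) * (q * (belX p q u v * (v ^ q / (u ^ p + v ^ q)))) ≤ 1 * (q * v ^ q) :=
    mul_le_mul hγ1 (mul_le_mul_of_nonneg_left hXσ hq0.le) (by positivity) (by norm_num)
  have h3 : (1 + belK q) * q * v ^ q ≤ (1 + belK q) * q * (u ^ p + v ^ q) :=
    mul_le_mul_of_nonneg_left hw' (by positivity)
  linarith

theorem bel_nonneg (hq : 1 < q) (hu : 0 < u) (hv : 0 < v) : 0 ≤ bel p q (belK q) u v := by
  have hX := belX_nonneg (p := p) (q := q) hu hv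
  have hK := belK_pos hq
  unfold bel; positivity

theorem bel_le (hp : 2 ≤ p) (hq : 1 < q) (hu : 0 < u) (hv : 0 < v) :
    bel p q (belK q) u v ≤ (1 + belK q) * (u ^ p + v ^ q) := by
  have hX := belX_le (q := q) hp hu hv
  have hK := belK_pos hq
  have := Real.rpow_pos_of_pos hu p
  unfold bel; nlinarith

/-- Each Hessian term is at least XU² + wV². Keeping the U² term of index i and the V² term of index
j, the arithmetic-geometric mean inequality yields 2√(Xw)|UᵢVⱼ|, and Xw ≥ u²v². -/
theorem abs_mul_le_belQ (hp : 2 ≤ p) (hpq : 1 / p + 1 / q = 1) (hq : 1 < q)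
    (hu : 0 < u) (hv : 0 < v) {ι : Type*} (s : Finset ι) (U V : ι → ℝ) {i j : ι}
    (hi : i ∈ s) (hj : j ∈ s) :
    2 * |(u * U i) * (v * V j)| ≤ ∑ k ∈ s, belQ p q (belK q) u v (U k) (V k) := by
  have hX := belX_nonneg (p := p) (q := q) hu hv
  have hw : 0 < v ^ q := by positivity
  have h1 : belX p q u v * U i ^ 2 + v ^ q * V j ^ 2
      ≤ ∑ k ∈ s, belQ p q (belK q) u v (U k) (V k) := by
    refine le_trans ?_ (Finset.sum_le_sum fun k _ => belQ_ge hp hpq hq hu hv (U k) (V k))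
    rw [Finset.sum_add_distrib]
    exact add_le_add
      (Finset.single_le_sum (f := fun k => belX p q u v * U k ^ 2) (fun k _ => by positivity) hi)
      (Finset.single_le_sum (f := fun k => v ^ q * V k ^ 2) (fun k _ => by positivity) hj)
  refine le_trans ?_ h1
  refine abs_le_of_sq_le_sq' ?_ (by positivity) |>.2
  have h2 := sq_mul_sq_le_belX_mul hp hpq hq hu hv
  have h3 := mul_le_mul_of_nonneg_right h2 (by positivity : 0 ≤ U i ^ 2 * V j ^ 2)
  rw [mul_pow, sq_abs]
  nlinarith [sq_nonneg (belX p q u v * U i ^ 2 - v ^ q * V j ^ 2)]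

theorem abs_belQ_le (hp : 2 ≤ p) (hpq : 1 / p + 1 / q = 1) (hq : 1 < q)
    (hu : 0 < u) (hv : 0 < v) (U V : ℝ) :
    |belQ p q (belK q) u v U V|
      ≤ (2 + p * (3 + p) + 3 + belK q * (q * (q - 1))) * (u ^ p + v ^ q) * (U ^ 2 + V ^ 2) := by
  have hM : 0 < u ^ p + v ^ q := by positivity
  have hX := belX_nonneg (p := p) (q := q) hu hv
  rw [abs_of_nonneg (le_trans (by positivity) (belQ_ge hp hpq hq hu hv U V)),
    belQ_eq _ hp hpq hq hu hv]
  refine bellman_quadratic_le hp hq (conj_le_two hp hpq hq) hX (by positivity) ?_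
    (belX_le hp hu hv) (by linarith [Real.rpow_pos_of_pos hu p]) (belK_pos hq).le
  rw [div_le_one hM]; linarith [Real.rpow_pos_of_pos hu p]

end Bounds

/-! ### The heat flow of a compactly supported function on `ℝ³` -/

/-- The standard basis vectors of `ℝ³`. -/
noncomputable abbrev e3 (k : Fin 3) : E3 := EuclideanSpace.single k 1

/-- The heat kernel on `ℝ³`. -/
noncomputable def heatK (t : ℝ) (z : E3) : ℝ :=
  (4 * Real.pi * t) ^ (-(3 / 2) : ℝ) * Real.exp (-‖z‖ ^ 2 / (4 * t))

/-- The partial derivative `∂ₖ` of the heat kernel. -/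
noncomputable def heatK1 (k : Fin 3) (t : ℝ) (z : E3) : ℝ := -(z k / (2 * t)) * heatK t z

/-- The second partial derivative `∂ₖ²` of the heat kernel. -/
noncomputable def heatK2 (k : Fin 3) (t : ℝ) (z : E3) : ℝ :=
  (z k ^ 2 / (4 * t ^ 2) - 1 / (2 * t)) * heatK t z

/-- Convolution of a kernel with a function. -/
noncomputable def gconv (κ f : E3 → ℝ) (x : E3) : ℝ := ∫ y, κ (x - y) * f y

theorem heatK_pos {t : ℝ} (ht : 0 < t) (z : E3) : 0 < heatK t z := by
  unfold heatK; positivity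

theorem continuous_heatK (t : ℝ) : Continuous (heatK t) := by
  unfold heatK; fun_prop

theorem continuous_heatK1 (k : Fin 3) (t : ℝ) : Continuous (heatK1 k t) := by
  have := continuous_heatK t
  unfold heatK1; fun_prop

theorem continuous_heatK2 (k : Fin 3) (t : ℝ) : Continuous (heatK2 k t) := by
  have := continuous_heatK t
  unfold heatK2; fun_prop

theorem heatK_neg (t : ℝ) (z : E3) : heatK t (-z) = heatK t z := by
  simp [heatK]

theorem norm_sq_add_smul (x : E3) (k : Fin 3) (s : ℝ) :
    ‖x + s • e3 k‖ ^ 2 = ‖x‖ ^ 2 + 2 * s * x k + s ^ 2 := by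
  rw [norm_add_sq_real, inner_smul_right, norm_smul, EuclideanSpace.inner_single_right]
  simp; ring

theorem hasDerivAt_heatK_line (k : Fin 3) (t : ℝ) (z : E3) (s : ℝ) :
    HasDerivAt (fun s : ℝ => heatK t (z + s • e3 k)) (heatK1 k t (z + s • e3 k)) s := by
  have h1 : HasDerivAt (fun s : ℝ => -(‖z‖ ^ 2 + 2 * s * z k + s ^ 2) / (4 * t))
      (-(2 * z k + 2 * s) / (4 * t)) s := by
    have := ((((hasDerivAt_id s).const_mul 2).mul_const (z k)).const_add (‖z‖ ^ 2)).add
      ((hasDerivAt_id s).pow 2)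
    refine (this.neg.div_const (4 * t)).congr_deriv ?_
    simp
  have h2 := h1.exp.const_mul ((4 * Real.pi * t) ^ (-(3 / 2) : ℝ))
  have e : (fun s : ℝ => heatK t (z + s • e3 k)) = fun s : ℝ =>
      (4 * Real.pi * t) ^ (-(3 / 2) : ℝ) *
        Real.exp (-(‖z‖ ^ 2 + 2 * s * z k + s ^ 2) / (4 * t)) := by
    funext s; simp only [heatK, norm_sq_add_smul]
  rw [e]
  refine h2.congr_deriv ?_
  simp only [heatK1, heatK, norm_sq_add_smul]
  simp
  ring

theorem hasDerivAt_heatK1_line (k : Fin 3) (t : ℝ) (z : E3) (s : ℝ) :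
    HasDerivAt (fun s : ℝ => heatK1 k t (z + s • e3 k)) (heatK2 k t (z + s • e3 k)) s := by
  have h1 : HasDerivAt (fun s : ℝ => -((z + s • e3 k) k / (2 * t))) (-(1 / (2 * t))) s := by
    have e : (fun s : ℝ => -((z + s • e3 k) k / (2 * t))) = fun s => -((z k + s) / (2 * t)) := by
      funext s; simp
    rw [e]
    exact (((hasDerivAt_id s).const_add (z k)).div_const (2 * t)).neg
  refine (h1.mul (hasDerivAt_heatK_line k t z s)).congr_deriv ?_
  simp only [heatK2, heatK1]
  ring

theorem hasDerivAt_heatK_time {t : ℝ} (ht : 0 < t) (z : E3) :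
    HasDerivAt (fun t => heatK t z) (∑ k, heatK2 k t z) t := by
  have hpos : 0 < 4 * Real.pi * t := by positivity
  have h1 : HasDerivAt (fun t : ℝ => (4 * Real.pi * t) ^ (-(3 / 2) : ℝ))
      (-(3 / 2) * (1 / t) * (4 * Real.pi * t) ^ (-(3 / 2) : ℝ)) t := by
    refine (((hasDerivAt_id t).const_mul (4 * Real.pi)).rpow_const
      (p := -(3 / 2)) (Or.inl hpos.ne')).congr_deriv ?_
    simp only [id]
    rw [Real.rpow_sub_one hpos.ne']; field_simp
  have h2 : HasDerivAt (fun t : ℝ => -‖z‖ ^ 2 / (4 * t)) (‖z‖ ^ 2 / (4 * t ^ 2)) t := by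
    have := ((hasDerivAt_id t).const_mul 4).fun_inv (by simp; exact ht.ne')
    refine ((this.const_mul (-‖z‖ ^ 2))).congr_deriv ?_
    simp; field_simp
  refine (h1.mul h2.exp).congr_deriv ?_
  have hn : ‖z‖ ^ 2 = z 0 ^ 2 + z 1 ^ 2 + z 2 ^ 2 := by
    rw [EuclideanSpace.real_norm_sq_eq, Fin.sum_univ_three]
  simp only [Fin.sum_univ_three, heatK2, heatK]
  rw [hn]; field_simp; ring

theorem continuousOn_heatK2 (k : Fin 3) :
    ContinuousOn (fun a : ℝ × E3 => heatK2 k a.1 a.2) {a | 0 < a.1} := by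
  unfold heatK2 heatK
  have h4 : ∀ a ∈ {a : ℝ × E3 | 0 < a.1}, 4 * Real.pi * a.1 ≠ 0 ∨ (0:ℝ) ≤ -(3/2) := by
    intro a ha; left; have : 0 < a.1 := ha; positivity
  have h5 : ∀ a ∈ {a : ℝ × E3 | 0 < a.1}, a.1 ≠ 0 := fun a ha => ne_of_gt ha
  refine ContinuousOn.mul (ContinuousOn.sub (ContinuousOn.div (by fun_prop) (by fun_prop) ?_)
    (ContinuousOn.div (by fun_prop) (by fun_prop) ?_))
    (ContinuousOn.mul (ContinuousOn.rpow_const (by fun_prop) h4)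
    (ContinuousOn.rexp (ContinuousOn.div (by fun_prop) (by fun_prop) ?_)))
  all_goals intro a ha; have := h5 a ha; positivity

theorem integral_heatK {t : ℝ} (ht : 0 < t) : ∫ z, heatK t z = 1 := by
  have := GaussianFourier.integral_rexp_neg_mul_sq_norm (V := E3) (b := 1 / (4 * t)) (by positivity)
  unfold heatK
  rw [integral_const_mul]
  have e : ∀ z : E3, -‖z‖ ^ 2 / (4 * t) = -(1 / (4 * t)) * ‖z‖ ^ 2 := fun z => by ring
  simp_rw [e]
  rw [this]
  have e2 : Real.pi / (1 / (4 * t)) = 4 * Real.pi * t := by field_simp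
  rw [e2]
  simp only [finrank_euclideanSpace, Fintype.card_fin]
  rw [← Real.rpow_add (by positivity)]
  norm_num

theorem integrable_heatK {t : ℝ} (ht : 0 < t) : Integrable (heatK t) := by
  -- A nonintegrable function has integral 0 by convention, whereas this integral is 1.
  by_contra h
  have := integral_heatK ht
  rw [integral_undef h] at this
  norm_num at this

/-! ### Differentiating convolutions with compactly supported functions -/

section Gconv

variable {f : E3 → ℝ}

theorem integrable_gconv {κ : E3 → ℝ} (hκ : Continuous κ) (hf : Continuous f)
    (hf' : HasCompactSupport f) (x : E3) : Integrable (fun y => κ (x - y) * f y) :=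
  ((hκ.comp (continuous_const.sub continuous_id)).mul hf).integrable_of_hasCompactSupport
    hf'.mul_left

theorem continuous_gconv {κ : E3 → ℝ} (hκ : Continuous κ) (hf : Continuous f)
    (hf' : HasCompactSupport f) : Continuous (gconv κ f) := by
  have h : Continuous (Function.uncurry fun x y : E3 => κ (x - y) * f y) := by
    unfold Function.uncurry; fun_prop
  have := continuous_parametric_integral_of_continuous (μ := volume) h hf'
  convert this using 2 with x
  exact (setIntegral_eq_integral_of_forall_compl_eq_zero fun y hy => by
    rw [image_eq_zero_of_notMem_tsupport hy, mul_zero]).symm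

/-- On the compact product of a smaller closed ball of parameters and the support of f, the
continuous κ' is bounded by some C, so C|f| dominates the differentiated integrand. -/
theorem hasDerivAt_integral_mul_of_compactSupport (hf : Continuous f)
    (hf' : HasCompactSupport f) {κ κ' : ℝ → E3 → ℝ} {s₀ ε : ℝ} (hε : 0 < ε)
    (hκc : ∀ s, Continuous (κ s))
    (hκ : ∀ s ∈ Metric.ball s₀ ε, ∀ y, HasDerivAt (fun s => κ s y) (κ' s y) s)
    (hκ' : ContinuousOn (fun a : ℝ × E3 => κ' a.1 a.2) (Metric.ball s₀ ε ×ˢ Set.univ)) :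
    HasDerivAt (fun s => ∫ y, κ s y * f y) (∫ y, κ' s₀ y * f y) s₀ := by
  have hcomp : IsCompact (Metric.closedBall s₀ (ε / 2) ×ˢ tsupport f) :=
    (isCompact_closedBall _ _).prod hf'
  have hsub : Metric.closedBall s₀ (ε / 2) ⊆ Metric.ball s₀ ε :=
    Metric.closedBall_subset_ball (by linarith)
  obtain ⟨C, hC⟩ := hcomp.exists_bound_of_continuousOn
    (hκ'.mono (Set.prod_mono hsub (Set.subset_univ _)))
  have hcs : ∀ s ∈ Metric.ball s₀ ε, Continuous (κ' s) := fun s hs => by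
    rw [← continuousOn_univ]
    exact hκ'.comp (f := fun y => (s, y)) (by fun_prop) fun y _ => ⟨hs, trivial⟩
  have h0 : s₀ ∈ Metric.ball s₀ ε := Metric.mem_ball_self hε
  refine (hasDerivAt_integral_of_dominated_loc_of_deriv_le (μ := volume)
    (F := fun s y => κ s y * f y) (F' := fun s y => κ' s y * f y)
    (bound := fun y => C * ‖f y‖) (Metric.ball_mem_nhds s₀ (half_pos hε)) ?_ ?_ ?_ ?_ ?_ ?_).2
  · exact Eventually.of_forall fun s => ((hκc s).mul hf).aestronglyMeasurable
  · exact ((hκc s₀).mul hf).integrable_of_hasCompactSupport hf'.mul_left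
  · exact ((hcs s₀ h0).mul hf).aestronglyMeasurable
  · refine Eventually.of_forall fun y s hs => ?_
    rw [norm_mul]
    by_cases hy : y ∈ tsupport f
    · exact mul_le_mul_of_nonneg_right (hC (s, y) ⟨Metric.ball_subset_closedBall hs, hy⟩)
        (norm_nonneg _)
    · rw [image_eq_zero_of_notMem_tsupport hy]; simp
  · exact (hf.norm.integrable_of_hasCompactSupport hf'.norm).const_mul C
  · exact Eventually.of_forall fun y s hs =>
      (hκ s (Metric.ball_subset_ball (by linarith) hs) y).mul_const (f y)

theorem hasLineDerivAt_gconv (hf : Continuous f) (hf' : HasCompactSupport f) {κ κ' : E3 → ℝ}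
    {k : Fin 3} (hκc : Continuous κ) (hκ'c : Continuous κ')
    (hκ : ∀ z (s : ℝ), HasDerivAt (fun s : ℝ => κ (z + s • e3 k)) (κ' (z + s • e3 k)) s)
    (x : E3) : HasLineDerivAt ℝ (gconv κ f) (gconv κ' f x) x (e3 k) := by
  have := hasDerivAt_integral_mul_of_compactSupport hf hf' (s₀ := 0) (ε := 1) one_pos
    (κ := fun s y => κ (x - y + s • e3 k)) (κ' := fun s y => κ' (x - y + s • e3 k))
    (fun s => by fun_prop) (fun s _ y => hκ _ _) (by fun_prop)
  simp only [HasLineDerivAt, gconv]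
  refine (this.congr_deriv (by simp)).congr_of_eventuallyEq (Eventually.of_forall fun s => ?_)
  refine integral_congr_ae (Eventually.of_forall fun y => ?_)
  simp only [add_sub_right_comm]

theorem hasDerivAt_gconv_time (hf : Continuous f) (hf' : HasCompactSupport f) {t : ℝ}
    (ht : 0 < t) (x : E3) :
    HasDerivAt (fun t => gconv (heatK t) f x) (∑ k, gconv (heatK2 k t) f x) t := by
  have hpos : ∀ s ∈ Metric.ball t t, 0 < s := fun s hs => by
    rw [Metric.mem_ball, Real.dist_eq, abs_lt] at hs; linarith
  have := hasDerivAt_integral_mul_of_compactSupport hf hf' (s₀ := t) (ε := t) ht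
    (κ := fun s y => heatK s (x - y)) (κ' := fun s y => ∑ k, heatK2 k s (x - y))
    (fun s => by have := continuous_heatK s; fun_prop)
    (fun s hs y => hasDerivAt_heatK_time (hpos s hs) _) ?_
  · refine this.congr_deriv ?_
    simp_rw [Finset.sum_mul]
    exact integral_finsetSum _ fun k _ => integrable_gconv (continuous_heatK2 k t) hf hf' x
  · refine continuousOn_finsetSum _ fun k _ => ?_
    refine (continuousOn_heatK2 k).comp (f := fun a : ℝ × E3 => (a.1, x - a.2)) (by fun_prop) ?_
    intro a ha; exact hpos _ ha.1

end Gconv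

/-! ### Integrability against Gaussians -/

section GaussianIntegrability

theorem integrable_exp_neg_mul_sq_norm {c : ℝ} (hc : 0 < c) :
    Integrable (fun x : E3 => Real.exp (-c * ‖x‖ ^ 2)) := by
  by_contra h
  have := GaussianFourier.integral_rexp_neg_mul_sq_norm (V := E3) hc
  rw [integral_undef h] at this
  have h2 : 0 < (Real.pi / c) ^ ((Module.finrank ℝ E3 : ℝ) / 2) := by positivity
  exact h2.ne this

/-- The polynomial is at most n! e^(1+|x|), and the linear exponent is absorbed into half of the
Gaussian by completing the square. -/
theorem integrable_pow_mul_exp {c : ℝ} (hc : 0 < c) (n : ℕ) :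
    Integrable (fun x : E3 => (1 + ‖x‖) ^ n * Real.exp (-c * ‖x‖ ^ 2)) := by
  refine ((integrable_exp_neg_mul_sq_norm (half_pos hc)).const_mul
    (n.factorial * Real.exp (1 + 1 / (2 * c)))).mono' (by fun_prop)
    (Eventually.of_forall fun x => ?_)
  have h0 := norm_nonneg x
  rw [Real.norm_of_nonneg (by positivity)]
  have h1 : (1 + ‖x‖) ^ n ≤ n.factorial * Real.exp (1 + ‖x‖) := by
    have := Real.pow_div_factorial_le_exp (1 + ‖x‖) (by positivity) n
    rw [div_le_iff₀ (by positivity)] at this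
    linarith
  have h2 : 1 + ‖x‖ + -c * ‖x‖ ^ 2 ≤ 1 + 1 / (2 * c) + -(c / 2) * ‖x‖ ^ 2 := by
    have e : 1 / (2 * c) + (c / 2) * ‖x‖ ^ 2 - ‖x‖ = (c * ‖x‖ - 1) ^ 2 / (2 * c) := by
      field_simp; ring
    have : 0 ≤ (c * ‖x‖ - 1) ^ 2 / (2 * c) := by positivity
    linarith
  calc (1 + ‖x‖) ^ n * Real.exp (-c * ‖x‖ ^ 2)
      ≤ n.factorial * Real.exp (1 + ‖x‖) * Real.exp (-c * ‖x‖ ^ 2) := by gcongr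
    _ = n.factorial * Real.exp (1 + ‖x‖ + -c * ‖x‖ ^ 2) := by rw [Real.exp_add (1 + ‖x‖), mul_assoc]
    _ ≤ n.factorial * Real.exp (1 + 1 / (2 * c) + -(c / 2) * ‖x‖ ^ 2) := by gcongr
    _ = _ := by rw [Real.exp_add _ (-(c / 2) * ‖x‖ ^ 2), mul_assoc]

/-- Integration by parts against the constant 1. -/
theorem integral_lineDeriv_eq_zero {F F' : E3 → ℝ} {v : E3} (hF : Integrable F)
    (hF' : Integrable F') (h : ∀ x, HasLineDerivAt ℝ F (F' x) x v) : ∫ x, F' x = 0 := by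
  have := integral_bilinear_hasLineDerivAt_right_eq_neg_left_of_integrable (μ := volume)
    (f := fun _ => (1 : ℝ)) (f' := fun _ => 0) (g := F) (g' := F') (v := v)
    (B := ContinuousLinearMap.mul ℝ ℝ) (by simp) (by simpa using hF') (by simpa using hF)
    (fun x _ => by simpa [HasLineDerivAt] using hasDerivAt_const (0 : ℝ) (1 : ℝ))
    (fun x _ => h x)
  simpa using this

end GaussianIntegrability

/-! ### Heat flows with a Gaussian majorant -/

/-- A solution `u` of the heat equation with spatial derivatives `u1 k = ∂ₖ u`, `u2 k = ∂ₖ² u`,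
controlled, uniformly on compact time intervals, by a Gaussian majorant `w`. -/
structure IsGaussianHeatFlow (u : ℝ → E3 → ℝ) (u1 u2 : Fin 3 → ℝ → E3 → ℝ)
    (w : ℝ → E3 → ℝ) : Prop where
  cont : ∀ t, Continuous (u t)
  cont1 : ∀ k t, Continuous (u1 k t)
  cont2 : ∀ k t, Continuous (u2 k t)
  line : ∀ k t x, HasLineDerivAt ℝ (u t) (u1 k t x) x (e3 k)
  line1 : ∀ k t x, HasLineDerivAt ℝ (u1 k t) (u2 k t x) x (e3 k)
  time : ∀ t, 0 < t → ∀ x, HasDerivAt (fun t => u t x) (∑ k, u2 k t x) t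
  le : ∀ t, 0 < t → ∀ x, |u t x| ≤ w t x
  bound : ∀ a b, 0 < a → a ≤ b → ∃ C c : ℝ, 0 ≤ C ∧ 0 < c ∧ ∀ t ∈ Set.Icc a b, ∀ x,
    w t x ≤ C * Real.exp (-c * ‖x‖ ^ 2) ∧
    ∀ k, |u1 k t x| ≤ C * (1 + ‖x‖) * w t x ∧ |u2 k t x| ≤ C * (1 + ‖x‖) ^ 2 * w t x

namespace IsGaussianHeatFlow

variable {u v : ℝ → E3 → ℝ} {u1 u2 v1 v2 : Fin 3 → ℝ → E3 → ℝ} {w w' : ℝ → E3 → ℝ}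

/-- Crude absolute bounds, with a common Gaussian. -/
theorem bound_abs (hu : IsGaussianHeatFlow u u1 u2 w) {a b : ℝ} (ha : 0 < a) (hab : a ≤ b) :
    ∃ C c : ℝ, 0 ≤ C ∧ 0 < c ∧ ∀ t ∈ Set.Icc a b, ∀ x,
      |u t x| ≤ C * (1 + ‖x‖) ^ 2 * Real.exp (-c * ‖x‖ ^ 2) ∧
      ∀ k, |u1 k t x| ≤ C * (1 + ‖x‖) ^ 2 * Real.exp (-c * ‖x‖ ^ 2) ∧
        |u2 k t x| ≤ C * (1 + ‖x‖) ^ 2 * Real.exp (-c * ‖x‖ ^ 2) := by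
  obtain ⟨C, c, hC, hc, h⟩ := hu.bound a b ha hab
  refine ⟨C + C ^ 2, c, by positivity, hc, fun t ht x => ?_⟩
  obtain ⟨h1, h2⟩ := h t ht x
  have h0 := norm_nonneg x
  have ht0 : 0 < t := ha.trans_le ht.1
  have hw : 0 ≤ w t x := (abs_nonneg _).trans (hu.le t ht0 x)
  have hone : 1 ≤ 1 + ‖x‖ := by linarith
  have hone2 : 1 ≤ (1 + ‖x‖) ^ 2 := one_le_pow₀ hone
  have hone3 : 1 + ‖x‖ ≤ (1 + ‖x‖) ^ 2 := by nlinarith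
  have he := Real.exp_pos (-c * ‖x‖ ^ 2)
  have key : C * (1 + ‖x‖) ^ 2 * w t x
      ≤ (C + C ^ 2) * (1 + ‖x‖) ^ 2 * Real.exp (-c * ‖x‖ ^ 2) := by
    calc C * (1 + ‖x‖) ^ 2 * w t x ≤ C * (1 + ‖x‖) ^ 2 * (C * Real.exp (-c * ‖x‖ ^ 2)) := by gcongr
      _ = C ^ 2 * (1 + ‖x‖) ^ 2 * Real.exp (-c * ‖x‖ ^ 2) := by ring
      _ ≤ _ := by gcongr; linarith
  refine ⟨?_, fun k => ⟨?_, ?_⟩⟩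
  · calc |u t x| ≤ C * 1 * Real.exp (-c * ‖x‖ ^ 2) := by
          rw [mul_one]; exact (hu.le t ht0 x).trans h1
      _ ≤ _ := by gcongr; nlinarith
  · refine ((h2 k).1.trans ?_).trans key
    gcongr
  · exact (h2 k).2.trans key

theorem integrable_of_le {g : E3 → ℝ} (hg : AEStronglyMeasurable g) {C c : ℝ} {n : ℕ} (hc : 0 < c)
    (h : ∀ x, |g x| ≤ C * (1 + ‖x‖) ^ n * Real.exp (-c * ‖x‖ ^ 2)) : Integrable g :=
  ((integrable_pow_mul_exp hc n).const_mul C).mono' hg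
    (Eventually.of_forall fun x => by rw [Real.norm_eq_abs, ← mul_assoc]; exact h x)

theorem abs_mul_le {a b C C' c c' r : ℝ} (hC : 0 ≤ C) (hC' : 0 ≤ C') (hc' : 0 < c')
    (ha : |a| ≤ C * (1 + r) ^ 2 * Real.exp (-c * r ^ 2))
    (hb : |b| ≤ C' * (1 + r) ^ 2 * Real.exp (-c' * r ^ 2)) :
    |a * b| ≤ C * C' * (1 + r) ^ 4 * Real.exp (-c * r ^ 2) := by
  rw [abs_mul]
  have h1 : Real.exp (-c' * r ^ 2) ≤ 1 := by
    rw [Real.exp_le_one_iff]; nlinarith [sq_nonneg r]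
  have hb' : |b| ≤ C' * (1 + r) ^ 2 := hb.trans (mul_le_of_le_one_right (by positivity) h1)
  calc |a| * |b| ≤ (C * (1 + r) ^ 2 * Real.exp (-c * r ^ 2)) * (C' * (1 + r) ^ 2) :=
        mul_le_mul ha hb' (abs_nonneg _) (by positivity)
    _ = _ := by ring

/-- Two integrations by parts: the second derivative is symmetric. Hence the derivative of a pairing
of two flows can be written with all derivatives on one of them. -/
theorem integral_mul_u2 (hu : IsGaussianHeatFlow u u1 u2 w) (hv : IsGaussianHeatFlow v v1 v2 w')
    {t : ℝ} (ht : 0 < t) (k : Fin 3) :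
    ∫ x, u2 k t x * v t x = ∫ x, u t x * v2 k t x := by
  obtain ⟨C, c, hC, hc, h⟩ := hu.bound_abs ht le_rfl
  obtain ⟨C', c', hC', hc', h'⟩ := hv.bound_abs ht le_rfl
  have hm : t ∈ Set.Icc t t := ⟨le_rfl, le_rfl⟩
  have cu := hu.cont t; have cv := hv.cont t; have cu1 := hu.cont1 k t
  have cv1 := hv.cont1 k t; have cu2 := hu.cont2 k t; have cv2 := hv.cont2 k t
  have i1 : Integrable (fun x => u2 k t x * v t x) :=
    integrable_of_le (by fun_prop) hc fun x => abs_mul_le hC hC' hc' ((h t hm x).2 k).2 (h' t hm x).1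
  have i2 : Integrable (fun x => u1 k t x * v t x) :=
    integrable_of_le (by fun_prop) hc fun x => abs_mul_le hC hC' hc' ((h t hm x).2 k).1 (h' t hm x).1
  have i3 : Integrable (fun x => u1 k t x * v1 k t x) :=
    integrable_of_le (by fun_prop) hc fun x =>
      abs_mul_le hC hC' hc' ((h t hm x).2 k).1 ((h' t hm x).2 k).1
  have i4 : Integrable (fun x => u t x * v1 k t x) :=
    integrable_of_le (by fun_prop) hc fun x => abs_mul_le hC hC' hc' (h t hm x).1 ((h' t hm x).2 k).1
  have i5 : Integrable (fun x => u t x * v2 k t x) :=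
    integrable_of_le (by fun_prop) hc fun x => abs_mul_le hC hC' hc' (h t hm x).1 ((h' t hm x).2 k).2
  have e1 := integral_bilinear_hasLineDerivAt_right_eq_neg_left_of_integrable (μ := volume)
    (f := u1 k t) (f' := u2 k t) (g := v t) (g' := v1 k t) (v := e3 k)
    (B := ContinuousLinearMap.mul ℝ ℝ) i1 i3 i2
    (fun x _ => hu.line1 k t x) (fun x _ => hv.line k t x)
  have e2 := integral_bilinear_hasLineDerivAt_right_eq_neg_left_of_integrable (μ := volume)
    (f := u t) (f' := u1 k t) (g := v1 k t) (g' := v2 k t) (v := e3 k)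
    (B := ContinuousLinearMap.mul ℝ ℝ) i3 i5 i4
    (fun x _ => hu.line k t x) (fun x _ => hv.line1 k t x)
  simp only [ContinuousLinearMap.mul_apply'] at e1 e2
  rw [e2, e1, neg_neg]

theorem hasDerivAt_integral_mul (hu : IsGaussianHeatFlow u u1 u2 w)
    (hv : IsGaussianHeatFlow v v1 v2 w') {t : ℝ} (ht : 0 < t) :
    HasDerivAt (fun t => ∫ x, u t x * v t x) (2 * ∫ x, u t x * ∑ k, v2 k t x) t := by
  obtain ⟨C, c, hC, hc, h⟩ := hu.bound_abs (half_pos ht) (by linarith : t / 2 ≤ 2 * t)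
  obtain ⟨C', c', hC', hc', h'⟩ := hv.bound_abs (half_pos ht) (by linarith : t / 2 ≤ 2 * t)
  have hball : ∀ s ∈ Metric.ball t (t / 2), s ∈ Set.Icc (t / 2) (2 * t) := fun s hs => by
    rw [Metric.mem_ball, Real.dist_eq, abs_lt] at hs; constructor <;> linarith
  have hm : t ∈ Set.Icc (t / 2) (2 * t) := by constructor <;> linarith
  have cu := hu.cont; have cv := hv.cont
  have cu2 := hu.cont2; have cv2 := hv.cont2
  have i1 : ∀ k, Integrable (fun x => u2 k t x * v t x) := fun k =>
    integrable_of_le ((cu2 k t).mul (cv t)).aestronglyMeasurable hc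
      fun x => abs_mul_le hC hC' hc' ((h t hm x).2 k).2 (h' t hm x).1
  have i5 : ∀ k, Integrable (fun x => u t x * v2 k t x) := fun k =>
    integrable_of_le ((cu t).mul (cv2 k t)).aestronglyMeasurable hc
      fun x => abs_mul_le hC hC' hc' (h t hm x).1 ((h' t hm x).2 k).2
  refine (hasDerivAt_integral_of_dominated_loc_of_deriv_le (μ := volume)
    (F := fun s x => u s x * v s x)
    (F' := fun s x => (∑ k, u2 k s x) * v s x + u s x * ∑ k, v2 k s x)
    -- Six products: three second derivatives on each of the two factors.
    (bound := fun x => 6 * (C * C' * (1 + ‖x‖) ^ 4 * Real.exp (-c * ‖x‖ ^ 2)))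
    (Metric.ball_mem_nhds t (half_pos ht)) ?_ ?_ ?_ ?_ ?_ ?_).2.congr_deriv ?_
  · exact Eventually.of_forall fun s => ((cu s).mul (cv s)).aestronglyMeasurable
  · exact integrable_of_le ((cu t).mul (cv t)).aestronglyMeasurable hc
      fun x => abs_mul_le hC hC' hc' (h t hm x).1 (h' t hm x).1
  · exact Continuous.aestronglyMeasurable (by
      have := cu t; have := cv t; have := fun k => cu2 k t; have := fun k => cv2 k t
      fun_prop)
  · refine Eventually.of_forall fun x s hs => ?_
    have hs' := hball s hs
    have b1 := fun k => abs_mul_le hC hC' hc' ((h s hs' x).2 k).2 (h' s hs' x).1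
    have b2 := fun k => abs_mul_le hC hC' hc' (h s hs' x).1 ((h' s hs' x).2 k).2
    rw [Finset.sum_mul, Finset.mul_sum, Real.norm_eq_abs]
    refine (abs_add_le _ _).trans ((add_le_add (Finset.abs_sum_le_sum_abs _ _)
      (Finset.abs_sum_le_sum_abs _ _)).trans ?_)
    simp only [Fin.sum_univ_three]
    linarith [b1 0, b1 1, b1 2, b2 0, b2 1, b2 2]
  · simp_rw [mul_assoc (C * C')]
    exact ((integrable_pow_mul_exp hc 4).const_mul _).const_mul _
  · refine Eventually.of_forall fun x s hs => ?_
    have hs0 : 0 < s := (half_pos ht).trans_le (hball s hs).1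
    exact (hu.time s hs0 x).mul (hv.time s hs0 x)
  · simp_rw [Finset.sum_mul, Finset.mul_sum]
    rw [integral_add (integrable_finsetSum _ fun k _ => i1 k)
      (integrable_finsetSum _ fun k _ => i5 k), integral_finsetSum _ fun k _ => i1 k,
      integral_finsetSum _ fun k _ => i5 k, two_mul]
    congr 1
    exact Finset.sum_congr rfl fun k _ => integral_mul_u2 hu hv ht k

end IsGaussianHeatFlow

theorem measurable_bel1 (p q : ℝ) : Measurable fun a : ℝ × ℝ => bel1 p q a.1 a.2 := by
  unfold bel1 belX; fun_prop

theorem measurable_bel2 (p q K : ℝ) : Measurable fun a : ℝ × ℝ => bel2 p q K a.1 a.2 := by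
  unfold bel2 belX; fun_prop

theorem measurable_bel (p q K : ℝ) : Measurable fun a : ℝ × ℝ => bel p q K a.1 a.2 := by
  unfold bel belX; fun_prop

theorem measurable_belQ (p q K : ℝ) :
    Measurable fun a : (ℝ × ℝ) × (ℝ × ℝ) => belQ p q K a.1.1 a.1.2 a.2.1 a.2.2 := by
  unfold belQ bel1 bel2 belX; fun_prop

attribute [local irreducible] bel bel1 bel2 belQ

/-! ### The Bellman energy along two positive heat flows -/

namespace IsGaussianHeatFlow

variable {u v : ℝ → E3 → ℝ} {u1 u2 v1 v2 : Fin 3 → ℝ → E3 → ℝ} {p q : ℝ}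

/-- Uniform bounds for two positive flows, in terms of logarithmic derivatives. -/
theorem log_bounds (hu : IsGaussianHeatFlow u u1 u2 u) (hv : IsGaussianHeatFlow v v1 v2 v)
    (hu0 : ∀ t, 0 < t → ∀ x, 0 < u t x) (hv0 : ∀ t, 0 < t → ∀ x, 0 < v t x)
    (hp : 1 ≤ p) (hq : 1 ≤ q) {a b : ℝ} (ha : 0 < a) (hab : a ≤ b) :
    ∃ C c : ℝ, 0 ≤ C ∧ 0 < c ∧ ∀ t ∈ Set.Icc a b, ∀ x,
      u t x ^ p + v t x ^ q ≤ C * Real.exp (-c * ‖x‖ ^ 2) ∧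
      ∀ k, |u1 k t x / u t x| ≤ C * (1 + ‖x‖) ∧ |u2 k t x / u t x| ≤ C * (1 + ‖x‖) ^ 2 ∧
        |v1 k t x / v t x| ≤ C * (1 + ‖x‖) ∧ |v2 k t x / v t x| ≤ C * (1 + ‖x‖) ^ 2 := by
  obtain ⟨C, c, hC, hc, h⟩ := hu.bound a b ha hab
  obtain ⟨C', c', hC', hc', h'⟩ := hv.bound a b ha hab
  -- A Gaussian raised to a power r ≥ 1 decays at least as fast as before, so u^p and v^q share the
  -- slower of the two rates.
  have aux : ∀ {C c m r s : ℝ} {y : ℝ}, 0 ≤ C → 0 < c → 1 ≤ r → m ≤ c → 0 < y →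
      y ≤ C * Real.exp (-c * s ^ 2) → y ^ r ≤ C ^ r * Real.exp (-m * s ^ 2) := by
    intro C c m r s y hC hc hr hm hy hle
    calc y ^ r ≤ (C * Real.exp (-c * s ^ 2)) ^ r := Real.rpow_le_rpow hy.le hle (by linarith)
      _ = C ^ r * Real.exp (-c * s ^ 2 * r) := by
          rw [Real.mul_rpow hC (Real.exp_pos _).le, ← Real.exp_mul]
      _ ≤ _ := by
          refine mul_le_mul_of_nonneg_left (Real.exp_le_exp.2 ?_) (by positivity)
          have h1 : 0 ≤ c * s ^ 2 := by positivity
          nlinarith [mul_le_mul_of_nonneg_right hm (sq_nonneg s), mul_le_mul_of_nonneg_left hr h1]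
  refine ⟨C ^ p + C' ^ q + C + C', min c c', by positivity, lt_min hc hc', fun t ht x => ?_⟩
  have ht0 : 0 < t := ha.trans_le ht.1
  obtain ⟨h1, h2⟩ := h t ht x
  obtain ⟨h1', h2'⟩ := h' t ht x
  have pu := hu0 t ht0 x
  have pv := hv0 t ht0 x
  have n1 : 0 ≤ C ^ p := by positivity
  have n2 : 0 ≤ C' ^ q := by positivity
  have hle : C ≤ C ^ p + C' ^ q + C + C' := by linarith
  have hle' : C' ≤ C ^ p + C' ^ q + C + C' := by linarith
  have dv : ∀ {a y D E r : ℝ}, 0 < y → 0 ≤ r → |a| ≤ D * r * y → D ≤ E → |a / y| ≤ E * r := by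
    intro a y D E r hy hr h hDE
    rw [abs_div, abs_of_pos hy, div_le_iff₀ hy]
    exact h.trans (by gcongr)
  refine ⟨?_, fun k => ⟨?_, ?_, ?_, ?_⟩⟩
  · have b1 := aux (r := p) hC hc hp (min_le_left c c') pu h1
    have b2 := aux (r := q) hC' hc' hq (min_le_right c c') pv h1'
    have he := Real.exp_pos (-min c c' * ‖x‖ ^ 2)
    nlinarith
  · exact dv pu (by positivity) (h2 k).1 hle
  · exact dv pu (by positivity) (h2 k).2 hle
  · exact dv pv (by positivity) (h2' k).1 hle'
  · exact dv pv (by positivity) (h2' k).2 hle'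

theorem exists_bel_bounds (hp : 2 ≤ p) (hpq : 1 / p + 1 / q = 1) (hq : 1 < q) :
    ∃ D : ℝ, 0 ≤ D ∧ ∀ u v : ℝ, 0 < u → 0 < v →
      |bel1 p q u v| ≤ D * (u ^ p + v ^ q) ∧ |bel2 p q (belK q) u v| ≤ D * (u ^ p + v ^ q) ∧
      ∀ U V, |belQ p q (belK q) u v U V| ≤ D * (u ^ p + v ^ q) * (U ^ 2 + V ^ 2) := by
  have hKp := belK_pos hq
  have hq1 : 0 < q - 1 := by linarith
  have n1 : 0 ≤ (1 + belK q) * q := by positivity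
  have n2 : 0 ≤ 2 + p * (3 + p) + 3 + belK q * (q * (q - 1)) := by positivity
  refine ⟨p + (1 + belK q) * q + (2 + p * (3 + p) + 3 + belK q * (q * (q - 1))), by linarith,
    fun u v hu hv => ?_⟩
  have hM : 0 ≤ u ^ p + v ^ q := by positivity
  refine ⟨(abs_bel1_le hp hu hv).trans (mul_le_mul_of_nonneg_right (by linarith) hM),
    (abs_bel2_le hp hq hu hv).trans (mul_le_mul_of_nonneg_right (by linarith) hM),
    fun U V => (abs_belQ_le hp hpq hq hu hv U V).trans ?_⟩
  exact mul_le_mul_of_nonneg_right (mul_le_mul_of_nonneg_right (by linarith) hM) (by positivity)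

/-- The Bellman function and its logarithmic derivatives are at most a multiple of u^p + v^q, which
is Gaussian, while the logarithmic derivatives of the flows grow polynomially. The products are
integrable uniformly for times in a compact interval, which supplies the domination needed to
differentiate the energy. -/
theorem bel_flow_bounds (hu : IsGaussianHeatFlow u u1 u2 u)
    (hv : IsGaussianHeatFlow v v1 v2 v)
    (hu0 : ∀ t, 0 < t → ∀ x, 0 < u t x) (hv0 : ∀ t, 0 < t → ∀ x, 0 < v t x)
    (hp : 2 ≤ p) (hpq : 1 / p + 1 / q = 1) (hq : 1 < q) {a b : ℝ} (ha : 0 < a) (hab : a ≤ b) :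
    ∃ C c : ℝ, 0 < c ∧ ∀ t ∈ Set.Icc a b, ∀ x,
      |bel p q (belK q) (u t x) (v t x)| ≤ C * (1 + ‖x‖) ^ 0 * Real.exp (-c * ‖x‖ ^ 2) ∧ ∀ k,
      |bel1 p q (u t x) (v t x) * (u2 k t x / u t x)
        + bel2 p q (belK q) (u t x) (v t x) * (v2 k t x / v t x)|
        ≤ C * (1 + ‖x‖) ^ 2 * Real.exp (-c * ‖x‖ ^ 2) ∧
      |bel1 p q (u t x) (v t x) * (u1 k t x / u t x)
        + bel2 p q (belK q) (u t x) (v t x) * (v1 k t x / v t x)|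
        ≤ C * (1 + ‖x‖) ^ 1 * Real.exp (-c * ‖x‖ ^ 2) ∧
      |belQ p q (belK q) (u t x) (v t x) (u1 k t x / u t x) (v1 k t x / v t x)|
        ≤ C * (1 + ‖x‖) ^ 2 * Real.exp (-c * ‖x‖ ^ 2) := by
  obtain ⟨C, c, hC, hc, h⟩ := log_bounds hu hv hu0 hv0 (by linarith : 1 ≤ p) hq.le ha hab
  obtain ⟨D, hD0, hD⟩ := exists_bel_bounds hp hpq hq
  have hK := belK_pos hq
  refine ⟨(1 + belK q) * C + 2 * D * C * C + 2 * D * C * C ^ 2, c, hc, fun t ht x => ?_⟩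
  have ht0 : 0 < t := ha.trans_le ht.1
  obtain ⟨hM, hk⟩ := h t ht x
  have hx0 := norm_nonneg x
  have pu := hu0 t ht0 x
  have pv := hv0 t ht0 x
  have hM0 : 0 ≤ u t x ^ p + v t x ^ q := by positivity
  obtain ⟨d1, d2, d3⟩ := hD _ _ pu pv
  have he := Real.exp_pos (-c * ‖x‖ ^ 2)
  generalize Real.exp (-c * ‖x‖ ^ 2) = E at *
  have b1 := d1.trans (mul_le_mul_of_nonneg_left hM hD0)
  have b2 := d2.trans (mul_le_mul_of_nonneg_left hM hD0)
  have w1 : 2 * D * C * C ≤ (1 + belK q) * C + 2 * D * C * C + 2 * D * C * C ^ 2 := by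
    have : 0 ≤ (1 + belK q) * C + 2 * D * C * C ^ 2 := by positivity
    linarith
  have w2 : 2 * D * C * C ^ 2 ≤ (1 + belK q) * C + 2 * D * C * C + 2 * D * C * C ^ 2 := by
    have : 0 ≤ (1 + belK q) * C + 2 * D * C * C := by positivity
    linarith
  have w0 : (1 + belK q) * C ≤ (1 + belK q) * C + 2 * D * C * C + 2 * D * C * C ^ 2 := by
    have : 0 ≤ 2 * D * C * C + 2 * D * C * C ^ 2 := by positivity
    linarith
  have comb : ∀ {b1 b2 U V : ℝ} {n : ℕ}, |b1| ≤ D * (C * E) →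
      |b2| ≤ D * (C * E) → |U| ≤ C * (1 + ‖x‖) ^ n →
      |V| ≤ C * (1 + ‖x‖) ^ n → |b1 * U + b2 * V|
        ≤ ((1 + belK q) * C + 2 * D * C * C + 2 * D * C * C ^ 2) * (1 + ‖x‖) ^ n * E := by
    intro b1 b2 U V n h1 h2 h3 h4
    have e1 := mul_le_mul h1 h3 (abs_nonneg _) (by positivity)
    have e2 := mul_le_mul h2 h4 (abs_nonneg _) (by positivity)
    have : |b1 * U + b2 * V| ≤ 2 * D * C * C * (1 + ‖x‖) ^ n * E := by
      refine (abs_add_le _ _).trans ?_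
      rw [abs_mul, abs_mul]
      linarith
    refine this.trans ?_
    gcongr
  refine ⟨?_, fun k => ⟨?_, ?_, ?_⟩⟩
  · rw [abs_of_nonneg (bel_nonneg hq pu pv), pow_zero, mul_one]
    refine (bel_le hp hq pu pv).trans ?_
    calc (1 + belK q) * (u t x ^ p + v t x ^ q) ≤ (1 + belK q) * (C * E) := by gcongr
      _ = (1 + belK q) * C * E := by ring
      _ ≤ _ := by gcongr
  · exact comb b1 b2 (hk k).2.1 (hk k).2.2.2
  · exact comb b1 b2 (by simpa using (hk k).1) (by simpa using (hk k).2.2.1)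
  · have e1 := pow_le_pow_left₀ (abs_nonneg _) (hk k).1 2
    have e2 := pow_le_pow_left₀ (abs_nonneg _) (hk k).2.2.1 2
    rw [sq_abs] at e1 e2
    refine (d3 _ _).trans ?_
    have := mul_le_mul (mul_le_mul_of_nonneg_left hM hD0) (add_le_add e1 e2)
      (by positivity) (by positivity)
    calc D * (u t x ^ p + v t x ^ q) * ((u1 k t x / u t x) ^ 2 + (v1 k t x / v t x) ^ 2)
        ≤ 2 * D * C * C ^ 2 * (1 + ‖x‖) ^ 2 * E := by linarith
      _ ≤ _ := by gcongr

/-- The k-th partial derivative of B(u,v) is integrable, and so is its own k-th derivative, the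
Hessian term plus the gradient term; hence the latter has integral zero. -/
theorem bel_flow_ibp (hu : IsGaussianHeatFlow u u1 u2 u)
    (hv : IsGaussianHeatFlow v v1 v2 v)
    (hu0 : ∀ t, 0 < t → ∀ x, 0 < u t x) (hv0 : ∀ t, 0 < t → ∀ x, 0 < v t x)
    (hp : 2 ≤ p) (hpq : 1 / p + 1 / q = 1) (hq : 1 < q) {t : ℝ} (ht : 0 < t) (k : Fin 3) :
    Integrable (fun x => belQ p q (belK q) (u t x) (v t x) (u1 k t x / u t x)
      (v1 k t x / v t x)) ∧
    Integrable (fun x => bel1 p q (u t x) (v t x) * (u2 k t x / u t x)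
        + bel2 p q (belK q) (u t x) (v t x) * (v2 k t x / v t x)) ∧
    ∫ x, (bel1 p q (u t x) (v t x) * (u2 k t x / u t x)
        + bel2 p q (belK q) (u t x) (v t x) * (v2 k t x / v t x)) =
      -∫ x, belQ p q (belK q) (u t x) (v t x) (u1 k t x / u t x) (v1 k t x / v t x) := by
  obtain ⟨C, c, hc, h⟩ := bel_flow_bounds hu hv hu0 hv0 hp hpq hq ht le_rfl
  have hm : t ∈ Set.Icc t t := ⟨le_rfl, le_rfl⟩
  have mu := (hu.cont t).measurable
  have mv := (hv.cont t).measurable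
  have mu1 := (hu.cont1 k t).measurable
  have mv1 := (hv.cont1 k t).measurable
  have mu2 := (hu.cont2 k t).measurable
  have mv2 := (hv.cont2 k t).measurable
  have mB1 : Measurable fun x => bel1 p q (u t x) (v t x) :=
    (measurable_bel1 p q).comp (mu.prodMk mv)
  have mB2 : Measurable fun x => bel2 p q (belK q) (u t x) (v t x) :=
    (measurable_bel2 p q (belK q)).comp (mu.prodMk mv)
  have mQ : Measurable fun x => belQ p q (belK q) (u t x) (v t x) (u1 k t x / u t x)
      (v1 k t x / v t x) :=
    (measurable_belQ p q (belK q)).comp ((mu.prodMk mv).prodMk ((mu1.div mu).prodMk (mv1.div mv)))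
  have iQ := integrable_of_le mQ.aestronglyMeasurable hc fun x => ((h t hm x).2 k).2.2
  have iE : Integrable fun x => bel1 p q (u t x) (v t x) * (u2 k t x / u t x)
      + bel2 p q (belK q) (u t x) (v t x) * (v2 k t x / v t x) := integrable_of_le ((mB1.mul (mu2.div mu)).add
      (mB2.mul (mv2.div mv))).aestronglyMeasurable hc fun x => ((h t hm x).2 k).1
  have iF : Integrable fun x => bel1 p q (u t x) (v t x) * (u1 k t x / u t x)
      + bel2 p q (belK q) (u t x) (v t x) * (v1 k t x / v t x) := integrable_of_le ((mB1.mul (mu1.div mu)).add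
      (mB2.mul (mv1.div mv))).aestronglyMeasurable hc fun x => ((h t hm x).2 k).2.1
  refine ⟨iQ, iE, ?_⟩
  have := integral_lineDeriv_eq_zero (v := e3 k) iF (iQ.add iE) fun x => ?_
  · rw [← sub_eq_zero, sub_neg_eq_add, add_comm, ← integral_add iQ iE]
    exact this
  · have e0 : x + (0 : ℝ) • e3 k = x := by simp
    have := hasDerivAt_bel_deriv (p := p) (q := q) (K := belK q)
      (u := fun s : ℝ => u t (x + s • e3 k)) (v := fun s : ℝ => v t (x + s • e3 k))
      (u' := fun s : ℝ => u1 k t (x + s • e3 k)) (v' := fun s : ℝ => v1 k t (x + s • e3 k))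
      (s := 0) (u2 := u2 k t x) (v2 := v2 k t x)
      (by rw [e0]; exact hu.line k t x) (by rw [e0]; exact hv.line k t x)
      (hu.line1 k t x) (hv.line1 k t x) (hu0 t ht _) (hv0 t ht _)
    simp only [e0] at this
    exact this

/-- Under the integral the time derivative is the gradient of B applied to (Δu, Δv); integrating by
parts in each coordinate turns it into minus the Hessian form on the spatial gradients. -/
theorem hasDerivAt_integral_bel (hu : IsGaussianHeatFlow u u1 u2 u)
    (hv : IsGaussianHeatFlow v v1 v2 v)
    (hu0 : ∀ t, 0 < t → ∀ x, 0 < u t x) (hv0 : ∀ t, 0 < t → ∀ x, 0 < v t x)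
    (hp : 2 ≤ p) (hpq : 1 / p + 1 / q = 1) (hq : 1 < q) {t : ℝ} (ht : 0 < t) :
    Integrable (fun x => ∑ k, belQ p q (belK q) (u t x) (v t x) (u1 k t x / u t x)
        (v1 k t x / v t x)) ∧
    HasDerivAt (fun t => ∫ x, bel p q (belK q) (u t x) (v t x))
      (-∫ x, ∑ k, belQ p q (belK q) (u t x) (v t x) (u1 k t x / u t x) (v1 k t x / v t x)) t := by
  obtain ⟨C, c, hc, h⟩ := bel_flow_bounds hu hv hu0 hv0 hp hpq hq
    (half_pos ht) (by linarith : t / 2 ≤ 2 * t)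
  have hball : ∀ s ∈ Metric.ball t (t / 2), s ∈ Set.Icc (t / 2) (2 * t) := fun s hs => by
    rw [Metric.mem_ball, Real.dist_eq, abs_lt] at hs; constructor <;> linarith
  have hm : t ∈ Set.Icc (t / 2) (2 * t) := by constructor <;> linarith
  have mB : ∀ s, Measurable fun x => bel p q (belK q) (u s x) (v s x) := fun s =>
    (measurable_bel p q (belK q)).comp ((hu.cont s).measurable.prodMk (hv.cont s).measurable)
  have ibp := bel_flow_ibp hu hv hu0 hv0 hp hpq hq ht
  refine ⟨integrable_finsetSum _ fun k _ => (ibp k).1, ?_⟩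
  refine (hasDerivAt_integral_of_dominated_loc_of_deriv_le (μ := volume)
    (F := fun s x => bel p q (belK q) (u s x) (v s x))
    (F' := fun s x => ∑ k, (bel1 p q (u s x) (v s x) * (u2 k s x / u s x)
        + bel2 p q (belK q) (u s x) (v s x) * (v2 k s x / v s x)))
    (bound := fun x => 3 * (C * (1 + ‖x‖) ^ 2 * Real.exp (-c * ‖x‖ ^ 2)))
    (Metric.ball_mem_nhds t (half_pos ht)) ?_ ?_ ?_ ?_ ?_ ?_).2.congr_deriv ?_
  · exact Eventually.of_forall fun s => (mB s).aestronglyMeasurable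
  · exact integrable_of_le (mB t).aestronglyMeasurable hc fun x => (h t hm x).1
  · exact (integrable_finsetSum _ fun k _ => (ibp k).2.1).aestronglyMeasurable
  · refine Eventually.of_forall fun x s hs => ?_
    have b := (h s (hball s hs) x).2
    rw [Real.norm_eq_abs]
    refine (Finset.abs_sum_le_sum_abs _ _).trans ?_
    simp only [Fin.sum_univ_three]
    linarith [(b 0).1, (b 1).1, (b 2).1]
  · simp_rw [mul_assoc C]
    exact ((integrable_pow_mul_exp hc 2).const_mul _).const_mul _
  · refine Eventually.of_forall fun x s hs => ?_
    have hs0 : 0 < s := (half_pos ht).trans_le (hball s hs).1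
    refine (hasDerivAt_bel (p := p) (q := q) (K := belK q) (hu.time s hs0 x) (hv.time s hs0 x)
      (hu0 s hs0 x) (hv0 s hs0 x)).congr_deriv ?_
    simp only [Fin.sum_univ_three]; ring
  · rw [integral_finsetSum _ fun k _ => (ibp k).2.1, integral_finsetSum _ fun k _ => (ibp k).1,
      ← Finset.sum_neg_distrib]
    exact Finset.sum_congr rfl fun k _ => (ibp k).2.2

/-- The Bellman energy of two positive heat flows is bounded, and its decay controls the bilinear
quantity `∫ |∂ᵢu ∂ⱼv|`. -/
theorem exists_energy (hu : IsGaussianHeatFlow u u1 u2 u) (hv : IsGaussianHeatFlow v v1 v2 v)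
    (hu0 : ∀ t, 0 < t → ∀ x, 0 < u t x) (hv0 : ∀ t, 0 < t → ∀ x, 0 < v t x)
    (hp : 2 ≤ p) (hpq : 1 / p + 1 / q = 1) (hq : 1 < q) (i j : Fin 3) :
    ∃ I I' : ℝ → ℝ, ∀ t, 0 < t → HasDerivAt I (I' t) t ∧ 0 ≤ I t ∧
      I t ≤ (1 + belK q) * ((∫ x, u t x ^ p) + ∫ x, v t x ^ q) ∧
      2 * ∫ x, |u1 i t x * v1 j t x| ≤ -I' t := by
  refine ⟨fun t => ∫ x, bel p q (belK q) (u t x) (v t x), _, fun t ht =>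
    ⟨(hasDerivAt_integral_bel hu hv hu0 hv0 hp hpq hq ht).2, integral_nonneg fun x =>
      bel_nonneg hq (hu0 t ht x) (hv0 t ht x), ?_, ?_⟩⟩
  · obtain ⟨C, c, hC, hc, h⟩ := log_bounds hu hv hu0 hv0 (by linarith : 1 ≤ p) hq.le ht le_rfl
    have mu := (hu.cont t).measurable
    have mv := (hv.cont t).measurable
    have bnd := fun x => (h t ⟨le_rfl, le_rfl⟩ x).1
    have pu : ∀ x, 0 ≤ u t x ^ p := fun x => by have := hu0 t ht x; positivity
    have pv : ∀ x, 0 ≤ v t x ^ q := fun x => by have := hv0 t ht x; positivity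
    have i1 : Integrable fun x => u t x ^ p :=
      integrable_of_le (C := C) (n := 0) (Measurable.aestronglyMeasurable (by fun_prop)) hc
        fun x => by
          rw [abs_of_nonneg (pu x), pow_zero, mul_one]; linarith [bnd x, pv x]
    have i2 : Integrable fun x => v t x ^ q :=
      integrable_of_le (C := C) (n := 0) (Measurable.aestronglyMeasurable (by fun_prop)) hc
        fun x => by
          rw [abs_of_nonneg (pv x), pow_zero, mul_one]; linarith [bnd x, pu x]
    rw [← integral_add i1 i2, ← integral_const_mul]
    exact integral_mono_of_nonneg (Eventually.of_forall fun x =>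
      bel_nonneg hq (hu0 t ht x) (hv0 t ht x)) ((i1.add i2).const_mul _)
      (Eventually.of_forall fun x => bel_le hp hq (hu0 t ht x) (hv0 t ht x))
  · rw [neg_neg, ← integral_const_mul]
    refine integral_mono_of_nonneg (Eventually.of_forall fun x => by positivity)
      (hasDerivAt_integral_bel hu hv hu0 hv0 hp hpq hq ht).1 (Eventually.of_forall fun x => ?_)
    have pu := hu0 t ht x
    have pv := hv0 t ht x
    have := abs_mul_le_belQ hp hpq hq pu pv Finset.univ (fun k => u1 k t x / u t x)
      (fun k => v1 k t x / v t x) (Finset.mem_univ i) (Finset.mem_univ j)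
    rwa [mul_div_cancel₀ _ pu.ne', mul_div_cancel₀ _ pv.ne'] at this

end IsGaussianHeatFlow

/-! ### Gaussian bounds for the heat flow of a compactly supported function -/

section HeatBounds

variable {f : E3 → ℝ}

theorem exists_support_bound (hf' : HasCompactSupport f) :
    ∃ R : ℝ, 0 ≤ R ∧ ∀ y, f y ≠ 0 → ‖y‖ ≤ R := by
  obtain ⟨R, hR⟩ := hf'.isBounded.exists_norm_le
  exact ⟨max R 0, le_max_right _ _, fun y hy =>
    (hR y (subset_tsupport f hy)).trans (le_max_left _ _)⟩

theorem gconv_le_of_forall {κ κ' : E3 → ℝ} (hκ : Continuous κ) (hκ' : Continuous κ')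
    (hf : Continuous f) (hf' : HasCompactSupport f) {x : E3}
    (h : ∀ y, f y ≠ 0 → |κ (x - y)| ≤ κ' (x - y)) :
    |gconv κ f x| ≤ gconv κ' (fun y => |f y|) x := by
  have hfa : HasCompactSupport fun y => |f y| := hf'.norm
  refine (abs_integral_le_integral_abs).trans ?_
  refine integral_mono (integrable_gconv hκ hf hf' x).abs
    (integrable_gconv hκ' hf.abs hfa x) fun y => ?_
  simp only [abs_mul]
  by_cases hy : f y = 0
  · simp [hy]
  · exact mul_le_mul_of_nonneg_right (h y hy) (abs_nonneg _)

theorem gconv_const_mul (κ : E3 → ℝ) (f : E3 → ℝ) (c : ℝ) (x : E3) :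
    gconv (fun z => c * κ z) f x = c * gconv κ f x := by
  simp only [gconv, mul_assoc, integral_const_mul]

/-- From ‖x − y‖² ≥ ‖x‖²/2 − ‖y‖²: the y-dependence goes into a constant and half of the Gaussian in
x survives. Times at least a control the prefactor, times at most b the rate. -/
theorem heatK_sub_le {a b t R : ℝ} (ha : 0 < a) (hat : a ≤ t) (htb : t ≤ b) {x y : E3}
    (hy : ‖y‖ ≤ R) : heatK t (x - y) ≤
      (4 * Real.pi * a) ^ (-(3 / 2) : ℝ) * Real.exp (R ^ 2 / (4 * a))
        * Real.exp (-(1 / (8 * b)) * ‖x‖ ^ 2) := by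
  have ht : 0 < t := ha.trans_le hat
  have hb : 0 < b := ht.trans_le htb
  have h1 : ‖x‖ ^ 2 / 2 - ‖y‖ ^ 2 ≤ ‖x - y‖ ^ 2 := by
    have h2 := norm_sub_norm_le x y
    have h3 : ‖x‖ ≤ ‖x - y‖ + ‖y‖ := by linarith
    nlinarith [sq_nonneg (‖x - y‖ - ‖y‖), norm_nonneg x, norm_nonneg y, norm_nonneg (x - y)]
  have h4 : ‖y‖ ^ 2 ≤ R ^ 2 := pow_le_pow_left₀ (norm_nonneg y) hy 2
  rw [mul_assoc, ← Real.exp_add]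
  unfold heatK
  refine mul_le_mul ?_ (Real.exp_le_exp.2 ?_) (Real.exp_pos _).le (by positivity)
  · exact Real.rpow_le_rpow_of_nonpos (by positivity) (by gcongr) (by norm_num)
  · have e1 : -‖x - y‖ ^ 2 / (4 * t) ≤ R ^ 2 / (4 * t) - ‖x‖ ^ 2 / (8 * t) := by
      rw [div_le_iff₀ (by positivity)]
      have : (R ^ 2 / (4 * t) - ‖x‖ ^ 2 / (8 * t)) * (4 * t) = R ^ 2 - ‖x‖ ^ 2 / 2 := by
        field_simp; ring
      rw [this]; linarith
    have e2 : R ^ 2 / (4 * t) ≤ R ^ 2 / (4 * a) := by gcongr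
    have e3 : ‖x‖ ^ 2 / (8 * b) ≤ ‖x‖ ^ 2 / (8 * t) := by gcongr
    have e4 : -(1 / (8 * b)) * ‖x‖ ^ 2 = -(‖x‖ ^ 2 / (8 * b)) := by ring
    rw [e4]; linarith

theorem abs_coord_le (z : E3) (k : Fin 3) : |z k| ≤ ‖z‖ := by
  simpa using PiLp.norm_apply_le z k

/-- The derivatives of the kernel are the kernel times polynomials in x − y, and on the support of f
one has ‖x − y‖ ≤ (1 + R)(1 + ‖x‖). So the derivatives are bounded by a polynomial in ‖x‖ times the
flow of |f|. A bound by the flow itself, and not merely by a Gaussian, is essential: for f ≥ 0 it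
controls the logarithmic derivatives. -/
theorem isGaussianHeatFlow_gconv (hf : Continuous f) (hf' : HasCompactSupport f) :
    IsGaussianHeatFlow (fun t => gconv (heatK t) f) (fun k t => gconv (heatK1 k t) f)
      (fun k t => gconv (heatK2 k t) f) (fun t => gconv (heatK t) fun y => |f y|) where
  cont t := continuous_gconv (continuous_heatK t) hf hf'
  cont1 k t := continuous_gconv (continuous_heatK1 k t) hf hf'
  cont2 k t := continuous_gconv (continuous_heatK2 k t) hf hf'
  line k t x := hasLineDerivAt_gconv hf hf' (continuous_heatK t) (continuous_heatK1 k t)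
    (fun z s => hasDerivAt_heatK_line k t z s) x
  line1 k t x := hasLineDerivAt_gconv hf hf' (continuous_heatK1 k t) (continuous_heatK2 k t)
    (fun z s => hasDerivAt_heatK1_line k t z s) x
  time t ht x := hasDerivAt_gconv_time hf hf' ht x
  le t ht x := gconv_le_of_forall (continuous_heatK t) (continuous_heatK t) hf hf'
    fun y _ => by rw [abs_of_pos (heatK_pos ht _)]
  bound a b ha hab := by
    obtain ⟨R, hR0, hR⟩ := exists_support_bound hf'
    have hfa : HasCompactSupport fun y => |f y| := hf'.norm
    set A := (4 * Real.pi * a) ^ (-(3 / 2) : ℝ) * Real.exp (R ^ 2 / (4 * a)) with hA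
    have hA0 : 0 ≤ A := by positivity
    have hb : 0 < b := ha.trans_le hab
    set N := ∫ y, |f y| with hN
    have hN0 : 0 ≤ N := integral_nonneg fun y => abs_nonneg _
    have hC1 : 0 ≤ (1 + R) / (2 * a) := by positivity
    have hC2 : 0 ≤ (1 + R) ^ 2 / (4 * a ^ 2) + 1 / (2 * a) := by positivity
    refine ⟨A * N + (1 + R) / (2 * a) + ((1 + R) ^ 2 / (4 * a ^ 2) + 1 / (2 * a)), 1 / (8 * b),
      by positivity, by positivity, fun t ht x => ?_⟩
    have ht0 : 0 < t := ha.trans_le ht.1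
    have hx0 := norm_nonneg x
    have hw0 : 0 ≤ gconv (heatK t) (fun y => |f y|) x :=
      integral_nonneg fun y => mul_nonneg (heatK_pos ht0 _).le (abs_nonneg _)
    have hAN : 0 ≤ A * N := by positivity
    have hz : ∀ y, f y ≠ 0 → ‖x - y‖ ≤ (1 + R) * (1 + ‖x‖) := fun y hy => by
      have := hR y hy
      have h2 := norm_sub_le x y
      nlinarith
    refine ⟨?_, fun k => ⟨?_, ?_⟩⟩
    · calc gconv (heatK t) (fun y => |f y|) x
          ≤ ∫ y, A * Real.exp (-(1 / (8 * b)) * ‖x‖ ^ 2) * |f y| := by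
            refine integral_mono (integrable_gconv (continuous_heatK t) hf.abs hfa x)
              ((hf.abs.integrable_of_hasCompactSupport hfa).const_mul _) fun y => ?_
            by_cases hy : f y = 0
            · simp [hy]
            · exact mul_le_mul_of_nonneg_right (heatK_sub_le ha ht.1 ht.2 (hR y hy)) (abs_nonneg _)
        _ = A * N * Real.exp (-(1 / (8 * b)) * ‖x‖ ^ 2) := by rw [integral_const_mul]; ring
        _ ≤ _ := by gcongr; linarith
    · have h1 : |gconv (heatK1 k t) f x|
          ≤ gconv (fun z => ((1 + R) / (2 * a) * (1 + ‖x‖)) * heatK t z) (fun y => |f y|) x := by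
        refine gconv_le_of_forall (continuous_heatK1 k t)
          (continuous_const.mul (continuous_heatK t)) hf hf' fun y hy => ?_
        unfold heatK1
        rw [abs_mul, abs_of_pos (heatK_pos ht0 _)]
        refine mul_le_mul_of_nonneg_right ?_ (heatK_pos ht0 _).le
        rw [abs_neg, abs_div, abs_of_pos (by positivity : 0 < 2 * t)]
        calc |(x - y) k| / (2 * t) ≤ (1 + R) * (1 + ‖x‖) / (2 * a) := by
              gcongr
              · exact (abs_coord_le _ _).trans (hz y hy)
              · exact ht.1
          _ = _ := by ring
      refine h1.trans ?_
      rw [gconv_const_mul]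
      gcongr
      linarith
    · have h1 : |gconv (heatK2 k t) f x|
          ≤ gconv (fun z => (((1 + R) ^ 2 / (4 * a ^ 2) + 1 / (2 * a)) * (1 + ‖x‖) ^ 2)
            * heatK t z) (fun y => |f y|) x := by
        refine gconv_le_of_forall (continuous_heatK2 k t)
          (continuous_const.mul (continuous_heatK t)) hf hf' fun y hy => ?_
        unfold heatK2
        rw [abs_mul, abs_of_pos (heatK_pos ht0 _)]
        refine mul_le_mul_of_nonneg_right ?_ (heatK_pos ht0 _).le
        have e1 : (x - y) k ^ 2 / (4 * t ^ 2) ≤ ((1 + R) * (1 + ‖x‖)) ^ 2 / (4 * a ^ 2) := by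
          rw [← sq_abs]
          gcongr
          · exact (abs_coord_le _ _).trans (hz y hy)
          · exact ht.1
        have e2 : 1 / (2 * t) ≤ 1 / (2 * a) := by gcongr; exact ht.1
        have e3 : 1 ≤ (1 + ‖x‖) ^ 2 := one_le_pow₀ (by linarith)
        refine (abs_sub _ _).trans ?_
        rw [abs_of_nonneg (by positivity : 0 ≤ (x - y) k ^ 2 / (4 * t ^ 2)),
          abs_of_pos (by positivity : 0 < 1 / (2 * t))]
        have e4 : 1 / (2 * a) ≤ 1 / (2 * a) * (1 + ‖x‖) ^ 2 :=
          le_mul_of_one_le_right (by positivity) e3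
        calc _ ≤ ((1 + R) * (1 + ‖x‖)) ^ 2 / (4 * a ^ 2) + 1 / (2 * a) * (1 + ‖x‖) ^ 2 := by
              linarith
          _ = _ := by ring
      refine h1.trans ?_
      rw [gconv_const_mul]
      exact mul_le_mul_of_nonneg_right (mul_le_mul_of_nonneg_right (by linarith) (by positivity)) hw0

theorem gconv_heatK_pos (hf : Continuous f) (hf' : HasCompactSupport f) (h0 : ∀ y, 0 ≤ f y)
    (hne : f ≠ 0) {t : ℝ} (ht : 0 < t) (x : E3) : 0 < gconv (heatK t) f x := by
  have hK := continuous_heatK t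
  obtain ⟨y, hy⟩ := Function.ne_iff.1 hne
  exact Continuous.integral_pos_of_hasCompactSupport_nonneg_nonzero (x := y) (by fun_prop)
    hf'.mul_left (fun y => mul_nonneg (heatK_pos ht _).le (h0 y))
    (mul_ne_zero (heatK_pos ht (x - y)).ne' hy)

theorem isGaussianHeatFlow_gconv_of_nonneg (hf : Continuous f) (hf' : HasCompactSupport f)
    (h0 : ∀ y, 0 ≤ f y) :
    IsGaussianHeatFlow (fun t => gconv (heatK t) f) (fun k t => gconv (heatK1 k t) f)
      (fun k t => gconv (heatK2 k t) f) (fun t => gconv (heatK t) f) := by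
  have := isGaussianHeatFlow_gconv hf hf'
  simpa only [abs_of_nonneg (h0 _)] using this

/-- Integration by parts in the convolution: a derivative may be moved to the kernel. -/
theorem gconv_pderiv {κ κ' : E3 → ℝ} {k : Fin 3} (hκc : Continuous κ) (hκ'c : Continuous κ')
    (hκ : ∀ z (s : ℝ), HasDerivAt (fun s : ℝ => κ (z + s • e3 k)) (κ' (z + s • e3 k)) s)
    (hf : ContDiff ℝ 1 f) (hf' : HasCompactSupport f) (x : E3) :
    gconv κ (fun y => fderiv ℝ f y (e3 k)) x = gconv κ' f x := by
  have hdc : Continuous fun y => fderiv ℝ f y (e3 k) :=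
    (hf.continuous_fderiv (by norm_num)).clm_apply continuous_const
  have hds : HasCompactSupport fun y => fderiv ℝ f y (e3 k) := hf'.fderiv_apply ℝ (e3 k)
  have h1 := integral_bilinear_hasLineDerivAt_right_eq_neg_left_of_integrable (μ := volume)
    (f := fun y => κ (x - y)) (f' := fun y => -κ' (x - y)) (g := f)
    (g' := fun y => fderiv ℝ f y (e3 k)) (v := e3 k)
    (B := ContinuousLinearMap.mul ℝ ℝ)
    (by simpa using (integrable_gconv hκ'c hf.continuous hf' x).neg)
    (integrable_gconv hκc hdc hds x) (integrable_gconv hκc hf.continuous hf' x) ?_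
    (fun y _ => ((hf.differentiable (by norm_num)) y).hasFDerivAt.hasLineDerivAt _)
  · simp only [ContinuousLinearMap.mul_apply', neg_mul, integral_neg, neg_neg] at h1
    exact h1
  · intro y _
    have h2 := hκ (x - y) 0
    have h3 : HasDerivAt (fun s : ℝ => κ (x - y + -s • e3 k)) (-κ' (x - y)) 0 := by
      have := HasDerivAt.scomp (0 : ℝ) (g₁ := fun s : ℝ => κ (x - y + s • e3 k))
        (h := fun s : ℝ => -s) (h' := -1) (g₁' := κ' (x - y)) (by simpa using h2)
        (hasDerivAt_neg 0)
      exact this.congr_deriv (by simp)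
    unfold HasLineDerivAt
    refine h3.congr_of_eventuallyEq (Eventually.of_forall fun s => ?_)
    simp only [neg_smul]; congr 1; abel

end HeatBounds

/-! ### Young's inequality, the contraction of L^p, and the energy in terms of the initial data -/

/-- **Young's convolution inequality** `L¹ * L^p ⊆ L^p`, for nonnegative functions. -/
theorem lintegral_rpow_conv_le {κ f : E3 → ℝ≥0∞} (hκ : Measurable κ) (hf : Measurable f)
    {p : ℝ} (hp : 1 < p) :
    ∫⁻ x, (∫⁻ y, κ (x - y) * f y) ^ p ≤ (∫⁻ z, κ z) ^ p * ∫⁻ y, f y ^ p := by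
  have hpq : p.HolderConjugate p.conjExponent := Real.HolderConjugate.conjExponent hp
  set q := p.conjExponent
  have hp0 : 0 < p := by linarith
  have hq0 : 0 < q := hpq.symm.pos
  have htr : ∀ x, ∫⁻ y, κ (x - y) = ∫⁻ z, κ z := fun x => lintegral_sub_left_eq_self κ x
  have htr' : ∀ y, ∫⁻ x, κ (x - y) = ∫⁻ z, κ z := fun y => lintegral_sub_right_eq_self κ y
  -- Hölder's inequality after splitting κ = κ^(1/q) κ^(1/p), with the second factor attached to f.
  have key : ∀ x, (∫⁻ y, κ (x - y) * f y) ^ p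
      ≤ (∫⁻ z, κ z) ^ (p / q) * ∫⁻ y, κ (x - y) * f y ^ p := fun x => by
    have mκ : Measurable fun y => κ (x - y) := hκ.comp (measurable_const.sub measurable_id)
    have h := ENNReal.lintegral_mul_le_Lp_mul_Lq volume hpq.symm
      (f := fun y => κ (x - y) ^ (1 / q)) (g := fun y => κ (x - y) ^ (1 / p) * f y)
      (mκ.pow_const _).aemeasurable ((mκ.pow_const _).mul hf).aemeasurable
    have e1 : ∀ y, κ (x - y) ^ (1 / q) * (κ (x - y) ^ (1 / p) * f y) = κ (x - y) * f y :=
      fun y => by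
        rw [← mul_assoc, ← ENNReal.rpow_add_of_nonneg _ _ (by positivity) (by positivity)]
        have : 1 / q + 1 / p = 1 := by simpa using hpq.symm.inv_add_inv_eq_one
        rw [this, ENNReal.rpow_one]
    have e2 : ∀ y, (κ (x - y) ^ (1 / q)) ^ q = κ (x - y) := fun y => by
      rw [← ENNReal.rpow_mul, one_div_mul_cancel hq0.ne', ENNReal.rpow_one]
    have e3 : ∀ y, (κ (x - y) ^ (1 / p) * f y) ^ p = κ (x - y) * f y ^ p := fun y => by
      rw [ENNReal.mul_rpow_of_nonneg _ _ hp0.le, ← ENNReal.rpow_mul, one_div_mul_cancel hp0.ne',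
        ENNReal.rpow_one]
    simp only [Pi.mul_apply, e1, e2, e3, htr] at h
    calc (∫⁻ y, κ (x - y) * f y) ^ p
        ≤ ((∫⁻ z, κ z) ^ (1 / q) * (∫⁻ y, κ (x - y) * f y ^ p) ^ (1 / p)) ^ p :=
          ENNReal.rpow_le_rpow h hp0.le
      _ = _ := by
          rw [ENNReal.mul_rpow_of_nonneg _ _ hp0.le, ← ENNReal.rpow_mul, ← ENNReal.rpow_mul,
            one_div_mul_cancel hp0.ne', ENNReal.rpow_one, one_div_mul_eq_div]
  have mF : Measurable fun a : E3 × E3 => κ (a.1 - a.2) * f a.2 ^ p :=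
    (hκ.comp (measurable_fst.sub measurable_snd)).mul ((hf.comp measurable_snd).pow_const _)
  calc ∫⁻ x, (∫⁻ y, κ (x - y) * f y) ^ p
      ≤ ∫⁻ x, (∫⁻ z, κ z) ^ (p / q) * ∫⁻ y, κ (x - y) * f y ^ p := lintegral_mono key
    _ = (∫⁻ z, κ z) ^ (p / q) * ∫⁻ x, ∫⁻ y, κ (x - y) * f y ^ p :=
        lintegral_const_mul _ mF.lintegral_prod_right'
    _ = (∫⁻ z, κ z) ^ (p / q) * ∫⁻ y, ∫⁻ x, κ (x - y) * f y ^ p := by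
        rw [lintegral_lintegral_swap mF.aemeasurable]
    _ = (∫⁻ z, κ z) ^ (p / q) * ∫⁻ y, (∫⁻ z, κ z) * f y ^ p := by
        congr 1
        refine lintegral_congr fun y => ?_
        have mκ : Measurable fun x => κ (x - y) := hκ.comp (measurable_id.sub measurable_const)
        rw [lintegral_mul_const _ mκ, htr']
    _ = (∫⁻ z, κ z) ^ (p / q) * ((∫⁻ z, κ z) * ∫⁻ y, f y ^ p) := by
        rw [lintegral_const_mul _ (hf.pow_const _)]
    _ = _ := by
        rw [← mul_assoc]
        congr 1
        nth_rewrite 2 [← ENNReal.rpow_one (∫⁻ z, κ z)]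
        rw [← ENNReal.rpow_add_of_nonneg _ _ (by positivity) zero_le_one]
        congr 1
        have := hpq.symm.inv_add_inv_eq_one
        field_simp at this ⊢
        linarith

section

variable {f : E3 → ℝ}

theorem lintegral_ofReal_heatK {t : ℝ} (ht : 0 < t) : ∫⁻ z, ENNReal.ofReal (heatK t z) = 1 := by
  rw [← ofReal_integral_eq_lintegral_ofReal (integrable_heatK ht)
    (Eventually.of_forall fun z => (heatK_pos ht z).le), integral_heatK ht, ENNReal.ofReal_one]

/-- The heat kernel has mass 1, so Young's inequality makes the heat flow a contraction in L^p. -/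
theorem integral_rpow_gconv_heatK_le (hf : Continuous f) (hf' : HasCompactSupport f)
    (h0 : ∀ y, 0 ≤ f y) {p : ℝ} (hp : 1 < p) {t : ℝ} (ht : 0 < t) :
    ∫ x, gconv (heatK t) f x ^ p ≤ ∫ x, f x ^ p := by
  have hp0 : 0 < p := by linarith
  have hg0 : ∀ x, 0 ≤ gconv (heatK t) f x := fun x =>
    integral_nonneg fun y => mul_nonneg (heatK_pos ht _).le (h0 y)
  have hK := continuous_heatK t
  have ifp : Integrable fun x => f x ^ p :=
    (hf.rpow_const fun _ => Or.inr hp0.le).integrable_of_hasCompactSupport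
      (hf'.comp_left (g := fun r : ℝ => r ^ p) (Real.zero_rpow hp0.ne'))
  have e : ∀ x, ENNReal.ofReal (gconv (heatK t) f x ^ p)
      = (∫⁻ y, ENNReal.ofReal (heatK t (x - y)) * ENNReal.ofReal (f y)) ^ p := fun x => by
    rw [← ENNReal.ofReal_rpow_of_nonneg (hg0 x) hp0.le]
    congr 1
    unfold gconv
    rw [ofReal_integral_eq_lintegral_ofReal (integrable_gconv hK hf hf' x)
      (Eventually.of_forall fun y => mul_nonneg (heatK_pos ht _).le (h0 y))]
    exact lintegral_congr fun y => ENNReal.ofReal_mul (heatK_pos ht _).le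
  have h := lintegral_rpow_conv_le (κ := fun z => ENNReal.ofReal (heatK t z))
    (f := fun y => ENNReal.ofReal (f y)) hK.measurable.ennreal_ofReal
    hf.measurable.ennreal_ofReal hp
  rw [lintegral_ofReal_heatK ht, ENNReal.one_rpow, one_mul] at h
  simp_rw [← e, ENNReal.ofReal_rpow_of_nonneg (h0 _) hp0.le] at h
  rw [← ofReal_integral_eq_lintegral_ofReal ifp
    (Eventually.of_forall fun y => Real.rpow_nonneg (h0 y) p)] at h
  rw [integral_eq_lintegral_of_nonneg_ae (Eventually.of_forall fun x => Real.rpow_nonneg (hg0 x) p)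
    ((continuous_gconv hK hf hf').measurable.pow_const p).aestronglyMeasurable]
  refine (ENNReal.toReal_mono ENNReal.ofReal_ne_top h).trans_eq ?_
  exact ENNReal.toReal_ofReal (integral_nonneg fun y => Real.rpow_nonneg (h0 y) p)

/-- The energy at time t is bounded by L^p and L^q norms at time t, and contraction replaces these
by the norms of the initial data, with a constant free of t. -/
theorem exists_heat_energy {p q : ℝ} (hp : 1 < p) (hq : 1 < q) (hpq : 1 / p + 1 / q = 1) :
    ∃ C : ℝ, 0 ≤ C ∧ ∀ f h : E3 → ℝ, Continuous f → HasCompactSupport f → (∀ y, 0 ≤ f y) →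
      Continuous h → HasCompactSupport h → (∀ y, 0 ≤ h y) → ∀ i j : Fin 3,
      ∃ I I' : ℝ → ℝ, ∀ t, 0 < t → HasDerivAt I (I' t) t ∧ 0 ≤ I t ∧
        I t ≤ C * ((∫ x, f x ^ p) + ∫ x, h x ^ q) ∧
        2 * ∫ x, |gconv (heatK1 i t) f x * gconv (heatK1 j t) h x| ≤ -I' t := by
  -- The Bellman function requires p ≥ 2. One of two conjugate exponents is at least 2, and the
  -- claim is symmetric under exchanging (p, f, i) with (q, h, j).
  wlog hp2 : 2 ≤ p generalizing p q with H
  · have hq2 : 2 ≤ q := by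
      field_simp at hpq; nlinarith
    obtain ⟨C, hC, hH⟩ := H hq hp (by linarith) hq2
    refine ⟨C, hC, fun f h hf hf' hf0 hh hh' hh0 i j => ?_⟩
    obtain ⟨I, I', h⟩ := hH h f hh hh' hh0 hf hf' hf0 j i
    refine ⟨I, I', fun t ht => ?_⟩
    obtain ⟨h1, h2, h3, h4⟩ := h t ht
    refine ⟨h1, h2, by rwa [add_comm], ?_⟩
    simpa only [mul_comm (gconv (heatK1 i t) f _)] using h4
  have hK := belK_pos hq
  refine ⟨1 + belK q, by positivity, fun f h hf hf' hf0 hh hh' hh0 i j => ?_⟩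
  have n1 : 0 ≤ ∫ x, f x ^ p := integral_nonneg fun x => Real.rpow_nonneg (hf0 x) p
  have n2 : 0 ≤ ∫ x, h x ^ q := integral_nonneg fun x => Real.rpow_nonneg (hh0 x) q
  -- Logarithmic derivatives need strictly positive flows, which zero data do not give; in that case
  -- the bilinear quantity vanishes.
  by_cases hfz : f = 0 ∨ h = 0
  · refine ⟨fun _ => 0, fun _ => 0, fun t ht => ⟨hasDerivAt_const _ _, le_rfl, by positivity, ?_⟩⟩
    have : ∀ x, gconv (heatK1 i t) f x * gconv (heatK1 j t) h x = 0 := fun x => by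
      rcases hfz with rfl | rfl <;> simp [gconv]
    simp [this]
  push Not at hfz
  obtain ⟨I, I', hI⟩ := (isGaussianHeatFlow_gconv_of_nonneg hf hf' hf0).exists_energy
    (isGaussianHeatFlow_gconv_of_nonneg hh hh' hh0)
    (fun t ht x => gconv_heatK_pos hf hf' hf0 hfz.1 ht x)
    (fun t ht x => gconv_heatK_pos hh hh' hh0 hfz.2 ht x) hp2 hpq hq i j
  refine ⟨I, I', fun t ht => ?_⟩
  obtain ⟨h1, h2, h3, h4⟩ := hI t ht
  refine ⟨h1, h2, h3.trans ?_, h4⟩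
  have := integral_rpow_gconv_heatK_le hf hf' hf0 hp ht
  have := integral_rpow_gconv_heatK_le hh hh' hh0 hq ht
  gcongr

end

/-! ### Partial derivatives -/

section Pderiv

variable {F : Type*} [NormedAddCommGroup F] [NormedSpace ℝ F] {f g : E3 → F}

/-- Smooth functions with compact support on `ℝ³`. -/
structure IsTest (f : E3 → F) : Prop where
  contDiff : ContDiff ℝ ((⊤ : ℕ∞) : WithTop ℕ∞) f
  hasCompactSupport : HasCompactSupport f

theorem ContDiff.pderiv3 {n m : WithTop ℕ∞} (hf : ContDiff ℝ n f) (h : m + 1 ≤ n) (k : Fin 3) :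
    ContDiff ℝ m (pderiv3 k f) :=
  (hf.fderiv_right h).clm_apply contDiff_const

theorem IsTest.pderiv3 (hf : IsTest f) (k : Fin 3) : IsTest (pderiv3 k f) :=
  ⟨hf.contDiff.pderiv3 (by simp) k, hf.hasCompactSupport.fderiv_apply ℝ (e3 k)⟩

theorem IsTest.continuous (hf : IsTest f) : Continuous f := hf.contDiff.continuous

theorem IsTest.of_le (hf : IsTest f) (n : ℕ∞) : ContDiff ℝ n f :=
  hf.contDiff.of_le (by exact_mod_cast le_top)

theorem IsTest.differentiable (hf : IsTest f) : Differentiable ℝ f :=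
  hf.contDiff.differentiable (by simp)

theorem IsTest.integrable (hf : IsTest f) : Integrable f :=
  hf.continuous.integrable_of_hasCompactSupport hf.hasCompactSupport

theorem pderiv3_comm (hf : ContDiff ℝ 2 f) (i j : Fin 3) :
    pderiv3 i (pderiv3 j f) = pderiv3 j (pderiv3 i f) := by
  funext x
  have hd : Differentiable ℝ (fderiv ℝ f) :=
    (hf.fderiv_right (m := 1) (by norm_num)).differentiable (by norm_num)
  have e : ∀ i j : Fin 3, pderiv3 i (pderiv3 j f) x
      = fderiv ℝ (fderiv ℝ f) x (e3 i) (e3 j) := fun i j => by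
    unfold pderiv3
    rw [fderiv_clm_apply (hd x) (by fun_prop)]
    simp
  rw [e, e]
  exact (hf.contDiffAt.isSymmSndFDerivAt (by simp)) _ _

theorem IsTest.pderiv3_comm (hf : IsTest f) (i j : Fin 3) :
    _root_.pderiv3 i (_root_.pderiv3 j f) = _root_.pderiv3 j (_root_.pderiv3 i f) :=
  _root_.pderiv3_comm (hf.of_le 2) i j

theorem IsTest.hasLineDerivAt (hf : IsTest f) (k : Fin 3) (x : E3) :
    HasLineDerivAt ℝ f (_root_.pderiv3 k f x) x (e3 k) :=
  (hf.differentiable x).hasFDerivAt.hasLineDerivAt _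

end Pderiv

/-- The Laplacian on `ℝ³` in terms of second partial derivatives. -/
noncomputable def lap3 {F : Type*} [NormedAddCommGroup F] [NormedSpace ℝ F] (f : E3 → F)
    (x : E3) : F := ∑ k, pderiv3 k (pderiv3 k f) x

/-! ### Short and long time behaviour of the heat flow -/

section Limits

variable {f k : E3 → ℝ}

/-- Half of the Gaussian exponent absorbs ‖z‖ at the price of 2√s; the other half is the kernel at
time 2s up to the factor 2^(3/2). Thus the first moment of the kernel is O(√s). -/
theorem norm_mul_heatK_le {s : ℝ} (hs : 0 < s) (z : E3) :
    ‖z‖ * heatK s z ≤ 2 * 2 ^ (3 / 2 : ℝ) * √s * heatK (2 * s) z := by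
  have hss : 0 < √s := Real.sqrt_pos.2 hs
  have h1 : ‖z‖ * Real.exp (-‖z‖ ^ 2 / (4 * s)) ≤ 2 * √s * Real.exp (-‖z‖ ^ 2 / (8 * s)) := by
    have e : Real.exp (-‖z‖ ^ 2 / (4 * s))
        = Real.exp (-‖z‖ ^ 2 / (8 * s)) * Real.exp (-‖z‖ ^ 2 / (8 * s)) := by
      rw [← Real.exp_add]; congr 1; field_simp; ring
    rw [e, ← mul_assoc]
    refine mul_le_mul_of_nonneg_right ?_ (Real.exp_pos _).le
    have h2 : 1 + ‖z‖ ^ 2 / (8 * s) ≤ Real.exp (‖z‖ ^ 2 / (8 * s)) := by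
      linarith [Real.add_one_le_exp (‖z‖ ^ 2 / (8 * s))]
    have h3 : ‖z‖ ≤ 2 * √s * (1 + ‖z‖ ^ 2 / (8 * s)) := by
      have h4 : √s ^ 2 = s := Real.sq_sqrt hs.le
      have : 2 * √s * (1 + ‖z‖ ^ 2 / (8 * s)) - ‖z‖ = ((‖z‖ - 2 * √s) ^ 2 + 4 * s) / (4 * √s) := by
        nth_rewrite 2 [← h4]
        rw [← h4]; field_simp; rw [h4]; ring_nf; rw [h4]; ring
      have : 0 ≤ ((‖z‖ - 2 * √s) ^ 2 + 4 * s) / (4 * √s) := by positivity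
      linarith
    rw [neg_div, Real.exp_neg, ← div_eq_mul_inv, div_le_iff₀ (Real.exp_pos _)]
    exact h3.trans (mul_le_mul_of_nonneg_left h2 (by positivity))
  have e2 : (4 * Real.pi * (2 * s)) ^ (-(3 / 2) : ℝ)
      = (4 * Real.pi * s) ^ (-(3 / 2) : ℝ) * (2 ^ (3 / 2 : ℝ))⁻¹ := by
    rw [← Real.rpow_neg (by norm_num), ← Real.mul_rpow (by positivity) (by norm_num)]
    congr 1; ring
  unfold heatK
  rw [e2]
  have e3 : 4 * (2 * s) = 8 * s := by ring
  rw [e3]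
  calc ‖z‖ * ((4 * Real.pi * s) ^ (-(3 / 2) : ℝ) * Real.exp (-‖z‖ ^ 2 / (4 * s)))
      = (4 * Real.pi * s) ^ (-(3 / 2) : ℝ) * (‖z‖ * Real.exp (-‖z‖ ^ 2 / (4 * s))) := by ring
    _ ≤ (4 * Real.pi * s) ^ (-(3 / 2) : ℝ) * (2 * √s * Real.exp (-‖z‖ ^ 2 / (8 * s))) := by gcongr
    _ = _ := by field_simp

theorem integrable_heatK_sub {s : ℝ} (hs : 0 < s) (x : E3) :
    Integrable fun y => heatK s (x - y) := (integrable_heatK hs).comp_sub_left x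

theorem integral_heatK_sub {s : ℝ} (hs : 0 < s) (x : E3) : ∫ y, heatK s (x - y) = 1 := by
  rw [integral_sub_left_eq_self (heatK s), integral_heatK hs]

/-- Since the kernel has mass 1, the difference is the average of k(y) − k(x); the Lipschitz bound
and the first moment of the kernel finish. -/
theorem abs_gconv_heatK_sub_le (hk : Continuous k) (hk' : HasCompactSupport k) {L : ℝ}
    (hL : ∀ x y, |k x - k y| ≤ L * ‖x - y‖) {s : ℝ} (hs : 0 < s) (x : E3) :
    |gconv (heatK s) k x - k x| ≤ L * (2 * 2 ^ (3 / 2 : ℝ) * √s) := by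
  have i1 := integrable_gconv (continuous_heatK s) hk hk' x
  have i2 := (integrable_heatK_sub hs x).mul_const (k x)
  have e : gconv (heatK s) k x - k x = ∫ y, heatK s (x - y) * (k y - k x) := by
    have : ∫ y, heatK s (x - y) * k x = k x := by
      rw [integral_mul_const, integral_heatK_sub hs, one_mul]
    simp only [mul_sub]
    rw [integral_sub i1 i2, this]
    rfl
  have hL0 : 0 ≤ L := by
    have := (abs_nonneg _).trans (hL (e3 0) 0)
    simpa using this
  rw [e]
  refine abs_integral_le_integral_abs.trans ?_
  have i3 := (integrable_heatK_sub (by positivity : 0 < 2 * s) x).const_mul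
    (L * (2 * 2 ^ (3 / 2 : ℝ) * √s))
  refine (integral_mono_of_nonneg (Eventually.of_forall fun y => abs_nonneg _) i3
    (Eventually.of_forall fun y => ?_)).trans_eq ?_
  · simp only [abs_mul, abs_of_pos (heatK_pos hs _)]
    have h1 := hL y x
    rw [norm_sub_rev] at h1
    have h2 := norm_mul_heatK_le hs (x - y)
    calc heatK s (x - y) * |k y - k x| ≤ heatK s (x - y) * (L * ‖x - y‖) :=
          mul_le_mul_of_nonneg_left h1 (heatK_pos hs _).le
      _ = L * (‖x - y‖ * heatK s (x - y)) := by ring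
      _ ≤ L * (2 * 2 ^ (3 / 2 : ℝ) * √s * heatK (2 * s) (x - y)) :=
          mul_le_mul_of_nonneg_left h2 hL0
      _ = _ := by ring
  · rw [integral_const_mul, integral_heatK_sub (by positivity), mul_one]

theorem integral_gconv_mul_comm {κ : E3 → ℝ} (hκ : Continuous κ) (hsymm : ∀ z, κ (-z) = κ z)
    (hf : Continuous f) (hf' : HasCompactSupport f) (hk : Continuous k)
    (hk' : HasCompactSupport k) : ∫ x, gconv κ f x * k x = ∫ x, f x * gconv κ k x := by
  have hc : Continuous (Function.uncurry fun x y : E3 => κ (x - y) * f y * k x) := by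
    unfold Function.uncurry; fun_prop
  have hs : HasCompactSupport (Function.uncurry fun x y : E3 => κ (x - y) * f y * k x) := by
    refine HasCompactSupport.intro (hk'.prod hf') fun a ha => ?_
    rw [Set.mem_prod, not_and_or] at ha
    rcases ha with h | h
    · simp [Function.uncurry, image_eq_zero_of_notMem_tsupport h]
    · simp [Function.uncurry, image_eq_zero_of_notMem_tsupport h]
  have := integral_integral_swap_of_hasCompactSupport (μ := volume) (ν := volume) hc hs
  simp only [gconv, ← integral_mul_const, ← integral_const_mul]
  rw [this]
  refine integral_congr_ae (Eventually.of_forall fun y => integral_congr_ae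
    (Eventually.of_forall fun x => ?_))
  simp only
  rw [← hsymm (x - y), neg_sub]; ring

theorem integrable_integral_gconv {κ : E3 → ℝ} (hκ : Integrable κ) (hf : Integrable f) :
    Integrable (gconv κ f) ∧ ∫ x, gconv κ f x = (∫ y, f y) * ∫ z, κ z := by
  have e : gconv κ f = convolution f κ (ContinuousLinearMap.mul ℝ ℝ) volume := by
    funext x; rw [convolution_mul]; simp only [gconv, mul_comm]
  rw [e]
  exact ⟨hf.integrable_convolution _ hκ, integral_convolution _ hf hκ⟩

theorem integral_abs_gconv_heatK_le (hf : Continuous f) (hf' : HasCompactSupport f) {t : ℝ}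
    (ht : 0 < t) : Integrable (gconv (heatK t) f) ∧
      ∫ x, |gconv (heatK t) f x| ≤ ∫ x, |f x| := by
  have hfa : HasCompactSupport fun y => |f y| := hf'.norm
  have h1 := integrable_integral_gconv (integrable_heatK ht) (hf.integrable_of_hasCompactSupport hf')
  have h2 := integrable_integral_gconv (integrable_heatK ht)
    (hf.abs.integrable_of_hasCompactSupport hfa)
  refine ⟨h1.1, ?_⟩
  rw [integral_heatK ht, mul_one] at h2
  rw [← h2.2]
  exact integral_mono h1.1.abs h2.1 fun x => gconv_le_of_forall (continuous_heatK t)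
    (continuous_heatK t) hf hf' fun y _ => by rw [abs_of_pos (heatK_pos ht _)]

theorem abs_gconv_heatK_le (hf : Continuous f) (hf' : HasCompactSupport f) {t : ℝ}
    (ht : 0 < t) (x : E3) :
    |gconv (heatK t) f x| ≤ (4 * Real.pi * t) ^ (-(3 / 2) : ℝ) * ∫ y, |f y| := by
  refine abs_integral_le_integral_abs.trans ?_
  rw [← integral_const_mul]
  refine integral_mono (integrable_gconv (continuous_heatK t) hf hf' x).abs
    ((hf.integrable_of_hasCompactSupport hf').abs.const_mul _) fun y => ?_
  simp only [abs_mul, abs_of_pos (heatK_pos ht _)]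
  refine mul_le_mul_of_nonneg_right ?_ (abs_nonneg _)
  unfold heatK
  refine mul_le_of_le_one_right (by positivity) ?_
  rw [Real.exp_le_one_iff, neg_div]
  have : 0 ≤ ‖x - y‖ ^ 2 / (4 * t) := by positivity
  linarith

/-- The pairing of two heat flows: short time behaviour. -/
theorem abs_pairing_sub_le (hf : Continuous f) (hf' : HasCompactSupport f) (hk : Continuous k)
    (hk' : HasCompactSupport k) {L : ℝ} (hL : ∀ x y, |k x - k y| ≤ L * ‖x - y‖) {s : ℝ}
    (hs : 0 < s) :
    |(∫ x, gconv (heatK s) f x * gconv (heatK s) k x) - ∫ x, f x * k x|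
      ≤ 2 * (L * (2 * 2 ^ (3 / 2 : ℝ) * √s)) * ∫ x, |f x| := by
  set ε := L * (2 * 2 ^ (3 / 2 : ℝ) * √s)
  have hK := continuous_heatK s
  have b := abs_gconv_heatK_sub_le hk hk' hL hs
  have ck := continuous_gconv hK hk hk'
  have cf := continuous_gconv hK hf hf'
  obtain ⟨if1, if2⟩ := integral_abs_gconv_heatK_le hf hf' hs
  have iff : Integrable f := hf.integrable_of_hasCompactSupport hf'
  have hε : 0 ≤ ε := (abs_nonneg _).trans (b 0)
  -- With S the heat operator, symmetry gives ∫ Sf·Sk − ∫ f·k = ∫ Sf·(Sk − k) + ∫ f·(Sk − k). Both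
  -- terms are at most sup|Sk − k| times an L¹ norm, and S does not increase the L¹ norm.
  have bnd : ∀ {u : E3 → ℝ}, Continuous u → Integrable u →
      Integrable (fun x => u x * (gconv (heatK s) k x - k x)) ∧
      |∫ x, u x * (gconv (heatK s) k x - k x)| ≤ ε * ∫ x, |u x| := by
    intro u cu iu
    have ib : ∀ x, |u x * (gconv (heatK s) k x - k x)| ≤ ε * |u x| := fun x => by
      rw [abs_mul, mul_comm]; exact mul_le_mul_of_nonneg_right (b x) (abs_nonneg _)
    refine ⟨(iu.abs.const_mul ε).mono' (by fun_prop) (Eventually.of_forall ib), ?_⟩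
    refine abs_integral_le_integral_abs.trans ?_
    rw [← integral_const_mul]
    exact integral_mono_of_nonneg (Eventually.of_forall fun x => abs_nonneg _)
      (iu.abs.const_mul ε) (Eventually.of_forall ib)
  obtain ⟨j1, b1⟩ := bnd cf if1
  obtain ⟨j2, b2⟩ := bnd hf iff
  have j3 : Integrable fun x => gconv (heatK s) f x * k x :=
    (cf.mul hk).integrable_of_hasCompactSupport hk'.mul_left
  have j4 : Integrable fun x => f x * k x :=
    (hf.mul hk).integrable_of_hasCompactSupport hk'.mul_left
  have j5 : Integrable fun x => f x * gconv (heatK s) k x :=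
    (hf.mul ck).integrable_of_hasCompactSupport hf'.mul_right
  have e1 : ∫ x, gconv (heatK s) f x * gconv (heatK s) k x
      = (∫ x, gconv (heatK s) f x * (gconv (heatK s) k x - k x))
        + ∫ x, gconv (heatK s) f x * k x := by
    rw [← integral_add j1 j3]; congr 1; funext x; ring
  have e2 : ∫ x, f x * (gconv (heatK s) k x - k x)
      = (∫ x, f x * gconv (heatK s) k x) - ∫ x, f x * k x := by
    rw [← integral_sub j5 j4]; congr 1; funext x; ring
  rw [e1, integral_gconv_mul_comm hK (heatK_neg s) hf hf' hk hk']
  have e3 : ∀ a b c : ℝ, a + b - c = a + (b - c) := fun a b c => by ring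
  rw [e3, ← e2]
  refine (abs_add_le _ _).trans ?_
  have : ε * ∫ x, |gconv (heatK s) f x| ≤ ε * ∫ x, |f x| := mul_le_mul_of_nonneg_left if2 hε
  linarith

/-- The pairing of two heat flows: long time behaviour. -/
theorem abs_pairing_le (hf : Continuous f) (hf' : HasCompactSupport f) (hk : Continuous k)
    (hk' : HasCompactSupport k) {t : ℝ} (ht : 0 < t) :
    |∫ x, gconv (heatK t) f x * gconv (heatK t) k x|
      ≤ (4 * Real.pi * t) ^ (-(3 / 2) : ℝ) * (∫ y, |f y|) * ∫ x, |k x| := by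
  obtain ⟨ik1, ik2⟩ := integral_abs_gconv_heatK_le hk hk' ht
  have h0 : 0 ≤ ∫ y, |f y| := integral_nonneg fun y => abs_nonneg _
  refine abs_integral_le_integral_abs.trans ?_
  refine le_trans ?_ (mul_le_mul_of_nonneg_left ik2 (by positivity))
  rw [← integral_const_mul]
  refine integral_mono_of_nonneg (Eventually.of_forall fun x => abs_nonneg _)
    (ik1.abs.const_mul _) (Eventually.of_forall fun x => ?_)
  simp only [abs_mul]
  exact mul_le_mul_of_nonneg_right (abs_gconv_heatK_le hf hf' ht x) (abs_nonneg _)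

end Limits

/-- Both I + J and I − J are nonincreasing. This replaces integrating |J'| in time, so no
measurability in t is needed. -/
theorem abs_sub_le_of_abs_deriv_le {J J' I I' : ℝ → ℝ} {s T : ℝ} (hs : 0 < s) (hsT : s ≤ T)
    (hJ : ∀ t, 0 < t → HasDerivAt J (J' t) t) (hI : ∀ t, 0 < t → HasDerivAt I (I' t) t)
    (hle : ∀ t, 0 < t → |J' t| ≤ -I' t) : |J T - J s| ≤ I s - I T := by
  have anti : ∀ ε : ℝ, |ε| = 1 → I T + ε * J T ≤ I s + ε * J s := fun ε hε => by
    have hd : ∀ t, 0 < t → HasDerivAt (fun t => I t + ε * J t) (I' t + ε * J' t) t := fun t ht =>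
      (hI t ht).add ((hJ t ht).const_mul ε)
    have : AntitoneOn (fun t => I t + ε * J t) (Set.Ici s) := by
      refine antitoneOn_of_deriv_nonpos (convex_Ici s)
        (fun t ht => (hd t (hs.trans_le ht)).continuousAt.continuousWithinAt) ?_ ?_
      · intro t ht
        rw [interior_Ici] at ht
        exact (hd t (hs.trans ht)).differentiableAt.differentiableWithinAt
      · intro t ht
        rw [interior_Ici] at ht
        have ht0 : 0 < t := hs.trans ht
        rw [(hd t ht0).deriv]
        have h1 := hle t ht0
        have h2 : ε * J' t ≤ |J' t| := by
          calc ε * J' t ≤ |ε * J' t| := le_abs_self _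
            _ = |J' t| := by rw [abs_mul, hε, one_mul]
        linarith
    exact this (Set.mem_Ici.2 le_rfl) (Set.mem_Ici.2 hsT) hsT
  have a1 := anti 1 (by norm_num)
  have a2 := anti (-1) (by norm_num)
  rw [abs_le]; constructor <;> linarith

/-! ### The Calderón–Zygmund inequality `‖∂ᵢ∂ⱼφ‖_q ≤ C ‖Δφ‖_q` -/

namespace IsGaussianHeatFlow

variable {u v : ℝ → E3 → ℝ} {u1 u2 v1 v2 : Fin 3 → ℝ → E3 → ℝ} {w w' : ℝ → E3 → ℝ}

theorem integrable_products (hu : IsGaussianHeatFlow u u1 u2 w)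
    (hv : IsGaussianHeatFlow v v1 v2 w') {t : ℝ} (ht : 0 < t) (i j : Fin 3) :
    Integrable (fun x => u t x * v t x) ∧ Integrable (fun x => u1 i t x * v t x) ∧
    Integrable (fun x => u t x * v1 j t x) ∧ Integrable (fun x => u1 i t x * v1 j t x) := by
  obtain ⟨C, c, hC, hc, h⟩ := hu.bound_abs ht le_rfl
  obtain ⟨C', c', hC', hc', h'⟩ := hv.bound_abs ht le_rfl
  have hm : t ∈ Set.Icc t t := ⟨le_rfl, le_rfl⟩
  exact ⟨integrable_of_le ((hu.cont t).mul (hv.cont t)).aestronglyMeasurable hc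
      fun x => abs_mul_le hC hC' hc' (h t hm x).1 (h' t hm x).1,
    integrable_of_le ((hu.cont1 i t).mul (hv.cont t)).aestronglyMeasurable hc
      fun x => abs_mul_le hC hC' hc' ((h t hm x).2 i).1 (h' t hm x).1,
    integrable_of_le ((hu.cont t).mul (hv.cont1 j t)).aestronglyMeasurable hc
      fun x => abs_mul_le hC hC' hc' (h t hm x).1 ((h' t hm x).2 j).1,
    integrable_of_le ((hu.cont1 i t).mul (hv.cont1 j t)).aestronglyMeasurable hc
      fun x => abs_mul_le hC hC' hc' ((h t hm x).2 i).1 ((h' t hm x).2 j).1⟩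

theorem integral_mul_deriv (hu : IsGaussianHeatFlow u u1 u2 w)
    (hv : IsGaussianHeatFlow v v1 v2 w') {t : ℝ} (ht : 0 < t) (k : Fin 3) :
    ∫ x, u t x * v1 k t x = -∫ x, u1 k t x * v t x := by
  obtain ⟨i1, i2, i3, -⟩ := integrable_products hu hv ht k k
  exact integral_bilinear_hasLineDerivAt_right_eq_neg_left_of_integrable (μ := volume)
    (f := u t) (f' := u1 k t) (g := v t) (g' := v1 k t) (v := e3 k)
    (B := ContinuousLinearMap.mul ℝ ℝ) i2 i3 i1
    (fun x _ => hu.line k t x) (fun x _ => hv.line k t x)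

end IsGaussianHeatFlow

/-! ### From the heat-flow energy to the a priori inequality -/

section Apriori

variable {f φ : E3 → ℝ}

theorem IsTest.lap3 {F : Type*} [NormedAddCommGroup F] [NormedSpace ℝ F] {φ : E3 → F}
    (hφ : IsTest φ) : IsTest (lap3 φ) := by
  have h := fun k => (hφ.pderiv3 k).pderiv3 k
  refine ⟨ContDiff.sum fun k _ => (h k).contDiff, ?_⟩
  unfold _root_.lap3
  simp only [Fin.sum_univ_three]
  exact ((h 0).hasCompactSupport.add (h 1).hasCompactSupport).add (h 2).hasCompactSupport

theorem pderiv3_lap3 {F : Type*} [NormedAddCommGroup F] [NormedSpace ℝ F] {φ : E3 → F}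
    (hφ : IsTest φ) (i : Fin 3) : pderiv3 i (lap3 φ) = lap3 (pderiv3 i φ) := by
  funext x
  have h : ∀ k, DifferentiableAt ℝ (pderiv3 k (pderiv3 k φ)) x := fun k =>
    ((hφ.pderiv3 k).pderiv3 k).differentiable x
  have : pderiv3 i (lap3 φ) x = ∑ k, pderiv3 i (pderiv3 k (pderiv3 k φ)) x := by
    unfold pderiv3 lap3
    rw [fderiv_fun_sum fun k _ => h k]
    simp
    rfl
  rw [this]
  unfold lap3
  refine Finset.sum_congr rfl fun k _ => ?_
  rw [(hφ.pderiv3 k).pderiv3_comm i k, hφ.pderiv3_comm i k]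

theorem gconv_heatK_pderiv3 (hφ : IsTest φ) (t : ℝ) (k : Fin 3) (x : E3) :
    gconv (heatK t) (pderiv3 k φ) x = gconv (heatK1 k t) φ x :=
  gconv_pderiv (continuous_heatK t) (continuous_heatK1 k t)
    (fun z s => hasDerivAt_heatK_line k t z s) (hφ.of_le 1) hφ.hasCompactSupport x

theorem gconv_heatK1_pderiv3 (hφ : IsTest φ) (t : ℝ) (k : Fin 3) (x : E3) :
    gconv (heatK1 k t) (pderiv3 k φ) x = gconv (heatK2 k t) φ x :=
  gconv_pderiv (continuous_heatK1 k t) (continuous_heatK2 k t)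
    (fun z s => hasDerivAt_heatK1_line k t z s) (hφ.of_le 1) hφ.hasCompactSupport x

theorem sum_gconv_heatK2 (hφ : IsTest φ) (t : ℝ) (x : E3) :
    ∑ k, gconv (heatK2 k t) φ x = gconv (heatK t) (lap3 φ) x := by
  have e : ∀ k, gconv (heatK2 k t) φ x = gconv (heatK t) (pderiv3 k (pderiv3 k φ)) x := fun k => by
    rw [gconv_heatK_pderiv3 (hφ.pderiv3 k), gconv_heatK1_pderiv3 hφ]
  simp only [e]
  unfold gconv lap3
  rw [← integral_finsetSum _ fun k _ => integrable_gconv (continuous_heatK t)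
    ((hφ.pderiv3 k).pderiv3 k).continuous ((hφ.pderiv3 k).pderiv3 k).hasCompactSupport x]
  simp only [Finset.mul_sum]

theorem IsTest.exists_lipschitz (hφ : IsTest φ) :
    ∃ L : ℝ, ∀ x y, |φ x - φ y| ≤ L * ‖x - y‖ := by
  obtain ⟨C, hC⟩ := (hφ.of_le 1).lipschitzWith_of_hasCompactSupport hφ.hasCompactSupport
    (by norm_num)
  refine ⟨C, fun x y => ?_⟩
  have := hC.dist_le_mul x y
  rwa [Real.dist_eq, dist_eq_norm] at this

theorem integral_rpow_max_le {h : E3 → ℝ} (hh : Continuous h) (hh' : HasCompactSupport h)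
    {q : ℝ} (hq : 1 < q) (ε : ℝ) (hε : |ε| = 1) :
    Continuous (fun x => max (ε * h x) 0) ∧ HasCompactSupport (fun x => max (ε * h x) 0) ∧
    ∫ x, max (ε * h x) 0 ^ q ≤ ∫ x, |h x| ^ q := by
  have hq0 : 0 < q := by linarith
  refine ⟨by fun_prop, hh'.comp_left (g := fun r => max (ε * r) 0) (by simp), ?_⟩
  refine integral_mono_of_nonneg (Eventually.of_forall fun x => by positivity) ?_
    (Eventually.of_forall fun x => ?_)
  · exact (hh.abs.rpow_const fun _ => Or.inr hq0.le).integrable_of_hasCompactSupport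
      (hh'.comp_left (g := fun r : ℝ => |r| ^ q) (by simp [hq0.ne']))
  · refine Real.rpow_le_rpow (le_max_right _ _) (max_le ?_ (abs_nonneg _)) hq0.le
    calc ε * h x ≤ |ε * h x| := le_abs_self _
      _ = |h x| := by rw [abs_mul, hε, one_mul]

/-- With k = ∂ᵢ∂ⱼφ and h = Δφ, the pairing of the flows of f and k tends to ∫ f k as t → 0 and to 0
as t → ∞. Since Δk = ∂ᵢ∂ⱼh, its derivative is −2∫ ∂ᵢ(flow of f) ∂ⱼ(flow of h), which the Bellman
energies dominate. -/
theorem exists_bilinear_bound {p q : ℝ} (hp : 1 < p) (hq : 1 < q) (hpq : 1 / p + 1 / q = 1) :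
    ∃ C : ℝ, 0 ≤ C ∧ ∀ f φ : E3 → ℝ, Continuous f → HasCompactSupport f → (∀ y, 0 ≤ f y) →
      IsTest φ → ∀ i j : Fin 3,
      |∫ x, f x * pderiv3 i (pderiv3 j φ) x| ≤ C * ((∫ x, f x ^ p) + ∫ x, |lap3 φ x| ^ q) := by
  obtain ⟨C, hC, H⟩ := exists_heat_energy hp hq hpq
  refine ⟨2 * C, by positivity, fun f φ hf hf' hf0 hφ i j => ?_⟩
  set h := lap3 φ with hh_def
  set k := pderiv3 i (pderiv3 j φ) with hk_def
  have hh : IsTest h := hφ.lap3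
  have hk : IsTest k := (hφ.pderiv3 j).pderiv3 i
  have e_lap : lap3 k = pderiv3 i (pderiv3 j h) := by
    rw [hk_def, ← pderiv3_lap3 (hφ.pderiv3 j), ← pderiv3_lap3 hφ]
  obtain ⟨cP, sP, nP⟩ := integral_rpow_max_le hh.continuous hh.hasCompactSupport hq 1 (by norm_num)
  obtain ⟨cN, sN, nN⟩ := integral_rpow_max_le hh.continuous hh.hasCompactSupport hq (-1)
    (by norm_num)
  -- The energy estimate needs nonnegative data, so h is split into its positive and negative parts,
  -- each with its own energy; this doubles the constant.
  set hP := fun x => max (1 * h x) 0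
  set hN := fun x => max (-1 * h x) 0
  have hPN : ∀ x, h x = hP x - hN x := fun x => by
    simp only [hP, hN]
    rcases le_total 0 (h x) with h0 | h0
    · rw [max_eq_left (by linarith), max_eq_right (by linarith)]; ring
    · rw [max_eq_right (by linarith), max_eq_left (by linarith)]; ring
  obtain ⟨I, I', hI⟩ := H f hP hf hf' hf0 cP sP (fun x => le_max_right _ _) i j
  obtain ⟨N, N', hN'⟩ := H f hN hf hf' hf0 cN sN (fun x => le_max_right _ _) i j
  have fu := isGaussianHeatFlow_gconv hf hf'
  have fk := isGaussianHeatFlow_gconv hk.continuous hk.hasCompactSupport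
  have fh := isGaussianHeatFlow_gconv (hh.pderiv3 j).continuous (hh.pderiv3 j).hasCompactSupport
  have fP := isGaussianHeatFlow_gconv cP sP
  have fN := isGaussianHeatFlow_gconv cN sN
  have hJ : ∀ t, 0 < t → HasDerivAt (fun t => ∫ x, gconv (heatK t) f x * gconv (heatK t) k x)
      (-2 * ∫ x, gconv (heatK1 i t) f x * gconv (heatK1 j t) h x) t := fun t ht => by
    refine (fu.hasDerivAt_integral_mul fk ht).congr_deriv ?_
    have e1 : ∀ x, ∑ l, gconv (heatK2 l t) k x = gconv (heatK1 i t) (pderiv3 j h) x := fun x => by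
      rw [sum_gconv_heatK2 hk, e_lap, gconv_heatK_pderiv3 (hh.pderiv3 j)]
    simp only [e1]
    rw [fu.integral_mul_deriv fh ht i]
    simp only [gconv_heatK_pderiv3 hh]
    ring
  have hle : ∀ t, 0 < t → |-2 * ∫ x, gconv (heatK1 i t) f x * gconv (heatK1 j t) h x|
      ≤ -(I' t + N' t) := fun t ht => by
    obtain ⟨-, -, -, iP⟩ := fu.integrable_products fP ht i j
    obtain ⟨-, -, -, iN⟩ := fu.integrable_products fN ht i j
    have e1 : ∀ x, gconv (heatK1 j t) h x = gconv (heatK1 j t) hP x - gconv (heatK1 j t) hN x :=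
      fun x => by
        unfold gconv
        rw [← integral_sub (integrable_gconv (continuous_heatK1 j t) cP sP x)
          (integrable_gconv (continuous_heatK1 j t) cN sN x)]
        simp only [hPN, mul_sub]
    have e2 : ∫ x, gconv (heatK1 i t) f x * gconv (heatK1 j t) h x
        = (∫ x, gconv (heatK1 i t) f x * gconv (heatK1 j t) hP x)
          - ∫ x, gconv (heatK1 i t) f x * gconv (heatK1 j t) hN x := by
      rw [← integral_sub iP iN]
      simp only [e1, mul_sub]
    rw [e2, abs_mul, abs_neg, abs_two]
    have a1 := abs_sub (∫ x, gconv (heatK1 i t) f x * gconv (heatK1 j t) hP x)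
      (∫ x, gconv (heatK1 i t) f x * gconv (heatK1 j t) hN x)
    have a2 := abs_integral_le_integral_abs (μ := volume)
      (f := fun x => gconv (heatK1 i t) f x * gconv (heatK1 j t) hP x)
    have a3 := abs_integral_le_integral_abs (μ := volume)
      (f := fun x => gconv (heatK1 i t) f x * gconv (heatK1 j t) hN x)
    have a4 := (hI t ht).2.2.2
    have a5 := (hN' t ht).2.2.2
    linarith
  set E := (∫ x, f x ^ p) + ∫ x, |h x| ^ q
  obtain ⟨L, hL⟩ := hk.exists_lipschitz
  set F := ∫ x, |f x|
  set G := ∫ x, |k x|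
  -- The flow is followed from time s to time 1/s, so that a single limit s → 0 handles both ends.
  have bound : ∀ s : ℝ, 0 < s → s ≤ 1 → |∫ x, f x * k x|
      ≤ 2 * (L * (2 * 2 ^ (3 / 2 : ℝ) * √s)) * F + 2 * C * E
        + (4 * Real.pi * s⁻¹) ^ (-(3 / 2) : ℝ) * F * G := fun s hs hs1 => by
    have hs' : 0 < s⁻¹ := inv_pos.2 hs
    have hsT : s ≤ s⁻¹ := hs1.trans ((one_le_inv₀ hs).2 hs1)
    have b1 := abs_pairing_sub_le hf hf' hk.continuous hk.hasCompactSupport hL hs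
    have b2 := abs_pairing_le hf hf' hk.continuous hk.hasCompactSupport hs'
    have b3 := abs_sub_le_of_abs_deriv_le hs hsT hJ
      (fun t ht => (hI t ht).1.add (hN' t ht).1) hle
    have c1 := (hI s hs).2.2.1
    have c2 := (hN' s hs).2.2.1
    have c3 := (hI s⁻¹ hs').2.1
    have c4 := (hN' s⁻¹ hs').2.1
    simp only [Pi.add_apply] at b3
    have c5 : C * ((∫ x, f x ^ p) + ∫ x, hP x ^ q) ≤ C * E :=
      mul_le_mul_of_nonneg_left (add_le_add le_rfl nP) hC
    have c6 : C * ((∫ x, f x ^ p) + ∫ x, hN x ^ q) ≤ C * E :=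
      mul_le_mul_of_nonneg_left (add_le_add le_rfl nN) hC
    rw [abs_le] at b1 b2 b3 ⊢
    constructor <;> linarith [b1.1, b1.2, b2.1, b2.2, b3.1, b3.2]
  have lim : Tendsto (fun s : ℝ => 2 * (L * (2 * 2 ^ (3 / 2 : ℝ) * √s)) * F + 2 * C * E
        + (4 * Real.pi * s⁻¹) ^ (-(3 / 2) : ℝ) * F * G) (nhdsWithin 0 (Set.Ioi 0))
      (nhds (2 * (L * (2 * 2 ^ (3 / 2 : ℝ) * √0)) * F + 2 * C * E + 0 * F * G)) := by
    refine Tendsto.add ?_ ((Tendsto.mul_const _ ?_).mul_const _)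
    · have : Continuous fun s : ℝ => 2 * (L * (2 * 2 ^ (3 / 2 : ℝ) * √s)) * F + 2 * C * E := by
        fun_prop
      exact (this.tendsto 0).mono_left nhdsWithin_le_nhds
    · refine (tendsto_rpow_neg_atTop (by norm_num : (0 : ℝ) < 3 / 2)).comp ?_
      exact tendsto_inv_nhdsGT_zero.const_mul_atTop (by positivity)
  have := ge_of_tendsto lim (by
    filter_upwards [Ioc_mem_nhdsGT (zero_lt_one' ℝ)] with s hs
    exact bound s hs.1 hs.2)
  simpa using this

/-- The **Calderón–Zygmund inequality** for test functions. -/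
theorem exists_integral_pderiv3_pderiv3_le {q : ℝ} (hq : 1 < q) :
    ∃ C : ℝ, 0 ≤ C ∧ ∀ φ : E3 → ℝ, IsTest φ → ∀ i j : Fin 3,
      ∫ x, |pderiv3 i (pderiv3 j φ) x| ^ q ≤ C * ∫ x, |lap3 φ x| ^ q := by
  have hpq' : q.HolderConjugate q.conjExponent := Real.HolderConjugate.conjExponent hq
  set p := q.conjExponent
  have hp : 1 < p := hpq'.symm.lt
  have hp0 : 0 < p := by linarith
  have hq0 : 0 < q := by linarith
  have hpq : 1 / p + 1 / q = 1 := by simpa using hpq'.symm.inv_add_inv_eq_one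
  obtain ⟨C, hC, H⟩ := exists_bilinear_bound hp hq hpq
  -- choose `s` with `C s^(p-1) ≤ 1/2`
  obtain ⟨s, hs, hs2⟩ : ∃ s : ℝ, 0 < s ∧ C * s ^ p ≤ s / 2 := by
    refine ⟨(2 * (C + 1))⁻¹ ^ (1 / (p - 1)), by positivity, ?_⟩
    set s := (2 * (C + 1))⁻¹ ^ (1 / (p - 1)) with hs
    have hs0 : 0 < s := by positivity
    have e : s ^ (p - 1) = (2 * (C + 1))⁻¹ := by
      rw [hs, ← Real.rpow_mul (by positivity), one_div_mul_cancel (by linarith), Real.rpow_one]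
    have e2 : s ^ p = s ^ (p - 1) * s := by
      rw [← Real.rpow_add_one hs0.ne']; congr 1; ring
    rw [e2, e]
    have : C * (2 * (C + 1))⁻¹ ≤ 1 / 2 := by
      rw [← div_eq_mul_inv, div_le_div_iff₀ (by positivity) (by norm_num)]; linarith
    nlinarith
  refine ⟨2 * (2 * C / s), by positivity, fun φ hφ i j => ?_⟩
  set k := pderiv3 i (pderiv3 j φ)
  have hk : IsTest k := (hφ.pderiv3 j).pderiv3 i
  set B := ∫ x, |lap3 φ x| ^ q
  -- Duality with f = s m^(q−1), where m is the positive part of εk. As (q − 1)p = q, f^p = s^p m^q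
  -- and f k = ε s m^q, so sA ≤ C(s^p A + B) with A = ∫ m^q. The choice of s absorbs the finite
  -- quantity A on the right.
  have half : ∀ ε : ℝ, |ε| = 1 → ∫ x, max (ε * k x) 0 ^ q ≤ 2 * C / s * B := fun ε hε => by
    obtain ⟨cM, sM, -⟩ := integral_rpow_max_le hk.continuous hk.hasCompactSupport hq ε hε
    set m := fun x => max (ε * k x) 0
    have hm0 : ∀ x, 0 ≤ m x := fun x => le_max_right _ _
    have hq1 : 0 < q - 1 := by linarith
    set A := ∫ x, m x ^ q
    have h1 := H (fun x => s * m x ^ (q - 1)) φ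
      (continuous_const.mul (cM.rpow_const fun _ => Or.inr hq1.le))
      (sM.comp_left (g := fun r => s * r ^ (q - 1)) (by simp [Real.zero_rpow hq1.ne']))
      (fun y => mul_nonneg hs.le (Real.rpow_nonneg (hm0 y) _)) hφ i j
    have e1 : ∀ x, (s * m x ^ (q - 1)) ^ p = s ^ p * m x ^ q := fun x => by
      rw [Real.mul_rpow hs.le (Real.rpow_nonneg (hm0 x) _), ← Real.rpow_mul (hm0 x)]
      congr 2
      field_simp at hpq
      linarith
    have e2 : ∀ x, s * m x ^ (q - 1) * k x = ε * (s * m x ^ q) := fun x => by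
      have hεε : ε * ε = 1 := by rw [← abs_mul_abs_self, hε, one_mul]
      have e3 : m x ^ (q - 1) * (ε * k x) = m x ^ q := by
        rcases le_total (ε * k x) 0 with h0 | h0
        · have : m x = 0 := max_eq_right h0
          rw [this, Real.zero_rpow hq1.ne', Real.zero_rpow hq0.ne', zero_mul]
        · have : m x = ε * k x := max_eq_left h0
          rw [← this]
          rcases eq_or_lt_of_le (hm0 x) with h2 | h2
          · rw [← h2, Real.zero_rpow hq0.ne', mul_zero]
          · rw [← Real.rpow_add_one h2.ne']; congr 1; ring
      rw [← e3]
      linear_combination (-(s * m x ^ (q - 1) * k x)) * hεε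
    change |∫ x, s * m x ^ (q - 1) * k x| ≤ _ at h1
    simp only [e1, e2, integral_const_mul, abs_mul, hε, one_mul, abs_of_pos hs] at h1
    have hA : 0 ≤ A := integral_nonneg fun x => Real.rpow_nonneg (hm0 x) _
    change s * |A| ≤ C * (s ^ p * A + B) at h1
    rw [abs_of_nonneg hA] at h1
    have h2 : C * s ^ p * A ≤ s / 2 * A := mul_le_mul_of_nonneg_right hs2 hA
    rw [div_mul_eq_mul_div, le_div_iff₀ hs]
    linarith
  have hsum : ∀ x, |k x| ^ q = max (1 * k x) 0 ^ q + max (-1 * k x) 0 ^ q := fun x => by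
    rcases le_total 0 (k x) with h0 | h0
    · rw [max_eq_left (by linarith), max_eq_right (by linarith), abs_of_nonneg h0,
        Real.zero_rpow hq0.ne', one_mul, add_zero]
    · rw [max_eq_right (by linarith), max_eq_left (by linarith), abs_of_nonpos h0,
        Real.zero_rpow hq0.ne', zero_add, neg_one_mul]
  have int : ∀ ε : ℝ, |ε| = 1 → Integrable fun x => max (ε * k x) 0 ^ q := fun ε hε => by
    obtain ⟨cM, sM, -⟩ := integral_rpow_max_le hk.continuous hk.hasCompactSupport hq ε hε
    exact (cM.rpow_const fun _ => Or.inr hq0.le).integrable_of_hasCompactSupport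
      (sM.comp_left (g := fun r : ℝ => r ^ q) (Real.zero_rpow hq0.ne'))
  simp only [hsum]
  rw [integral_add (int 1 (by norm_num)) (int (-1) (by norm_num))]
  linarith [half 1 (by norm_num), half (-1) (by norm_num)]

end Apriori

/-! ### The fundamental solution of the Helmholtz operator -/

/-- The radial profile of the fundamental solution. -/
noncomputable def helmA (lam : ℂ) (r : ℝ) : ℂ :=
  -Complex.exp (Complex.I * lam * (r : ℂ)) / (4 * (Real.pi : ℂ) * (r : ℂ))

/-- `helmB r = helmA' r / r`. -/
noncomputable def helmB (lam : ℂ) (r : ℝ) : ℂ :=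
  -Complex.exp (Complex.I * lam * (r : ℂ)) * (Complex.I * lam * r - 1)
    / (4 * (Real.pi : ℂ) * (r : ℂ) ^ 3)

/-- `helmC r = helmB' r / r`. -/
noncomputable def helmC (lam : ℂ) (r : ℝ) : ℂ :=
  -Complex.exp (Complex.I * lam * (r : ℂ)) * (-lam ^ 2 * r ^ 2 - 3 * Complex.I * lam * r + 3)
    / (4 * (Real.pi : ℂ) * (r : ℂ) ^ 5)

section Radial

variable (lam : ℂ) {r : ℝ}

theorem hasDerivAt_cexp_radial (r : ℝ) :
    HasDerivAt (fun r : ℝ => Complex.exp (Complex.I * lam * (r : ℂ)))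
      (Complex.I * lam * Complex.exp (Complex.I * lam * (r : ℂ))) r := by
  have := ((Complex.ofRealCLM.hasDerivAt (x := r)).const_mul (Complex.I * lam)).cexp
  simp only [Complex.ofRealCLM_apply, Complex.ofReal_one, mul_one] at this
  exact this.congr_deriv (by ring)

theorem hasDerivAt_ofReal_pow (n : ℕ) (r : ℝ) :
    HasDerivAt (fun r : ℝ => (r : ℂ) ^ n) (n * (r : ℂ) ^ (n - 1)) r := by
  have := (Complex.ofRealCLM.hasDerivAt (x := r)).pow n
  simp only [Complex.ofRealCLM_apply, Complex.ofReal_one, mul_one] at this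
  exact this

theorem hasDerivAt_helmA (hr : 0 < r) : HasDerivAt (helmA lam) (r * helmB lam r) r := by
  have hr' : (r : ℂ) ≠ 0 := by exact_mod_cast hr.ne'
  have hpi : (Real.pi : ℂ) ≠ 0 := by exact_mod_cast Real.pi_ne_zero
  have h1 := (hasDerivAt_cexp_radial lam r).neg
  have h2 := (hasDerivAt_ofReal_pow 1 r).const_mul (4 * (Real.pi : ℂ))
  simp only [pow_one] at h2
  refine (h1.div h2 (by simp [hr', hpi])).congr_deriv ?_
  simp [helmB]
  field_simp
  ring

theorem hasDerivAt_helmB (hr : 0 < r) : HasDerivAt (helmB lam) (r * helmC lam r) r := by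
  have hr' : (r : ℂ) ≠ 0 := by exact_mod_cast hr.ne'
  have hpi : (Real.pi : ℂ) ≠ 0 := by exact_mod_cast Real.pi_ne_zero
  have h1 := (hasDerivAt_cexp_radial lam r).neg
  have h3 := ((hasDerivAt_ofReal_pow 1 r).const_mul (Complex.I * lam)).sub_const 1
  simp only [pow_one] at h3
  have h2 := (hasDerivAt_ofReal_pow 3 r).const_mul (4 * (Real.pi : ℂ))
  refine ((h1.mul h3).div h2 (by simp [hr', hpi])).congr_deriv ?_
  simp [helmC]
  field_simp
  ring_nf
  simp only [Complex.I_sq]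
  ring

/-- The radial form of the Helmholtz equation. -/
theorem helm_equation (hr : 0 < r) :
    3 * helmB lam r + (r : ℂ) ^ 2 * helmC lam r + lam ^ 2 * helmA lam r = 0 := by
  have hr' : (r : ℂ) ≠ 0 := by exact_mod_cast hr.ne'
  have hpi : (Real.pi : ℂ) ≠ 0 := by exact_mod_cast Real.pi_ne_zero
  unfold helmA helmB helmC
  field_simp
  ring

theorem contDiffAt_helmA (hr : 0 < r) {n : WithTop ℕ∞} : ContDiffAt ℝ n (helmA lam) r := by
  have h : ContDiffAt ℝ n (fun r : ℝ => (r : ℂ)) r := Complex.ofRealCLM.contDiff.contDiffAt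
  have hr' : (r : ℂ) ≠ 0 := by exact_mod_cast hr.ne'
  have hpi : (Real.pi : ℂ) ≠ 0 := by exact_mod_cast Real.pi_ne_zero
  have h1 : ContDiffAt ℝ n (fun r : ℝ => -Complex.exp (Complex.I * lam * (r : ℂ))) r :=
    (contDiffAt_const.mul h).cexp.neg
  have h2 : ContDiffAt ℝ n (fun r : ℝ => 4 * (Real.pi : ℂ) * (r : ℂ)) r := contDiffAt_const.mul h
  exact (h1.mul (h2.inv (by simp [hr', hpi]))).congr_of_eventuallyEq
    (Eventually.of_forall fun _ => div_eq_mul_inv _ _)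

theorem norm_cexp_radial_le (hr : 0 ≤ r) :
    ‖Complex.exp (Complex.I * lam * (r : ℂ))‖ ≤ Real.exp (‖lam‖ * r) := by
  refine (Complex.norm_exp_le_exp_norm _).trans (Real.exp_le_exp.2 ?_)
  simp [abs_of_nonneg hr]

theorem norm_helmA_le (hr : 0 < r) : ‖helmA lam r‖ ≤ Real.exp (‖lam‖ * r) / r := by
  unfold helmA
  rw [norm_div, norm_neg]
  have hpi := Real.pi_gt_three
  have : ‖(4 * (Real.pi : ℂ) * (r : ℂ))‖ = 4 * Real.pi * r := by
    simp [abs_of_pos hr, abs_of_pos Real.pi_pos]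
  rw [this]
  have := norm_cexp_radial_le lam hr.le
  gcongr
  nlinarith

theorem norm_helmB_le (hr : 0 < r) :
    ‖helmB lam r‖ ≤ Real.exp (‖lam‖ * r) * (‖lam‖ * r + 1) / r ^ 3 := by
  unfold helmB
  rw [norm_div, norm_mul, norm_neg]
  have hpi := Real.pi_gt_three
  have : ‖(4 * (Real.pi : ℂ) * (r : ℂ) ^ 3)‖ = 4 * Real.pi * r ^ 3 := by
    simp [abs_of_pos hr, abs_of_pos Real.pi_pos]
  rw [this]
  have h1 := norm_cexp_radial_le lam hr.le
  have h2 : ‖Complex.I * lam * r - 1‖ ≤ ‖lam‖ * r + 1 := by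
    refine (norm_sub_le _ _).trans ?_
    simp [abs_of_pos hr]
  have h3 : 0 < r ^ 3 := by positivity
  gcongr
  nlinarith

end Radial

/-! ### Regularization of the fundamental solution -/

/-- The regularized radius `√(|x|² + ε²)`. -/
noncomputable def regNorm (ε : ℝ) (x : E3) : ℝ := √(‖x‖ ^ 2 + ε ^ 2)

section Reg

variable {ε : ℝ}

theorem regNorm_pos (hε : 0 < ε) (x : E3) : 0 < regNorm ε x := by
  unfold regNorm; positivity

theorem regNorm_sq (ε : ℝ) (x : E3) : regNorm ε x ^ 2 = ‖x‖ ^ 2 + ε ^ 2 :=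
  Real.sq_sqrt (by positivity)

theorem norm_le_regNorm (ε : ℝ) (x : E3) : ‖x‖ ≤ regNorm ε x :=
  Real.le_sqrt_of_sq_le (by nlinarith [sq_nonneg ε])

theorem regNorm_le (hε : 0 ≤ ε) (x : E3) : regNorm ε x ≤ ‖x‖ + ε := by
  unfold regNorm
  rw [Real.sqrt_le_left (by positivity)]
  nlinarith [norm_nonneg x]

theorem continuous_regNorm (ε : ℝ) : Continuous (regNorm ε) := by
  unfold regNorm; fun_prop

theorem tendsto_regNorm (x : E3) :
    Tendsto (fun ε => regNorm ε x) (nhdsWithin 0 (Set.Ioi 0)) (nhds ‖x‖) := by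
  have : Continuous fun ε => regNorm ε x := by unfold regNorm; fun_prop
  have h := (this.tendsto 0).mono_left (nhdsWithin_le_nhds (s := Set.Ioi 0))
  simpa [regNorm] using h

theorem hasDerivAt_regNorm (k : Fin 3) {x : E3} (hr : 0 < regNorm ε x) :
    HasDerivAt (fun s : ℝ => regNorm ε (x + s • e3 k)) (x k / regNorm ε x) 0 := by
  have e : (fun s : ℝ => regNorm ε (x + s • e3 k))
      = fun s => √(‖x‖ ^ 2 + 2 * s * x k + s ^ 2 + ε ^ 2) := by
    funext s; simp only [regNorm, norm_sq_add_smul]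
  rw [e]
  have h1 : HasDerivAt (fun s : ℝ => ‖x‖ ^ 2 + 2 * s * x k + s ^ 2 + ε ^ 2) (2 * x k) 0 := by
    have := (((((hasDerivAt_id (0 : ℝ)).const_mul 2).mul_const (x k)).const_add (‖x‖ ^ 2)).add
      ((hasDerivAt_id (0 : ℝ)).pow 2)).add_const (ε ^ 2)
    exact this.congr_deriv (by simp)
  have hne : ‖x‖ ^ 2 + 2 * 0 * x k + 0 ^ 2 + ε ^ 2 ≠ 0 := by
    have := Real.sqrt_pos.1 hr
    linarith
  refine (h1.sqrt hne).congr_deriv ?_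
  have : √(‖x‖ ^ 2 + 2 * 0 * x k + 0 ^ 2 + ε ^ 2) = regNorm ε x := by
    unfold regNorm; congr 1; ring
  rw [this, mul_div_mul_left _ _ two_ne_zero]

theorem hasLineDerivAt_radial {A : ℝ → ℂ} {B : ℂ} {x : E3} (hr : 0 < regNorm ε x) (k : Fin 3)
    (hA : HasDerivAt A (regNorm ε x * B) (regNorm ε x)) :
    HasLineDerivAt ℝ (fun x => A (regNorm ε x)) (x k * B) x (e3 k) := by
  have e0 : x + (0 : ℝ) • e3 k = x := by simp
  have h := HasDerivAt.scomp (0 : ℝ) (g₁ := A) (h := fun s : ℝ => regNorm ε (x + s • e3 k))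
    (by rw [e0]; exact hA) (hasDerivAt_regNorm k hr)
  refine h.congr_deriv ?_
  have hr' : (regNorm ε x : ℂ) ≠ 0 := by exact_mod_cast hr.ne'
  rw [Complex.real_smul]
  push_cast
  field_simp

theorem continuous_radial (hε : 0 < ε) {A B : ℝ → ℂ}
    (hA : ∀ r, 0 < r → HasDerivAt A (B r) r) : Continuous fun x => A (regNorm ε x) :=
  continuous_iff_continuousAt.2 fun x =>
    (hA _ (regNorm_pos hε x)).continuousAt.comp (f := regNorm ε) (continuous_regNorm ε).continuousAt

theorem hasDerivAt_helmC (lam : ℂ) {r : ℝ} (hr : 0 < r) :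
    HasDerivAt (helmC lam) (deriv (helmC lam) r) r := by
  have hr' : (r : ℂ) ≠ 0 := by exact_mod_cast hr.ne'
  have hpi : (Real.pi : ℂ) ≠ 0 := by exact_mod_cast Real.pi_ne_zero
  have h : DifferentiableAt ℝ (fun r : ℝ => (r : ℂ)) r := Complex.ofRealCLM.differentiableAt
  refine DifferentiableAt.hasDerivAt ?_
  unfold helmC
  refine DifferentiableAt.div ?_ ((differentiableAt_const _).mul (h.pow 5)) (by simp [hr', hpi])
  exact ((((differentiableAt_const _).mul h).cexp).neg).mul (by fun_prop)

end Reg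

/-! ### Integration by parts against the regularized kernels -/

section FundamentalSolution

variable {φ : E3 → ℂ}

theorem integral_mul_pderiv3_eq_neg {f f' : E3 → ℂ} {k : Fin 3} (hf : Continuous f)
    (hf' : Continuous f') (h : ∀ x, HasLineDerivAt ℝ f (f' x) x (e3 k)) (hφ : IsTest φ) :
    ∫ x, f x * pderiv3 k φ x = -∫ x, f' x * φ x := by
  have h1 := (hφ.pderiv3 k).continuous
  have h2 := hφ.continuous
  have := integral_bilinear_hasLineDerivAt_right_eq_neg_left_of_integrable (μ := volume)
    (f := f) (f' := f') (g := φ) (g' := pderiv3 k φ) (v := e3 k)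
    (B := ContinuousLinearMap.mul ℝ ℂ)
    ((hf'.mul h2).integrable_of_hasCompactSupport hφ.hasCompactSupport.mul_left)
    ((hf.mul h1).integrable_of_hasCompactSupport (hφ.pderiv3 k).hasCompactSupport.mul_left)
    ((hf.mul h2).integrable_of_hasCompactSupport hφ.hasCompactSupport.mul_left)
    (fun x _ => h x) (fun x _ => hφ.hasLineDerivAt k x)
  simpa using this

theorem continuous_coord (k : Fin 3) : Continuous fun x : E3 => ((x k : ℝ) : ℂ) := by fun_prop

theorem hasLineDerivAt_coord_mul {f : E3 → ℂ} {f' : ℂ} {x : E3} {k : Fin 3}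
    (h : HasLineDerivAt ℝ f f' x (e3 k)) :
    HasLineDerivAt ℝ (fun x : E3 => (x k : ℂ) * f x) (f x + x k * f') x (e3 k) := by
  have h1 : HasDerivAt (fun s : ℝ => (((x + s • e3 k) k : ℝ) : ℂ)) 1 0 := by
    have : (fun s : ℝ => (((x + s • e3 k) k : ℝ) : ℂ)) = fun s : ℝ => (x k : ℂ) + (s : ℂ) := by
      funext s; simp [e3]
    rw [this]
    have := (Complex.ofRealCLM.hasDerivAt (x := (0 : ℝ))).const_add (x k : ℂ)
    simpa using this
  have h2 : HasDerivAt (fun s : ℝ => f (x + s • e3 k)) f' 0 := h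
  refine (h1.mul h2).congr_deriv ?_
  simp

theorem continuous_helmA_regNorm (lam : ℂ) {ε : ℝ} (hε : 0 < ε) :
    Continuous fun x => helmA lam (regNorm ε x) :=
  continuous_radial hε (fun _ hr => hasDerivAt_helmA lam hr)

theorem continuous_helmB_regNorm (lam : ℂ) {ε : ℝ} (hε : 0 < ε) :
    Continuous fun x => helmB lam (regNorm ε x) :=
  continuous_radial hε (fun _ hr => hasDerivAt_helmB lam hr)

theorem continuous_helmC_regNorm (lam : ℂ) {ε : ℝ} (hε : 0 < ε) :
    Continuous fun x => helmC lam (regNorm ε x) :=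
  continuous_radial hε (fun _ hr => hasDerivAt_helmC lam hr)

theorem integral_helmA_mul_pderiv3 (lam : ℂ) {ε : ℝ} (hε : 0 < ε) (hφ : IsTest φ) (k : Fin 3) :
    ∫ x, helmA lam (regNorm ε x) * pderiv3 k φ x
      = -∫ x, (x k * helmB lam (regNorm ε x)) * φ x :=
  integral_mul_pderiv3_eq_neg (continuous_helmA_regNorm lam hε)
    ((continuous_coord k).mul (continuous_helmB_regNorm lam hε))
    (fun _ => hasLineDerivAt_radial (regNorm_pos hε _) k (hasDerivAt_helmA lam (regNorm_pos hε _))) hφ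

theorem integral_helmB_mul_pderiv3 (lam : ℂ) {ε : ℝ} (hε : 0 < ε) (hφ : IsTest φ) (k : Fin 3) :
    ∫ x, (x k * helmB lam (regNorm ε x)) * pderiv3 k φ x
      = -∫ x, (helmB lam (regNorm ε x) + x k * (x k * helmC lam (regNorm ε x))) * φ x :=
  integral_mul_pderiv3_eq_neg ((continuous_coord k).mul (continuous_helmB_regNorm lam hε))
    ((continuous_helmB_regNorm lam hε).add ((continuous_coord k).mul
      ((continuous_coord k).mul (continuous_helmC_regNorm lam hε))))
    (fun _ => hasLineDerivAt_coord_mul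
      (hasLineDerivAt_radial (regNorm_pos hε _) k (hasDerivAt_helmB lam (regNorm_pos hε _)))) hφ

theorem IsTest.integrable_mul (hφ : IsTest φ) {f : E3 → ℂ} (hf : Continuous f) :
    Integrable fun x => f x * φ x :=
  (hf.mul hφ.continuous).integrable_of_hasCompactSupport hφ.hasCompactSupport.mul_left

theorem sum_coord_sq (x : E3) : ∑ k : Fin 3, x k ^ 2 = ‖x‖ ^ 2 := by
  rw [EuclideanSpace.norm_sq_eq]; simp

/-- For a function A of r = √(|x|² + ε²) the Laplacian is 3B + |x|²C. The radial Helmholtz equation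
has r² in place of |x|² = r² − ε², so the defect is exactly −ε²C. -/
theorem integral_regularized_helmholtz (lam : ℂ) {ε : ℝ} (hε : 0 < ε) (hφ : IsTest φ) :
    ∫ x, helmA lam (regNorm ε x) * (lap3 φ x + lam ^ 2 * φ x)
      = ∫ x, -(ε : ℂ) ^ 2 * helmC lam (regNorm ε x) * φ x := by
  have hA := continuous_helmA_regNorm lam hε
  have hB := continuous_helmB_regNorm lam hε
  have hC := continuous_helmC_regNorm lam hε
  have h1 : ∀ k : Fin 3, ∫ x, helmA lam (regNorm ε x) * pderiv3 k (pderiv3 k φ) x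
      = ∫ x, (helmB lam (regNorm ε x) + x k * (x k * helmC lam (regNorm ε x))) * φ x := fun k => by
    rw [integral_helmA_mul_pderiv3 lam hε (hφ.pderiv3 k), integral_helmB_mul_pderiv3 lam hε hφ,
      neg_neg]
  have i1 : ∀ k : Fin 3, Integrable fun x => helmA lam (regNorm ε x) * pderiv3 k (pderiv3 k φ) x :=
    fun k => ((hφ.pderiv3 k).pderiv3 k).integrable_mul hA
  have i2 : ∀ k : Fin 3, Integrable fun x : E3 =>
      (helmB lam (regNorm ε x) + x k * (x k * helmC lam (regNorm ε x))) * φ x := fun k =>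
    hφ.integrable_mul (hB.add ((continuous_coord k).mul ((continuous_coord k).mul hC)))
  have i3 : Integrable fun x => lam ^ 2 * helmA lam (regNorm ε x) * φ x :=
    hφ.integrable_mul (continuous_const.mul hA)
  have e1 : ∀ x, helmA lam (regNorm ε x) * (lap3 φ x + lam ^ 2 * φ x)
      = (∑ k, helmA lam (regNorm ε x) * pderiv3 k (pderiv3 k φ) x)
        + lam ^ 2 * helmA lam (regNorm ε x) * φ x := fun x => by
    rw [lap3, ← Finset.mul_sum]; ring
  simp only [e1]
  rw [integral_add (integrable_finsetSum _ fun k _ => i1 k) i3,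
    integral_finsetSum _ fun k _ => i1 k, Finset.sum_congr rfl fun k _ => h1 k,
    ← integral_finsetSum _ fun k _ => i2 k, ← integral_add (integrable_finsetSum _ fun k _ => i2 k) i3]
  refine integral_congr_ae (Eventually.of_forall fun x => ?_)
  have h2 := helm_equation lam (regNorm_pos hε x)
  have h3 : ((regNorm ε x : ℝ) : ℂ) ^ 2 = (x 0 : ℂ) ^ 2 + (x 1 : ℂ) ^ 2 + (x 2 : ℂ) ^ 2
      + (ε : ℂ) ^ 2 := by
    have := regNorm_sq ε x
    rw [← sum_coord_sq, Fin.sum_univ_three] at this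
    exact_mod_cast this
  rw [h3] at h2
  simp only [Fin.sum_univ_three]
  linear_combination (φ x) * h2

/-- Continuous compactly supported functions may be integrated against `‖x‖^(-a)`, `a < 3`. -/
theorem integrable_norm_rpow_mul {a : ℝ} (ha : a < 3) {ψ : E3 → ℂ} (hψ : Continuous ψ)
    (hψ' : HasCompactSupport ψ) : Integrable fun x => ‖x‖ ^ (-a) * ‖ψ x‖ := by
  have h : LocallyIntegrable (fun x : E3 => ‖x‖ ^ (-a)) := by
    refine locallyIntegrable_of_norm_le_rpow (by simp) (α := a) (by simpa using ha) (C := 1) ?_ ?_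
    · refine Eventually.of_forall fun x => ?_
      rw [one_mul, Real.norm_of_nonneg (by positivity)]
    · exact (measurable_norm.pow_const _).aestronglyMeasurable
  have := h.integrable_smul_right_of_hasCompactSupport hψ.norm hψ'.norm
  simpa using this

end FundamentalSolution

/-! ### The limit ε → 0 and the point mass -/

section Delta

theorem regNorm_one_sq (x : E3) : regNorm 1 x = √(1 + ‖x‖ ^ 2) := by
  unfold regNorm; congr 1; ring

theorem integrable_inv_regNorm_pow : Integrable fun z : E3 => (regNorm 1 z ^ 5)⁻¹ := by
  have h := integrable_rpow_neg_one_add_norm_sq (E := E3) (μ := volume) (r := 5) (by simp; norm_num)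
  refine h.congr (Eventually.of_forall fun x => ?_)
  have h0 : 0 < 1 + ‖x‖ ^ 2 := by positivity
  change (1 + ‖x‖ ^ 2) ^ (-5 / 2 : ℝ) = (regNorm 1 x ^ 5)⁻¹
  rw [regNorm_one_sq, Real.sqrt_eq_rpow, ← Real.rpow_mul_natCast h0.le, ← Real.rpow_neg h0.le]
  norm_num

/-- In polar coordinates the radial integrand r²(1 + r²)^(−5/2) has the antiderivative (r/√(1 +
r²))³/3. The value 4π/3 normalizes the point mass: `helmN` at 0 is 3/(4π). -/
theorem integral_inv_regNorm_pow : ∫ z : E3, (regNorm 1 z ^ 5)⁻¹ = 4 * Real.pi / 3 := by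
  have e : ∀ z : E3, (regNorm 1 z ^ 5)⁻¹ = (fun r : ℝ => (√(1 + r ^ 2) ^ 5)⁻¹) ‖z‖ := fun z => by
    rw [regNorm_one_sq]
  simp_rw [e]
  rw [integral_fun_norm_addHaar volume (fun r : ℝ => (√(1 + r ^ 2) ^ 5)⁻¹)]
  have h1 : ∀ r : ℝ, HasDerivAt (fun r : ℝ => (r / √(1 + r ^ 2)) ^ 3 / 3)
      (r ^ 2 * (√(1 + r ^ 2) ^ 5)⁻¹) r := fun r => by
    have hp : 0 < 1 + r ^ 2 := by positivity
    have hs : 0 < √(1 + r ^ 2) := Real.sqrt_pos.2 hp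
    have hq : √(1 + r ^ 2) ^ 2 = 1 + r ^ 2 := Real.sq_sqrt hp.le
    have h2 : HasDerivAt (fun r : ℝ => √(1 + r ^ 2)) (2 * r / (2 * √(1 + r ^ 2))) r := by
      have h3 : HasDerivAt (fun r : ℝ => 1 + r ^ 2) (2 * r) r :=
        (((hasDerivAt_id r).pow 2).const_add 1).congr_deriv (by simp)
      exact h3.sqrt hp.ne'
    have h4 := ((((hasDerivAt_id r).div h2 hs.ne')).pow 3).div_const 3
    refine h4.congr_deriv ?_
    simp only [id, Pi.div_apply]
    field_simp
    simp only [hq]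
    ring_nf
    field_simp
    simp only [hq]
  have h2 : Tendsto (fun r : ℝ => (r / √(1 + r ^ 2)) ^ 3 / 3) atTop (nhds (1 ^ 3 / 3)) := by
    refine Tendsto.div_const (Tendsto.pow ?_ 3) 3
    have h3 : Tendsto (fun r : ℝ => √((1 + (r ^ 2)⁻¹)⁻¹)) atTop (nhds 1) := by
      have : Tendsto (fun r : ℝ => (r ^ 2)⁻¹) atTop (nhds 0) :=
        tendsto_inv_atTop_zero.comp (tendsto_pow_atTop two_ne_zero)
      have := ((this.const_add 1).inv₀ (by norm_num)).sqrt
      simpa using this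
    refine h3.congr' ?_
    filter_upwards [eventually_gt_atTop 0] with r hr
    have : (1 + (r ^ 2)⁻¹)⁻¹ = r ^ 2 / (1 + r ^ 2) := by field_simp; ring
    rw [this, Real.sqrt_div (by positivity), Real.sqrt_sq hr.le]
  have h3 := integral_Ioi_of_hasDerivAt_of_nonneg' (a := 0) (fun x _ => h1 x)
    (fun x _ => by positivity) h2
  have h4 : (volume : Measure E3).real (Metric.ball 0 1) = Real.pi * 4 / 3 := by
    rw [Measure.real, EuclideanSpace.volume_ball_fin_three]
    have := Real.pi_pos
    simp
    positivity
  simp only [finrank_euclideanSpace, Fintype.card_fin, smul_eq_mul, nsmul_eq_mul,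
    Nat.reduceSub]
  rw [h3, h4]
  norm_num
  ring

theorem regNorm_smul {ε : ℝ} (hε : 0 < ε) (z : E3) : regNorm ε (ε • z) = ε * regNorm 1 z := by
  unfold regNorm
  rw [norm_smul, Real.norm_of_nonneg hε.le, ← Real.sqrt_sq hε.le, ← Real.sqrt_mul (by positivity),
    Real.sqrt_sq hε.le]
  congr 1
  ring

/-- The numerator of `-helmC`. -/
noncomputable def helmN (lam : ℂ) (r : ℝ) : ℂ :=
  Complex.exp (Complex.I * lam * (r : ℂ)) * (-lam ^ 2 * r ^ 2 - 3 * Complex.I * lam * r + 3)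
    / (4 * (Real.pi : ℂ))

theorem continuous_helmN (lam : ℂ) : Continuous (helmN lam) := by
  unfold helmN; fun_prop

theorem neg_helmC_eq (lam : ℂ) (r : ℝ) : -helmC lam r = helmN lam r / (r : ℂ) ^ 5 := by
  unfold helmC helmN
  rw [div_div, neg_mul, neg_div, neg_neg]

variable {φ : E3 → ℂ}

/-- After the substitution x = εz the powers of ε cancel: ε² from the defect, ε³ from the volume,
ε^(−5) from the kernel. What remains converges dominatedly, with majorant a multiple of (1 +
|z|²)^(−5/2). -/
theorem tendsto_integral_helmC (lam : ℂ) (hφ : IsTest φ) :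
    Tendsto (fun ε : ℝ => ∫ x, -(ε : ℂ) ^ 2 * helmC lam (regNorm ε x) * φ x)
      (nhdsWithin 0 (Set.Ioi 0)) (nhds (φ 0)) := by
  obtain ⟨M, hM⟩ := hφ.hasCompactSupport.isCompact.isBounded.exists_norm_le
  have hM0 : 0 ≤ max M 0 := le_max_right _ _
  obtain ⟨K, hK⟩ := (isCompact_Icc (a := (0 : ℝ)) (b := max M 0 + 1)).exists_bound_of_continuousOn
    (continuous_helmN lam).continuousOn
  obtain ⟨L, hL⟩ := hφ.hasCompactSupport.exists_bound_of_continuous hφ.continuous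
  have hK0 : 0 ≤ K := (norm_nonneg _).trans (hK 0 ⟨le_rfl, by positivity⟩)
  have hL0 : 0 ≤ L := (norm_nonneg _).trans (hL 0)
  have key : ∀ ε : ℝ, 0 < ε → ∫ x, -(ε : ℂ) ^ 2 * helmC lam (regNorm ε x) * φ x
      = ∫ z, helmN lam (ε * regNorm 1 z) * φ (ε • z) * (((regNorm 1 z ^ 5)⁻¹ : ℝ) : ℂ) := by
    intro ε hε
    have h := Measure.integral_comp_smul_of_nonneg (volume : Measure E3)
      (fun x => -(ε : ℂ) ^ 2 * helmC lam (regNorm ε x) * φ x) ε (hR := hε.le)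
    have hε' : (ε : ℂ) ≠ 0 := by exact_mod_cast hε.ne'
    simp only [finrank_euclideanSpace, Fintype.card_fin] at h
    have h' : ∫ x, -(ε : ℂ) ^ 2 * helmC lam (regNorm ε x) * φ x = (ε : ℂ) ^ 3 *
        ∫ x, -(ε : ℂ) ^ 2 * helmC lam (regNorm ε (ε • x)) * φ (ε • x) := by
      rw [h, Complex.real_smul]
      push_cast
      rw [mul_inv_cancel_left₀ (pow_ne_zero 3 hε')]
    rw [h', ← integral_const_mul]
    refine integral_congr_ae (Eventually.of_forall fun z => ?_)
    have hz : ((regNorm 1 z : ℝ) : ℂ) ≠ 0 := by exact_mod_cast (regNorm_pos one_pos z).ne'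
    have h5 := neg_helmC_eq lam (ε * regNorm 1 z)
    simp only [regNorm_smul hε]
    push_cast at h5 ⊢
    rw [show -(ε : ℂ) ^ 2 * helmC lam (ε * regNorm 1 z) * φ (ε • z)
      = (ε : ℂ) ^ 2 * (-helmC lam (ε * regNorm 1 z)) * φ (ε • z) by ring, h5]
    field_simp
  have lim : φ 0 = ∫ z : E3, helmN lam 0 * φ 0 * (((regNorm 1 z ^ 5)⁻¹ : ℝ) : ℂ) := by
    rw [integral_const_mul, integral_complex_ofReal, integral_inv_regNorm_pow]
    have hpi : (Real.pi : ℂ) ≠ 0 := by exact_mod_cast Real.pi_ne_zero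
    simp [helmN]
    field_simp
  rw [lim]
  refine Tendsto.congr' (EventuallyEq.symm (eventually_nhdsWithin_of_forall fun ε hε => key ε hε)) ?_
  refine tendsto_integral_filter_of_dominated_convergence
    (fun z => K * L * (regNorm 1 z ^ 5)⁻¹) ?_ ?_ (integrable_inv_regNorm_pow.const_mul _) ?_
  · refine Eventually.of_forall fun ε => Continuous.aestronglyMeasurable ?_
    have h1 := continuous_helmN lam
    have h2 := continuous_regNorm 1
    have h3 := hφ.continuous
    have h4 : Continuous fun z : E3 => (regNorm 1 z ^ 5)⁻¹ :=
      (h2.pow 5).inv₀ fun z => (pow_pos (regNorm_pos one_pos z) 5).ne'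
    fun_prop
  · filter_upwards [Ioc_mem_nhdsGT (zero_lt_one' ℝ)] with ε hε
    refine Eventually.of_forall fun z => ?_
    have hρ := regNorm_pos one_pos z
    rw [norm_mul, norm_mul, Complex.norm_real, Real.norm_of_nonneg (by positivity)]
    -- Off the support there is nothing to bound; on it ε·regNorm 1 z stays in a fixed compact
    -- interval, where `helmN` is bounded.
    by_cases hz : φ (ε • z) = 0
    · rw [hz]; simp; positivity
    have h1 : ‖ε • z‖ ≤ M := hM _ (subset_tsupport _ hz)
    have h2 : ε * regNorm 1 z ≤ max M 0 + 1 := by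
      rw [← regNorm_smul hε.1]
      exact (regNorm_le hε.1.le _).trans (add_le_add (h1.trans (le_max_left _ _)) hε.2)
    have h3 := hK (ε * regNorm 1 z) ⟨mul_nonneg hε.1.le hρ.le, h2⟩
    have h4 := hL (ε • z)
    gcongr
  · refine Eventually.of_forall fun z => ?_
    have h1 := continuous_helmN lam
    have h3 := hφ.continuous
    have : Continuous fun ε : ℝ => helmN lam (ε * regNorm 1 z) * φ (ε • z)
        * (((regNorm 1 z ^ 5)⁻¹ : ℝ) : ℂ) := by fun_prop
    have := (this.tendsto 0).mono_left (nhdsWithin_le_nhds (s := Set.Ioi 0))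
    simpa using this

/-- The limits of the regularized kernels against a continuous function with compact support. -/
theorem tendsto_integral_radial {ψ : E3 → ℂ} (hψ : Continuous ψ) (hψ' : HasCompactSupport ψ)
    {a : ℝ} (ha : a < 3) {F : ℝ → E3 → ℂ} {F₀ : E3 → ℂ} {D : ℝ → ℝ}
    (hD : Continuous D)
    (hF : ∀ ε, 0 < ε → Continuous (F ε)) (hb : ∀ ε, 0 < ε → ∀ x, x ≠ 0 →
      ‖F ε x‖ ≤ D (regNorm ε x) * ‖x‖ ^ (-a))
    (hl : ∀ x, x ≠ 0 → Tendsto (fun ε => F ε x) (nhdsWithin 0 (Set.Ioi 0)) (nhds (F₀ x))) :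
    Tendsto (fun ε => ∫ x, F ε x * ψ x) (nhdsWithin 0 (Set.Ioi 0)) (nhds (∫ x, F₀ x * ψ x)) := by
  obtain ⟨M, hM⟩ := hψ'.isCompact.isBounded.exists_norm_le
  obtain ⟨K, hK⟩ := (isCompact_Icc (a := (0 : ℝ)) (b := M + 1)).exists_bound_of_continuousOn
    hD.continuousOn
  have hae : ∀ᵐ x : E3, x ≠ 0 := by
    simp [ae_iff, measure_singleton]
  refine tendsto_integral_filter_of_dominated_convergence
    (fun x => K * (‖x‖ ^ (-a) * ‖ψ x‖)) ?_ ?_ ((integrable_norm_rpow_mul ha hψ hψ').const_mul _) ?_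
  · exact eventually_nhdsWithin_of_forall fun ε hε => ((hF ε hε).mul hψ).aestronglyMeasurable
  · filter_upwards [Ioc_mem_nhdsGT (zero_lt_one' ℝ)] with ε hε
    filter_upwards [hae] with x hx
    by_cases hz : ψ x = 0
    · simp [hz]
    have h1 : ‖x‖ ≤ M := hM _ (subset_tsupport _ hz)
    rw [norm_mul, ← mul_assoc]
    refine mul_le_mul_of_nonneg_right ((hb ε hε.1 x hx).trans ?_) (norm_nonneg _)
    refine mul_le_mul_of_nonneg_right ((le_abs_self _).trans (hK _ ⟨(regNorm_pos hε.1 x).le,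
      (regNorm_le hε.1.le x).trans (add_le_add h1 hε.2)⟩)) (by positivity)
  · filter_upwards [hae] with x hx
    exact (hl x hx).mul_const _

theorem continuousAt_helmA (lam : ℂ) {r : ℝ} (hr : 0 < r) : ContinuousAt (helmA lam) r :=
  (hasDerivAt_helmA lam hr).continuousAt

theorem norm_helmA_regNorm_le (lam : ℂ) {ε : ℝ} {x : E3} (hx : x ≠ 0) :
    ‖helmA lam (regNorm ε x)‖ ≤ Real.exp (‖lam‖ * regNorm ε x) * ‖x‖ ^ (-1 : ℝ) := by
  have h0 : 0 < ‖x‖ := norm_pos_iff.2 hx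
  have h1 := norm_le_regNorm ε x
  refine (norm_helmA_le lam (h0.trans_le h1)).trans ?_
  rw [Real.rpow_neg_one, ← div_eq_mul_inv]
  gcongr

theorem norm_coord_mul_helmB_le (lam : ℂ) {ε : ℝ} {x : E3} (hx : x ≠ 0) (k : Fin 3) :
    ‖(x k : ℂ) * helmB lam (regNorm ε x)‖
      ≤ Real.exp (‖lam‖ * regNorm ε x) * (‖lam‖ * regNorm ε x + 1) * ‖x‖ ^ (-2 : ℝ) := by
  have h0 : 0 < ‖x‖ := norm_pos_iff.2 hx
  have h1 := norm_le_regNorm ε x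
  have h2 := norm_helmB_le lam (h0.trans_le h1)
  have h3 : 0 < regNorm ε x := h0.trans_le h1
  have h4 := abs_coord_le x k
  rw [norm_mul, Complex.norm_real, Real.norm_eq_abs]
  calc |x k| * ‖helmB lam (regNorm ε x)‖
      ≤ ‖x‖ * (Real.exp (‖lam‖ * regNorm ε x) * (‖lam‖ * regNorm ε x + 1) / ‖x‖ ^ 3) := by
        gcongr
        exact h2.trans (by gcongr)
    _ = _ := by
        rw [Real.rpow_neg h0.le, Real.rpow_two]
        field_simp

theorem regNorm_zero (x : E3) : regNorm 0 x = ‖x‖ := by simp [regNorm]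

/-- The gradient of the fundamental solution away from the origin. -/
noncomputable def gradFund (lam : ℂ) (k : Fin 3) (x : E3) : ℂ := x k * helmB lam ‖x‖

theorem tendsto_integral_helmA (lam : ℂ) {ψ : E3 → ℂ} (hψ : Continuous ψ)
    (hψ' : HasCompactSupport ψ) :
    Tendsto (fun ε => ∫ x, helmA lam (regNorm ε x) * ψ x) (nhdsWithin 0 (Set.Ioi 0))
      (nhds (∫ x, helmholtzFund lam x * ψ x)) :=
  tendsto_integral_radial hψ hψ' (by norm_num)
    (D := fun r => Real.exp (‖lam‖ * r)) (by fun_prop)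
    (fun _ hε => continuous_helmA_regNorm lam hε) (fun _ _ _ hx => norm_helmA_regNorm_le lam hx)
    (fun x hx => (continuousAt_helmA lam (norm_pos_iff.2 hx)).tendsto.comp (tendsto_regNorm x))

theorem tendsto_integral_helmB (lam : ℂ) {ψ : E3 → ℂ} (hψ : Continuous ψ)
    (hψ' : HasCompactSupport ψ) (k : Fin 3) :
    Tendsto (fun ε => ∫ x, (x k * helmB lam (regNorm ε x)) * ψ x) (nhdsWithin 0 (Set.Ioi 0))
      (nhds (∫ x, gradFund lam k x * ψ x)) :=
  tendsto_integral_radial hψ hψ' (a := 2) (by norm_num)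
    (F := fun ε x => x k * helmB lam (regNorm ε x))
    (D := fun r => Real.exp (‖lam‖ * r) * (‖lam‖ * r + 1)) (by fun_prop)
    (fun _ hε => (continuous_coord k).mul (continuous_helmB_regNorm lam hε))
    (fun ε _ x hx => norm_coord_mul_helmB_le lam (ε := ε) (x := x) hx k)
    (F₀ := gradFund lam k)
    (fun x hx => by
      have h : Tendsto (fun ε => helmB lam (regNorm ε x)) (nhdsWithin 0 (Set.Ioi 0))
          (nhds (helmB lam ‖x‖)) :=
        (hasDerivAt_helmB lam (norm_pos_iff.2 hx)).continuousAt.tendsto.comp (tendsto_regNorm x)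
      exact h.const_mul _)

theorem IsTest.helmholtz (hφ : IsTest φ) (lam : ℂ) :
    IsTest fun x => _root_.lap3 φ x + lam ^ 2 * φ x := by
  have h2 : HasCompactSupport fun x => lam ^ 2 * φ x := hφ.hasCompactSupport.mul_left
  exact ⟨hφ.lap3.contDiff.add (contDiff_const.mul hφ.contDiff),
    hφ.lap3.hasCompactSupport.add h2⟩

/-- The fundamental solution of the Helmholtz operator, tested with a smooth function. -/
theorem integral_helmholtzFund_mul (lam : ℂ) (hφ : IsTest φ) :
    ∫ x, helmholtzFund lam x * (lap3 φ x + lam ^ 2 * φ x) = φ 0 := by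
  have h := hφ.helmholtz lam
  have h1 := tendsto_integral_helmA lam h.continuous h.hasCompactSupport
  refine tendsto_nhds_unique h1 ((tendsto_integral_helmC lam hφ).congr' ?_)
  exact eventually_nhdsWithin_of_forall fun ε hε => (integral_regularized_helmholtz lam hε hφ).symm

/-- The regularized gradients are dominated by a locally integrable multiple of |x|^(−2), so the
weak gradient of θ is its pointwise gradient and no mass concentrates at the origin. -/
theorem integral_helmholtzFund_mul_pderiv3 (lam : ℂ) (hφ : IsTest φ) (k : Fin 3) :
    ∫ x, helmholtzFund lam x * pderiv3 k φ x = -∫ x, gradFund lam k x * φ x := by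
  have h1 := tendsto_integral_helmA lam (hφ.pderiv3 k).continuous (hφ.pderiv3 k).hasCompactSupport
  have h2 := (tendsto_integral_helmB lam hφ.continuous hφ.hasCompactSupport k).neg
  refine tendsto_nhds_unique h1 (h2.congr' ?_)
  exact eventually_nhdsWithin_of_forall fun ε hε => (integral_helmA_mul_pderiv3 lam hε hφ k).symm

end Delta

/-! ### Product rules -/

section Products

variable {f g : E3 → ℂ}

theorem IsTest.mul (hf : ContDiff ℝ ((⊤ : ℕ∞) : WithTop ℕ∞) f) (hg : IsTest g) :
    IsTest fun x => f x * g x :=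
  ⟨hf.mul hg.contDiff, hg.hasCompactSupport.mul_left⟩

theorem pderiv3_mul {x : E3} (hf : DifferentiableAt ℝ f x) (hg : DifferentiableAt ℝ g x)
    (k : Fin 3) :
    pderiv3 k (fun x => f x * g x) x = pderiv3 k f x * g x + f x * pderiv3 k g x := by
  unfold pderiv3
  rw [fderiv_fun_mul hf hg]
  simp
  ring

theorem pderiv3_add {F : Type*} [NormedAddCommGroup F] [NormedSpace ℝ F] {f g : E3 → F} {x : E3}
    (hf : DifferentiableAt ℝ f x) (hg : DifferentiableAt ℝ g x) (k : Fin 3) :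
    pderiv3 k (fun x => f x + g x) x = pderiv3 k f x + pderiv3 k g x := by
  unfold pderiv3
  rw [fderiv_fun_add hf hg]
  simp

theorem lap3_mul (hf : IsTest f) (hg : IsTest g) (x : E3) :
    lap3 (fun x => f x * g x) x
      = lap3 f x * g x + 2 * (∑ k, pderiv3 k f x * pderiv3 k g x) + f x * lap3 g x := by
  have h : ∀ k, pderiv3 k (pderiv3 k (fun x => f x * g x)) x
      = pderiv3 k (pderiv3 k f) x * g x + 2 * (pderiv3 k f x * pderiv3 k g x)
        + f x * pderiv3 k (pderiv3 k g) x := fun k => by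
    have e : pderiv3 k (fun x => f x * g x)
        = fun x => pderiv3 k f x * g x + f x * pderiv3 k g x :=
      funext fun y => pderiv3_mul (hf.differentiable y) (hg.differentiable y) k
    have d1 := (hf.pderiv3 k).differentiable x
    have d2 := (hg.pderiv3 k).differentiable x
    rw [e, pderiv3_add (d1.fun_mul (hg.differentiable x)) ((hf.differentiable x).fun_mul d2),
      pderiv3_mul d1 (hg.differentiable x), pderiv3_mul (hf.differentiable x) d2]
    ring
  simp only [lap3, h, Fin.sum_univ_three]
  ring

/-- A function which is smooth away from the origin, multiplied by a test function which vanishes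
near the origin, is a test function. -/
theorem isTest_mul_of_eq_zero {R : ℝ} (hR : 0 < R)
    (hf : ∀ x, x ≠ 0 → ContDiffAt ℝ ((⊤ : ℕ∞) : WithTop ℕ∞) f x) (hg : IsTest g)
    (h0 : ∀ x, ‖x‖ < R → g x = 0) : IsTest fun x => f x * g x := by
  refine ⟨contDiff_iff_contDiffAt.2 fun x => ?_, hg.hasCompactSupport.mul_left⟩
  by_cases hx : x = 0
  · refine (contDiffAt_const (c := (0 : ℂ))).congr_of_eventuallyEq ?_
    filter_upwards [Metric.ball_mem_nhds x hR] with y hy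
    rw [hx, mem_ball_zero_iff] at hy
    rw [h0 y hy, mul_zero]
  · exact (hf x hx).mul hg.contDiff.contDiffAt

end Products

/-! ### The fundamental solution away from the origin, and its local integrability -/

section Fund

variable (lam : ℂ)

theorem contDiffAt_helmholtzFund {x : E3} (hx : x ≠ 0) {n : WithTop ℕ∞} :
    ContDiffAt ℝ n (helmholtzFund lam) x :=
  (contDiffAt_helmA lam (norm_pos_iff.2 hx)).comp x (contDiffAt_norm ℝ hx)

theorem pderiv3_helmholtzFund {x : E3} (hx : x ≠ 0) (k : Fin 3) :
    pderiv3 k (helmholtzFund lam) x = gradFund lam k x := by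
  have hr : 0 < ‖x‖ := norm_pos_iff.2 hx
  have h1 := (((contDiffAt_helmholtzFund lam hx (n := 1)).differentiableAt
    (by simp)).hasFDerivAt.hasLineDerivAt (e3 k))
  have h2 := hasLineDerivAt_radial (ε := 0) (A := helmA lam) (B := helmB lam ‖x‖) (x := x)
    (by rw [regNorm_zero]; exact hr) k (by rw [regNorm_zero]; exact hasDerivAt_helmA lam hr)
  simp only [regNorm_zero] at h2
  exact h1.unique h2

theorem contDiffAt_gradFund {x : E3} (hx : x ≠ 0) (k : Fin 3) :
    ContDiffAt ℝ ((⊤ : ℕ∞) : WithTop ℕ∞) (gradFund lam k) x := by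
  have h : ContDiffAt ℝ ((⊤ : ℕ∞) : WithTop ℕ∞) (pderiv3 k (helmholtzFund lam)) x :=
    ((contDiffAt_helmholtzFund lam hx (n := ((⊤ : ℕ∞) : WithTop ℕ∞))).fderiv_right
      (by simp)).clm_apply contDiffAt_const
  refine h.congr_of_eventuallyEq ?_
  filter_upwards [isOpen_ne.mem_nhds hx] with y hy
  exact (pderiv3_helmholtzFund lam hy k).symm

theorem measurable_helmholtzFund : Measurable (helmholtzFund lam) := by
  unfold helmholtzFund; fun_prop

theorem measurable_gradFund (k : Fin 3) : Measurable (gradFund lam k) := by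
  have h : Measurable (helmB lam) := by unfold helmB; fun_prop
  exact (continuous_coord k).measurable.mul (h.comp measurable_norm)

theorem helmholtzFund_neg (x : E3) : helmholtzFund lam (-x) = helmholtzFund lam x := by
  simp [helmholtzFund]

theorem gradFund_neg (k : Fin 3) (x : E3) : gradFund lam k (-x) = -gradFund lam k x := by
  simp [gradFund]

theorem integrable_mul_of_norm_le {a : ℝ} (ha : a < 3) {D : ℝ → ℝ} (hD : Continuous D)
    {F ψ : E3 → ℂ} (hF : Measurable F) (hb : ∀ x, x ≠ 0 → ‖F x‖ ≤ D ‖x‖ * ‖x‖ ^ (-a))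
    (hψ : Continuous ψ) (hψ' : HasCompactSupport ψ) : Integrable fun x => F x * ψ x := by
  have h1 : HasCompactSupport fun x : E3 => (D ‖x‖ : ℂ) * ψ x := hψ'.mul_left
  have h := integrable_norm_rpow_mul ha (ψ := fun x => D ‖x‖ * ψ x) (by fun_prop) h1
  refine h.mono' (hF.aestronglyMeasurable.mul hψ.aestronglyMeasurable) ?_
  have hae : ∀ᵐ x : E3, x ≠ 0 := by simp [ae_iff, measure_singleton]
  filter_upwards [hae] with x hx
  rw [norm_mul, norm_mul, ← mul_assoc, Complex.norm_real]
  gcongr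
  refine (hb x hx).trans ?_
  rw [mul_comm]
  gcongr
  exact Real.le_norm_self _

theorem integrable_helmholtzFund_mul {ψ : E3 → ℂ} (hψ : Continuous ψ)
    (hψ' : HasCompactSupport ψ) : Integrable fun x => helmholtzFund lam x * ψ x :=
  integrable_mul_of_norm_le (a := 1) (by norm_num) (D := fun r => Real.exp (‖lam‖ * r))
    (by fun_prop) (measurable_helmholtzFund lam) (fun x hx => by
      have := norm_helmA_regNorm_le lam (ε := 0) hx
      rwa [regNorm_zero] at this) hψ hψ'

theorem integrable_gradFund_mul (k : Fin 3) {ψ : E3 → ℂ} (hψ : Continuous ψ)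
    (hψ' : HasCompactSupport ψ) : Integrable fun x => gradFund lam k x * ψ x :=
  integrable_mul_of_norm_le (a := 2) (by norm_num)
    (D := fun r => Real.exp (‖lam‖ * r) * (‖lam‖ * r + 1))
    (by fun_prop) (measurable_gradFund lam k) (fun x hx => by
      have := norm_coord_mul_helmB_le lam (ε := 0) hx k
      rwa [regNorm_zero] at this) hψ hψ'

end Fund

/-! ### Parametrix -/

/-- A compactly supported parametrix `E` of the Helmholtz operator, with gradient `E1`, which
agrees with the fundamental solution on a ball of radius `R`. -/
structure IsParametrix (lam : ℂ) (R : ℝ) (E : E3 → ℂ) (E1 : Fin 3 → E3 → ℂ) (η : E3 → ℂ) :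
    Prop where
  measurable : Measurable E
  measurable1 : ∀ k, Measurable (E1 k)
  integrable : Integrable E
  integrable1 : ∀ k, Integrable (E1 k)
  eq_fund : ∀ z, ‖z‖ < R → E z = helmholtzFund lam z
  eq_pderiv3 : ∀ k z, z ≠ 0 → ‖z‖ < R → E1 k z = pderiv3 k (helmholtzFund lam) z
  eq_zero : ∀ z, 2 * R < ‖z‖ → E z = 0
  test : IsTest η
  remainder_near : ∀ z, ‖z‖ < R → η z = 0
  remainder_far : ∀ z, 2 * R < ‖z‖ → η z = 0
  even : ∀ z, E (-z) = E z
  odd1 : ∀ k z, E1 k (-z) = -E1 k z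
  even_remainder : ∀ z, η (-z) = η z
  fund : ∀ φ : E3 → ℂ, IsTest φ →
    ∫ z, E z * (lap3 φ z + lam ^ 2 * φ z) = φ 0 + ∫ z, η z * φ z
  ibp : ∀ φ : E3 → ℂ, IsTest φ → ∀ k, ∫ z, E z * pderiv3 k φ z = -∫ z, E1 k z * φ z

theorem exists_cutoff {R : ℝ} (hR : 0 < R) : ∃ χ : E3 → ℂ, IsTest χ ∧
    (∀ z, ‖z‖ < R → χ z = 1) ∧ (∀ z, 2 * R < ‖z‖ → χ z = 0) ∧ ∀ z, χ (-z) = χ z := by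
  let b : ContDiffBump (0 : E3) := ⟨R, 2 * R, hR, by linarith⟩
  refine ⟨fun z => (b z : ℂ), ⟨Complex.ofRealCLM.contDiff.comp b.contDiff, ?_⟩, ?_, ?_, ?_⟩
  · exact b.hasCompactSupport.comp_left (g := fun r : ℝ => (r : ℂ)) Complex.ofReal_zero
  · intro z hz
    have := b.one_of_mem_closedBall (x := z) (by simpa using hz.le)
    simp [this]
  · intro z hz
    have := b.zero_of_le_dist (x := z) (by simpa using hz.le)
    simp [this]
  · intro z
    simp [b.neg]

theorem pderiv3_comp_neg (χ : E3 → ℂ) (k : Fin 3) (z : E3) :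
    pderiv3 k (fun z => χ (-z)) z = -pderiv3 k χ (-z) := by
  unfold pderiv3
  have := (ContinuousLinearEquiv.neg ℝ (M := E3)).comp_right_fderiv (f := χ) (x := z)
  have e : (χ ∘ (ContinuousLinearEquiv.neg ℝ (M := E3))) = fun z => χ (-z) := rfl
  rw [e] at this
  rw [this]
  simp

theorem pderiv3_neg_of_even {χ : E3 → ℂ} (hχ : ∀ z, χ (-z) = χ z) (k : Fin 3) (z : E3) :
    pderiv3 k χ (-z) = -pderiv3 k χ z := by
  have h := pderiv3_comp_neg χ k z
  rw [funext hχ] at h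
  rw [h, neg_neg]

theorem pderiv3_neg_of_odd {χ : E3 → ℂ} (hχ : ∀ z, χ (-z) = -χ z) (k : Fin 3) (z : E3) :
    pderiv3 k χ (-z) = pderiv3 k χ z := by
  have h := pderiv3_comp_neg χ k z
  rw [funext hχ] at h
  have h2 : pderiv3 k (fun z => -χ z) z = -pderiv3 k χ z := by
    unfold pderiv3
    rw [fderiv_fun_neg]
    simp
  rw [h2, neg_inj] at h
  exact h.symm

theorem pderiv3_eq_zero_of_eq_const {χ : E3 → ℂ} {U : Set E3} (hU : IsOpen U) {c : ℂ}
    (h : ∀ z ∈ U, χ z = c) (k : Fin 3) {z : E3} (hz : z ∈ U) : pderiv3 k χ z = 0 := by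
  have : χ =ᶠ[nhds z] fun _ => c := by
    filter_upwards [hU.mem_nhds hz] with y hy using h y hy
  unfold pderiv3
  rw [this.fderiv_eq]
  simp

/-- Take E = χθ with χ an even cutoff equal to 1 near 0. The remainder η = 2∇θ·∇χ + θΔχ involves
derivatives of χ, so it vanishes near the singularity and is a test function. -/
theorem exists_isParametrix (lam : ℂ) {R : ℝ} (hR : 0 < R) :
    ∃ E E1 η, IsParametrix lam R E E1 η := by
  obtain ⟨χ, hχ, h1, h0, hev⟩ := exists_cutoff hR
  have onear : IsOpen {z : E3 | ‖z‖ < R} := isOpen_lt continuous_norm continuous_const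
  have ofar : IsOpen {z : E3 | 2 * R < ‖z‖} := isOpen_lt continuous_const continuous_norm
  have d_near : ∀ k z, ‖z‖ < R → pderiv3 k χ z = 0 := fun k z hz =>
    pderiv3_eq_zero_of_eq_const onear h1 k hz
  have d_far : ∀ k z, 2 * R < ‖z‖ → pderiv3 k χ z = 0 := fun k z hz =>
    pderiv3_eq_zero_of_eq_const ofar h0 k hz
  have l_near : ∀ z, ‖z‖ < R → lap3 χ z = 0 := fun z hz => Finset.sum_eq_zero fun k _ =>
    pderiv3_eq_zero_of_eq_const onear (d_near k) k hz
  have l_far : ∀ z, 2 * R < ‖z‖ → lap3 χ z = 0 := fun z hz => Finset.sum_eq_zero fun k _ =>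
    pderiv3_eq_zero_of_eq_const ofar (d_far k) k hz
  have hd := fun k => hχ.pderiv3 k
  have hl := hχ.lap3
  have d_odd := pderiv3_neg_of_even hev
  have l_even : ∀ z, lap3 χ (-z) = lap3 χ z := fun z => by
    unfold lap3
    simp_rw [pderiv3_neg_of_odd (d_odd _)]
  have mθ := measurable_helmholtzFund lam
  have mG := measurable_gradFund lam
  have t1 : ∀ k, IsTest fun x => gradFund lam k x * pderiv3 k χ x := fun k =>
    isTest_mul_of_eq_zero hR (fun x hx => contDiffAt_gradFund lam hx k) (hd k) (d_near k)
  have t2 : IsTest fun x => helmholtzFund lam x * lap3 χ x :=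
    isTest_mul_of_eq_zero hR (fun x hx => contDiffAt_helmholtzFund lam hx) hl l_near
  have ibp : ∀ φ : E3 → ℂ, IsTest φ → ∀ k, ∫ z, helmholtzFund lam z * χ z * pderiv3 k φ z
      = -∫ z, (gradFund lam k z * χ z + helmholtzFund lam z * pderiv3 k χ z) * φ z := by
    intro φ hφ k
    have hφχ : IsTest fun x => χ x * φ x := IsTest.mul hχ.contDiff hφ
    have e1 : ∀ z, helmholtzFund lam z * χ z * pderiv3 k φ z
        = helmholtzFund lam z * pderiv3 k (fun x => χ x * φ x) z
          - helmholtzFund lam z * (pderiv3 k χ z * φ z) := fun z => by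
      rw [pderiv3_mul (hχ.differentiable z) (hφ.differentiable z)]; ring
    have hq : IsTest fun x => pderiv3 k χ x * φ x := IsTest.mul (hd k).contDiff hφ
    have e2 : ∀ z, (gradFund lam k z * χ z + helmholtzFund lam z * pderiv3 k χ z) * φ z
        = gradFund lam k z * (χ z * φ z) + helmholtzFund lam z * (pderiv3 k χ z * φ z) :=
      fun z => by ring
    simp only [e1, e2]
    rw [integral_sub (integrable_helmholtzFund_mul lam (hφχ.pderiv3 k).continuous
        (hφχ.pderiv3 k).hasCompactSupport)
        (integrable_helmholtzFund_mul lam hq.continuous hq.hasCompactSupport),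
      integral_add (integrable_gradFund_mul lam k hφχ.continuous hφχ.hasCompactSupport)
        (integrable_helmholtzFund_mul lam hq.continuous hq.hasCompactSupport),
      integral_helmholtzFund_mul_pderiv3 lam hφχ k]
    ring
  refine ⟨fun z => helmholtzFund lam z * χ z,
    fun k z => gradFund lam k z * χ z + helmholtzFund lam z * pderiv3 k χ z,
    fun z => 2 * (∑ k, gradFund lam k z * pderiv3 k χ z) + helmholtzFund lam z * lap3 χ z,
    ⟨mθ.mul hχ.continuous.measurable, fun k => ((mG k).mul hχ.continuous.measurable).add
      (mθ.mul (hd k).continuous.measurable),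
    integrable_helmholtzFund_mul lam hχ.continuous hχ.hasCompactSupport,
    fun k => (integrable_gradFund_mul lam k hχ.continuous hχ.hasCompactSupport).add
      (integrable_helmholtzFund_mul lam (hd k).continuous (hd k).hasCompactSupport),
    ?_, ?_, ?_, ?_, ?_, ?_, ?_, ?_, ?_, ?_, ibp⟩⟩
  · intro z hz; simp only [h1 z hz, mul_one]
  · intro k z hz hzR
    simp only [h1 z hzR, d_near k z hzR, mul_one, mul_zero, add_zero]
    exact (pderiv3_helmholtzFund lam hz k).symm
  · intro z hz; simp only [h0 z hz, mul_zero]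
  · have hs : HasCompactSupport fun z => ∑ k, gradFund lam k z * pderiv3 k χ z := by
      simp only [Fin.sum_univ_three]
      exact ((t1 0).hasCompactSupport.add (t1 1).hasCompactSupport).add (t1 2).hasCompactSupport
    have hs2 : HasCompactSupport fun z => 2 * ∑ k, gradFund lam k z * pderiv3 k χ z := hs.mul_left
    exact ⟨(contDiff_const.mul (ContDiff.sum fun k _ => (t1 k).contDiff)).add t2.contDiff,
      hs2.add t2.hasCompactSupport⟩
  · intro z hz; simp [d_near _ z hz, l_near z hz]
  · intro z hz; simp [d_far _ z hz, l_far z hz]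
  · intro z; simp only [helmholtzFund_neg, hev]
  · intro k z; simp only [helmholtzFund_neg, gradFund_neg, hev, d_odd]; ring
  · intro z; simp only [helmholtzFund_neg, gradFund_neg, l_even, d_odd, neg_mul_neg]
  · intro φ hφ
    have hφχ : IsTest fun x => χ x * φ x := IsTest.mul hχ.contDiff hφ
    have hl2 : IsTest fun x => lap3 χ x * φ x := IsTest.mul hl.contDiff hφ
    have hk : ∀ k, IsTest fun x => pderiv3 k χ x * φ x := fun k => IsTest.mul (hd k).contDiff hφ
    -- Since χΔφ = Δ(χφ) + φΔχ − 2 div(φ∇χ), only the last term is differentiated besides Δ(χφ), and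
    -- integrating it by parts against θ produces the gradient part of η.
    have e1 : ∀ z, helmholtzFund lam z * χ z * (lap3 φ z + lam ^ 2 * φ z)
        = helmholtzFund lam z * (lap3 (fun x => χ x * φ x) z + lam ^ 2 * (χ z * φ z))
          + helmholtzFund lam z * (lap3 χ z * φ z)
          - 2 * ∑ k, helmholtzFund lam z * pderiv3 k (fun x => pderiv3 k χ x * φ x) z := fun z => by
      rw [lap3_mul hχ hφ]
      have : ∀ k, pderiv3 k (fun x => pderiv3 k χ x * φ x) z
          = pderiv3 k (pderiv3 k χ) z * φ z + pderiv3 k χ z * pderiv3 k φ z := fun k =>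
        pderiv3_mul ((hd k).differentiable z) (hφ.differentiable z) k
      simp only [this]
      simp only [lap3, Fin.sum_univ_three]
      ring
    have i1 : ∀ {ψ : E3 → ℂ}, IsTest ψ → Integrable fun x => helmholtzFund lam x * ψ x :=
      fun h => integrable_helmholtzFund_mul lam h.continuous h.hasCompactSupport
    have i2 : ∀ k {ψ : E3 → ℂ}, IsTest ψ → Integrable fun x => gradFund lam k x * ψ x :=
      fun k _ h => integrable_gradFund_mul lam k h.continuous h.hasCompactSupport
    have e2 : ∀ z, (2 * (∑ k, gradFund lam k z * pderiv3 k χ z) + helmholtzFund lam z * lap3 χ z)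
        * φ z = 2 * (∑ k, gradFund lam k z * (pderiv3 k χ z * φ z))
          + helmholtzFund lam z * (lap3 χ z * φ z) := fun z => by
      simp only [Fin.sum_univ_three]; ring
    simp only [e1, e2]
    have i3 : Integrable fun z => helmholtzFund lam z
        * (lap3 (fun x => χ x * φ x) z + lam ^ 2 * (χ z * φ z))
          + helmholtzFund lam z * (lap3 χ z * φ z) := (i1 (hφχ.helmholtz lam)).add (i1 hl2)
    rw [integral_sub i3 ((integrable_finsetSum _ fun k _ => i1 ((hk k).pderiv3 k)).const_mul 2),
      integral_add (i1 (hφχ.helmholtz lam)) (i1 hl2), integral_helmholtzFund_mul lam hφχ,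
      integral_const_mul, integral_finsetSum _ fun k _ => i1 ((hk k).pderiv3 k),
      integral_add ((integrable_finsetSum _ fun k _ => i2 k (hk k)).const_mul 2) (i1 hl2),
      integral_const_mul, integral_finsetSum _ fun k _ => i2 k (hk k),
      Finset.sum_congr rfl fun k _ => integral_helmholtzFund_mul_pderiv3 lam (hk k) k,
      h1 0 (by simpa using hR), Finset.sum_neg_distrib]
    ring

/-! ### Convolutions -/

/-- The convolution of complex-valued functions on `ℝ³`. -/
noncomputable def cconv (κ f : E3 → ℂ) (x : E3) : ℂ := ∫ y, κ (x - y) * f y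

section Cconv

variable {κ f φ ψ : E3 → ℂ}

theorem cconv_eq (κ f : E3 → ℂ) (x : E3) : cconv κ f x = ∫ t, κ t * f (x - t) := by
  have := integral_sub_left_eq_self (fun t => κ t * f (x - t)) volume x
  simp only [sub_sub_cancel] at this
  exact this

theorem cconv_eq_convolution (κ f : E3 → ℂ) :
    cconv κ f = convolution κ f (ContinuousLinearMap.mul ℝ ℂ) volume :=
  funext fun x => cconv_eq κ f x

theorem contDiff_cconv (hκ : LocallyIntegrable κ) (hφ : IsTest φ) :
    ContDiff ℝ ((⊤ : ℕ∞) : WithTop ℕ∞) (cconv κ φ) := by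
  rw [cconv_eq_convolution]
  exact hφ.hasCompactSupport.contDiff_convolution_right _ hκ hφ.contDiff

theorem contDiff_cconv_left (hφ : IsTest φ) (hf : LocallyIntegrable f) :
    ContDiff ℝ ((⊤ : ℕ∞) : WithTop ℕ∞) (cconv φ f) := by
  rw [cconv_eq_convolution]
  exact hφ.hasCompactSupport.contDiff_convolution_left _ hφ.contDiff hf

theorem isTest_cconv (hκ : LocallyIntegrable κ) (hκ' : HasCompactSupport κ) (hφ : IsTest φ) :
    IsTest (cconv κ φ) := by
  refine ⟨contDiff_cconv hκ hφ, ?_⟩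
  rw [cconv_eq_convolution]
  exact HasCompactSupport.convolution _ hκ' hφ.hasCompactSupport

theorem integrable_mul_comp_sub (hκ : LocallyIntegrable κ) (hφ : Continuous φ)
    (hφ' : HasCompactSupport φ) (x : E3) : Integrable fun t => κ t * φ (x - t) :=
  (hφ'.convolutionExists_right (ContinuousLinearMap.mul ℝ ℂ) hκ hφ x).integrable

theorem pderiv3_cconv (hκ : LocallyIntegrable κ) (hφ : IsTest φ) (k : Fin 3) :
    pderiv3 k (cconv κ φ) = cconv κ (pderiv3 k φ) := by
  funext x
  have h := hφ.hasCompactSupport.hasFDerivAt_convolution_right (ContinuousLinearMap.mul ℝ ℂ) hκ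
    (hφ.of_le 1) x
  rw [← cconv_eq_convolution] at h
  unfold pderiv3
  rw [h.fderiv, cconv_eq, convolution_precompR_apply _ hκ (hφ.hasCompactSupport.fderiv ℝ)
    (hφ.contDiff.continuous_fderiv (by simp))]
  rfl

theorem lap3_cconv (hκ : LocallyIntegrable κ) (hφ : IsTest φ) (x : E3) :
    lap3 (cconv κ φ) x = cconv κ (lap3 φ) x := by
  have h : ∀ k, pderiv3 k (pderiv3 k (cconv κ φ)) x = cconv κ (pderiv3 k (pderiv3 k φ)) x :=
    fun k => by rw [pderiv3_cconv hκ hφ, pderiv3_cconv hκ (hφ.pderiv3 k)]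
  unfold lap3
  rw [Finset.sum_congr rfl fun k _ => h k]
  simp only [cconv_eq]
  rw [← integral_finsetSum]
  · simp only [Finset.mul_sum]
  · intro k _
    have := (hφ.pderiv3 k).pderiv3 k
    exact integrable_mul_comp_sub hκ this.continuous this.hasCompactSupport x

theorem pderiv3_comp_const_sub (φ : E3 → ℂ) (x : E3) (k : Fin 3) (t : E3) :
    pderiv3 k (fun t => φ (x - t)) t = -pderiv3 k φ (x - t) := by
  have h := pderiv3_comp_neg (fun t => φ (x + t)) k t
  simp only [← sub_eq_add_neg] at h
  rw [h]
  unfold pderiv3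
  rw [fderiv_comp_add_left]
  rw [sub_eq_add_neg]

theorem IsTest.comp_const_sub (hφ : IsTest φ) (x : E3) : IsTest fun t => φ (x - t) :=
  ⟨hφ.contDiff.comp (contDiff_const.sub contDiff_id),
    hφ.hasCompactSupport.comp_homeomorph (Homeomorph.subLeft x)⟩

theorem lap3_comp_const_sub (φ : E3 → ℂ) (x t : E3) :
    lap3 (fun t => φ (x - t)) t = lap3 φ (x - t) := by
  unfold lap3
  refine Finset.sum_congr rfl fun k _ => ?_
  rw [show pderiv3 k (fun t => φ (x - t)) = fun t => -pderiv3 k φ (x - t) from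
    funext fun t => pderiv3_comp_const_sub φ x k t]
  have h := pderiv3_comp_const_sub (pderiv3 k φ) x k t
  unfold pderiv3 at h ⊢
  rw [fderiv_fun_neg, _root_.neg_apply, h, neg_neg]

/-- Fubini: moving a convolution to the other factor. -/
theorem integral_mul_cconv {κ' : E3 → ℂ} {σ : ℂ} (hκ : Integrable κ)
    (hσ : ∀ z, κ (-z) = σ * κ' z) (hφ : Continuous φ) (hφ' : HasCompactSupport φ)
    (hf : Integrable f) : ∫ x, φ x * cconv κ f x = σ * ∫ y, f y * cconv κ' φ y := by
  obtain ⟨C, hC⟩ := hφ'.exists_bound_of_continuous hφ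
  have h1 := hf.convolution_integrand (ContinuousLinearMap.mul ℝ ℂ) hκ
  have h2 : Integrable (fun p : E3 × E3 => φ p.1 * (f p.2 * κ (p.1 - p.2)))
      (volume.prod volume) :=
    Integrable.bdd_mul (c := C) (f := fun p : E3 × E3 => φ p.1) h1
      (hφ.comp continuous_fst).aestronglyMeasurable (Eventually.of_forall fun p => hC p.1)
  have h3 := integral_integral_swap (f := fun x y => φ x * (f y * κ (x - y))) h2
  have e1 : ∀ x, ∫ y, φ x * (f y * κ (x - y)) = φ x * cconv κ f x := fun x => by
    rw [integral_const_mul, cconv]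
    simp_rw [mul_comm]
  have e2 : ∀ y, ∫ x, φ x * (f y * κ (x - y)) = σ * (f y * cconv κ' φ y) := fun y => by
    rw [cconv, ← integral_const_mul, ← integral_const_mul]
    refine integral_congr_ae (Eventually.of_forall fun x => ?_)
    have := hσ (y - x)
    rw [neg_sub] at this
    simp only [this]
    ring
  simp only [e1, e2] at h3
  rw [h3, integral_const_mul]

end Cconv

namespace IsParametrix

variable {lam : ℂ} {R : ℝ} {E : E3 → ℂ} {E1 : Fin 3 → E3 → ℂ} {η : E3 → ℂ} {φ ψ : E3 → ℂ}

theorem hasCompactSupport (h : IsParametrix lam R E E1 η) : HasCompactSupport E :=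
  HasCompactSupport.intro (isCompact_closedBall 0 (2 * R)) fun z hz =>
    h.eq_zero z (by simpa using hz)

theorem isTest_cconv (h : IsParametrix lam R E E1 η) (hφ : IsTest φ) : IsTest (cconv E φ) :=
  _root_.isTest_cconv h.integrable.locallyIntegrable h.hasCompactSupport hφ

/-- The parametrix inverts the Helmholtz operator up to a smoothing remainder. -/
theorem helmholtz_cconv (h : IsParametrix lam R E E1 η) (hφ : IsTest φ) (x : E3) :
    cconv E (fun x => lap3 φ x + lam ^ 2 * φ x) x = φ x + cconv η φ x := by
  have := h.fund _ (hφ.comp_const_sub x)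
  simp only [lap3_comp_const_sub, sub_zero] at this
  rw [cconv_eq, this, cconv_eq]

/-- The Laplacian of the potential is an operator of order zero applied to φ, which is the form the
Calderón–Zygmund inequality takes as input. -/
theorem lap3_cconv (h : IsParametrix lam R E E1 η) (hφ : IsTest φ) (x : E3) :
    lap3 (cconv E φ) x = φ x + cconv η φ x - lam ^ 2 * cconv E φ x := by
  have hE := h.integrable.locallyIntegrable
  rw [_root_.lap3_cconv hE hφ, ← h.helmholtz_cconv hφ, eq_sub_iff_add_eq]
  simp only [cconv_eq]
  rw [← integral_const_mul, ← integral_add]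
  · congr 1; funext t; ring
  · exact integrable_mul_comp_sub hE hφ.lap3.continuous hφ.lap3.hasCompactSupport x
  · exact (integrable_mul_comp_sub hE hφ.continuous hφ.hasCompactSupport x).const_mul _

theorem pderiv3_cconv (h : IsParametrix lam R E E1 η) (hφ : IsTest φ) (k : Fin 3) :
    pderiv3 k (cconv E φ) = cconv (E1 k) φ := by
  rw [_root_.pderiv3_cconv h.integrable.locallyIntegrable hφ]
  funext x
  have := h.ibp _ (hφ.comp_const_sub x) k
  simp only [pderiv3_comp_const_sub, mul_neg, integral_neg, neg_inj] at this
  rw [cconv_eq, this, cconv_eq]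

/-- E is even, so convolution with it is its own transpose; its gradient is odd, whence the sign in
the next statement. -/
theorem integral_mul_cconv (h : IsParametrix lam R E E1 η) (hφ : IsTest φ) {f : E3 → ℂ}
    (hf : Integrable f) : ∫ x, φ x * cconv E f x = ∫ y, f y * cconv E φ y := by
  have := _root_.integral_mul_cconv (κ' := E) (σ := 1) h.integrable (by simp [h.even])
    hφ.continuous hφ.hasCompactSupport hf
  rwa [one_mul] at this

theorem integral_mul_cconv1 (h : IsParametrix lam R E E1 η) (hφ : IsTest φ) {f : E3 → ℂ}
    (hf : Integrable f) (k : Fin 3) :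
    ∫ x, φ x * cconv (E1 k) f x = -∫ y, f y * pderiv3 k (cconv E φ) y := by
  have := _root_.integral_mul_cconv (κ' := E1 k) (σ := -1) (h.integrable1 k) (by simp [h.odd1])
    hφ.continuous hφ.hasCompactSupport hf
  rwa [neg_one_mul, ← h.pderiv3_cconv hφ] at this

theorem integral_mul_cconv_remainder (h : IsParametrix lam R E E1 η) (hφ : IsTest φ)
    {f : E3 → ℂ} (hf : Integrable f) : ∫ x, φ x * cconv η f x = ∫ y, f y * cconv η φ y := by
  have := _root_.integral_mul_cconv (κ' := η) (σ := 1) h.test.integrable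
    (by simp [h.even_remainder]) hφ.continuous hφ.hasCompactSupport hf
  rwa [one_mul] at this

end IsParametrix

/-! ### Estimates in `L^p` -/

section Lp

variable {p : ℝ≥0∞}

theorem lintegral_enorm_rpow_toReal (hp0 : p ≠ 0) (hp' : p ≠ ⊤) {α F : Type*} [MeasurableSpace α]
    {μ : Measure α} [NormedAddCommGroup F] (f : α → F) :
    ∫⁻ x, ‖f x‖ₑ ^ p.toReal ∂μ = eLpNorm f p μ ^ p.toReal := by
  rw [eLpNorm_eq_lintegral_rpow_enorm_toReal hp0 hp', ← ENNReal.rpow_mul,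
    one_div_mul_cancel (ENNReal.toReal_pos hp0 hp').ne', ENNReal.rpow_one]

theorem eLpNorm_le_of_lintegral_rpow_le (hp0 : p ≠ 0) (hp' : p ≠ ⊤) {α F : Type*}
    [MeasurableSpace α] {μ : Measure α} [NormedAddCommGroup F] {f : α → F} {A : ℝ≥0∞}
    (h : ∫⁻ x, ‖f x‖ₑ ^ p.toReal ∂μ ≤ A ^ p.toReal) : eLpNorm f p μ ≤ A := by
  rw [lintegral_enorm_rpow_toReal hp0 hp'] at h
  exact (ENNReal.rpow_le_rpow_iff (ENNReal.toReal_pos hp0 hp')).1 h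

/-- Young's inequality. -/
theorem eLpNorm_cconv_le (hp : 1 < p) (hp' : p < ⊤) {κ f : E3 → ℂ} (hκ : Measurable κ)
    (hf : AEStronglyMeasurable f) :
    eLpNorm (cconv κ f) p volume ≤ eLpNorm κ 1 volume * eLpNorm f p volume := by
  have hp0 : p ≠ 0 := (zero_lt_one.trans hp).ne'
  have h1 : 1 < p.toReal := by
    rw [← ENNReal.toReal_one]; exact (ENNReal.toReal_lt_toReal (by simp) hp'.ne).2 hp
  have hp1 : 0 ≤ p.toReal := by linarith
  set F := hf.mk f with hF
  have hFm : Measurable F := hf.stronglyMeasurable_mk.measurable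
  have hfF : f =ᵐ[volume] F := hf.ae_eq_mk
  -- The convolution depends on f only up to null sets, so a measurable representative may be used.
  have e : cconv κ f = cconv κ F := funext fun x => integral_congr_ae <| by
    filter_upwards [hfF] with y hy
    rw [hy]
  rw [e, eLpNorm_congr_ae hfF]
  refine eLpNorm_le_of_lintegral_rpow_le hp0 hp'.ne ?_
  rw [ENNReal.mul_rpow_of_nonneg _ _ hp1, eLpNorm_one_eq_lintegral_enorm,
    ← lintegral_enorm_rpow_toReal hp0 hp'.ne]
  refine le_trans (lintegral_mono fun x => ?_)
    (lintegral_rpow_conv_le (κ := fun z => ‖κ z‖ₑ) (f := fun z => ‖F z‖ₑ) hκ.enorm hFm.enorm h1)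
  refine ENNReal.rpow_le_rpow ((enorm_integral_le_lintegral_enorm _).trans_eq ?_) hp1
  simp only [enorm_mul]

theorem integrable_cconv {κ f : E3 → ℂ} (hκ : Integrable κ) (hf : Integrable f) :
    Integrable (cconv κ f) := by
  rw [cconv_eq_convolution]
  exact hκ.integrable_convolution _ hf

theorem ae_integrable_cconv {κ f : E3 → ℂ} (hκ : Integrable κ) (hf : Integrable f) :
    ∀ᵐ x, Integrable fun y => κ (x - y) * f y := by
  filter_upwards [hf.ae_convolution_exists (ContinuousLinearMap.mul ℝ ℂ) hκ] with x hx
  have : Integrable fun y => f y * κ (x - y) := hx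
  simpa only [mul_comm] using this

theorem memLp_cconv (hp : 1 < p) (hp' : p < ⊤) {κ f : E3 → ℂ} (hκm : Measurable κ)
    (hκ : Integrable κ) (hf1 : Integrable f) (hf : MemLp f p) : MemLp (cconv κ f) p :=
  ⟨(integrable_cconv hκ hf1).aestronglyMeasurable,
    (eLpNorm_cconv_le hp hp' hκm hf.1).trans_lt
      (ENNReal.mul_lt_top (memLp_one_iff_integrable.2 hκ).2 hf.2)⟩

theorem IsTest.memLp {φ : E3 → ℂ} (hφ : IsTest φ) (p : ℝ≥0∞) : MemLp φ p :=
  hφ.continuous.memLp_of_hasCompactSupport hφ.hasCompactSupport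

end Lp

/-! ### The Calderón–Zygmund bound for complex functions and the Hessian of the potential -/

section CalderonZygmund

variable {p : ℝ≥0∞}

theorem ofReal_integral_abs_rpow {f : E3 → ℝ} (hf : Continuous f) (hf' : HasCompactSupport f)
    {q : ℝ} (hq : 0 < q) : ENNReal.ofReal (∫ x, |f x| ^ q) = ∫⁻ x, ‖f x‖ₑ ^ q := by
  have hc : Continuous fun x => |f x| ^ q := hf.abs.rpow_const fun _ => Or.inr hq.le
  have hs : HasCompactSupport fun x => |f x| ^ q :=
    hf'.comp_left (g := fun r => |r| ^ q) (by simp [hq.ne'])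
  rw [ofReal_integral_eq_lintegral_ofReal (hc.integrable_of_hasCompactSupport hs)
    (Eventually.of_forall fun x => by positivity)]
  refine lintegral_congr fun x => ?_
  rw [← ENNReal.ofReal_rpow_of_nonneg (abs_nonneg _) hq.le, Real.enorm_eq_ofReal_abs]

theorem pderiv3_clm_comp {F G : Type*} [NormedAddCommGroup F] [NormedSpace ℝ F]
    [NormedAddCommGroup G] [NormedSpace ℝ G] (L : F →L[ℝ] G) {φ : E3 → F} (hφ : IsTest φ)
    (k : Fin 3) : pderiv3 k (fun x => L (φ x)) = fun x => L (pderiv3 k φ x) := by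
  funext x
  unfold pderiv3
  have := (L.hasFDerivAt.comp x (hφ.differentiable x).hasFDerivAt).fderiv
  change fderiv ℝ (fun x => L (φ x)) x = _ at this
  rw [this]
  rfl

theorem IsTest.clm_comp {F G : Type*} [NormedAddCommGroup F] [NormedSpace ℝ F]
    [NormedAddCommGroup G] [NormedSpace ℝ G] (L : F →L[ℝ] G) {φ : E3 → F} (hφ : IsTest φ) :
    IsTest fun x => L (φ x) :=
  ⟨L.contDiff.comp hφ.contDiff, hφ.hasCompactSupport.comp_left (map_zero L)⟩

theorem eLpNorm_le_re_add_im (hp : 1 ≤ p) {f : E3 → ℂ} (hf : Continuous f) :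
    eLpNorm f p volume ≤ eLpNorm (fun x => Complex.reCLM (f x)) p volume
      + eLpNorm (fun x => Complex.imCLM (f x)) p volume := by
  have e : f = (fun x => ((f x).re : ℂ)) + fun x => ((f x).im : ℂ) * Complex.I := by
    funext x; exact (Complex.re_add_im _).symm
  have h1 : Continuous fun x => ((f x).re : ℂ) := by fun_prop
  have h2 : Continuous fun x => ((f x).im : ℂ) * Complex.I := by fun_prop
  calc eLpNorm f p volume
      = eLpNorm ((fun x => ((f x).re : ℂ)) + fun x => ((f x).im : ℂ) * Complex.I) p volume := by
        rw [← e]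
    _ ≤ _ := eLpNorm_add_le h1.aestronglyMeasurable h2.aestronglyMeasurable hp
    _ = _ := by
        congr 1
        · exact eLpNorm_congr_norm_ae (Eventually.of_forall fun x => by simp)
        · exact eLpNorm_congr_norm_ae (Eventually.of_forall fun x => by simp)

/-- The Calderón–Zygmund inequality in `L^p`. -/
theorem exists_eLpNorm_pderiv3_pderiv3_le (hp : 1 < p) (hp' : p < ⊤) : ∃ C : ℝ≥0∞, C ≠ ⊤ ∧
    ∀ φ : E3 → ℂ, IsTest φ → ∀ i j,
      eLpNorm (pderiv3 i (pderiv3 j φ)) p volume ≤ C * eLpNorm (lap3 φ) p volume := by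
  have hp0 : p ≠ 0 := (zero_lt_one.trans hp).ne'
  have h1 : 1 < p.toReal := by
    rw [← ENNReal.toReal_one]; exact (ENNReal.toReal_lt_toReal (by simp) hp'.ne).2 hp
  have hp1 : 0 < p.toReal := by linarith
  obtain ⟨C, hC0, hC⟩ := exists_integral_pderiv3_pderiv3_le h1
  set D : ℝ≥0∞ := ENNReal.ofReal C ^ (1 / p.toReal) with hD
  have hDp : D ^ p.toReal = ENNReal.ofReal C := by
    rw [hD, ← ENNReal.rpow_mul, one_div_mul_cancel hp1.ne', ENNReal.rpow_one]
  have real : ∀ φ : E3 → ℝ, IsTest φ → ∀ i j,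
      eLpNorm (pderiv3 i (pderiv3 j φ)) p volume ≤ D * eLpNorm (lap3 φ) p volume := by
    intro φ hφ i j
    refine eLpNorm_le_of_lintegral_rpow_le hp0 hp'.ne ?_
    have h2 := (hφ.pderiv3 j).pderiv3 i
    rw [ENNReal.mul_rpow_of_nonneg _ _ hp1.le, hDp, ← lintegral_enorm_rpow_toReal hp0 hp'.ne,
      ← ofReal_integral_abs_rpow h2.continuous h2.hasCompactSupport hp1,
      ← ofReal_integral_abs_rpow hφ.lap3.continuous hφ.lap3.hasCompactSupport hp1,
      ← ENNReal.ofReal_mul hC0]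
    exact ENNReal.ofReal_le_ofReal (hC φ hφ i j)
  -- Real and imaginary parts commute with derivatives, so the real inequality applies to each.
  have comp : ∀ (L : ℂ →L[ℝ] ℝ), (∀ z, ‖L z‖ ≤ ‖z‖) → ∀ φ : E3 → ℂ, IsTest φ → ∀ i j,
      eLpNorm (fun x => L (pderiv3 i (pderiv3 j φ) x)) p volume
        ≤ D * eLpNorm (lap3 φ) p volume := by
    intro L hL φ hφ i j
    have h2 := real _ (hφ.clm_comp L) i j
    rw [pderiv3_clm_comp L hφ, pderiv3_clm_comp L (hφ.pderiv3 j)] at h2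
    refine h2.trans ?_
    gcongr
    refine eLpNorm_mono fun x => ?_
    have e : lap3 (fun x => L (φ x)) x = L (lap3 φ x) := by
      unfold lap3
      rw [map_sum]
      refine Finset.sum_congr rfl fun k _ => ?_
      rw [pderiv3_clm_comp L hφ, pderiv3_clm_comp L (hφ.pderiv3 k)]
    rw [e]
    exact hL _
  refine ⟨D + D, ?_, fun φ hφ i j => ?_⟩
  · have : D ≠ ⊤ := ENNReal.rpow_ne_top_of_nonneg (by positivity) ENNReal.ofReal_ne_top
    exact ENNReal.add_ne_top.2 ⟨this, this⟩
  · rw [add_mul]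
    exact (eLpNorm_le_re_add_im hp.le ((hφ.pderiv3 j).pderiv3 i).continuous).trans
      (add_le_add (comp _ (fun z => Complex.abs_re_le_norm z) φ hφ i j)
        (comp _ (fun z => Complex.abs_im_le_norm z) φ hφ i j))

/-- Second derivatives of the parametrix are bounded in `L^p`. -/
theorem IsParametrix.exists_eLpNorm_le {lam : ℂ} {R : ℝ} {E : E3 → ℂ} {E1 : Fin 3 → E3 → ℂ}
    {η : E3 → ℂ} (h : IsParametrix lam R E E1 η) (hp : 1 < p) (hp' : p < ⊤) :
    ∃ C : ℝ≥0∞, C ≠ ⊤ ∧ ∀ φ : E3 → ℂ, IsTest φ → ∀ i j,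
      eLpNorm (pderiv3 i (pderiv3 j (cconv E φ))) p volume ≤ C * eLpNorm φ p volume := by
  obtain ⟨C, hC, hb⟩ := exists_eLpNorm_pderiv3_pderiv3_le hp hp'
  have nE : eLpNorm E 1 volume ≠ ⊤ := (memLp_one_iff_integrable.2 h.integrable).2.ne
  have nη : eLpNorm η 1 volume ≠ ⊤ := (h.test.memLp 1).2.ne
  refine ⟨C * (1 + eLpNorm η 1 volume + ‖lam ^ 2‖ₑ * eLpNorm E 1 volume), ?_, ?_⟩
  · exact ENNReal.mul_ne_top hC (ENNReal.add_ne_top.2 ⟨ENNReal.add_ne_top.2 ⟨by simp, nη⟩,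
      ENNReal.mul_ne_top (by simp) nE⟩)
  · intro φ hφ i j
    refine (hb _ (h.isTest_cconv hφ) i j).trans ?_
    rw [mul_assoc]
    gcongr
    -- Each of the three terms of Δ(E∗φ) is bounded in L^p by Young's inequality.
    have e : lap3 (cconv E φ) = (φ + cconv η φ) - lam ^ 2 • cconv E φ := by
      funext x; rw [h.lap3_cconv hφ]; rfl
    have m1 := hφ.continuous.aestronglyMeasurable (μ := volume)
    have m2 := (_root_.isTest_cconv h.test.integrable.locallyIntegrable h.test.hasCompactSupport
      hφ).continuous.aestronglyMeasurable (μ := volume)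
    have m3 := (h.isTest_cconv hφ).continuous.aestronglyMeasurable (μ := volume)
    rw [e]
    refine (eLpNorm_sub_le (m1.add m2) (m3.const_smul _) hp.le).trans ?_
    rw [add_mul, add_mul, one_mul, eLpNorm_const_smul, mul_assoc]
    gcongr
    · refine (eLpNorm_add_le m1 m2 hp.le).trans ?_
      gcongr
      exact eLpNorm_cconv_le hp hp' h.test.continuous.measurable m1
    · exact eLpNorm_cconv_le hp hp' h.measurable m1

/-- Hölder's inequality gives continuity of the pairing of `L^q` and `L^p`. -/
theorem tendsto_integral_mul_of_eLpNorm {α : Type*} [MeasurableSpace α] {μ : Measure α}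
    {q : ℝ≥0∞} (hpq : p⁻¹ + q⁻¹ = 1) {f : ℕ → α → ℂ} {F h : α → ℂ}
    (hf : ∀ n, MemLp (f n) p μ) (hF : MemLp F p μ) (hh : MemLp h q μ)
    (hl : Tendsto (fun n => eLpNorm (fun x => f n x - F x) p μ) atTop (nhds 0)) :
    Tendsto (fun n => ∫ x, f n x * h x ∂μ) atTop (nhds (∫ x, F x * h x ∂μ)) := by
  have : ENNReal.HolderTriple p q 1 := ⟨by rw [hpq, inv_one]⟩
  have i1 : ∀ n, Integrable (fun x => f n x * h x) μ := fun n => (hf n).integrable_mul hh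
  have i2 : Integrable (fun x => F x * h x) μ := hF.integrable_mul hh
  refine tendsto_integral_of_L1 _ i2.aestronglyMeasurable (Eventually.of_forall i1) ?_
  have hb : ∀ n, ∫⁻ x, ‖f n x * h x - F x * h x‖ₑ ∂μ
      ≤ eLpNorm (fun x => f n x - F x) p μ * eLpNorm h q μ := fun n => by
    have := eLpNorm_smul_le_mul_eLpNorm (p := p) (q := q) (r := 1) (μ := μ) (f := h)
      (φ := fun x => f n x - F x) hh.1 ((hf n).1.sub hF.1)
    rw [eLpNorm_one_eq_lintegral_enorm] at this
    refine le_trans (le_of_eq ?_) this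
    refine lintegral_congr fun x => ?_
    simp [sub_mul]
  refine tendsto_of_tendsto_of_tendsto_of_le_of_le tendsto_const_nhds ?_ (fun _ => zero_le) hb
  have := ENNReal.Tendsto.mul_const hl (Or.inr hh.2.ne)
  rwa [zero_mul] at this

/-- The explicit rate 2^(−n) makes the differences summable, as required when completeness of L^p is
applied. -/
theorem exists_isTest_tendsto (hp : 1 ≤ p) (hp' : p ≠ ⊤) {f : E3 → ℂ} (hf : MemLp f p) :
    ∃ φ : ℕ → E3 → ℂ, (∀ n, IsTest (φ n)) ∧
      ∀ n : ℕ, eLpNorm (f - φ n) p volume ≤ 2⁻¹ ^ n := by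
  have : ∀ n : ℕ, ∃ φ : E3 → ℂ, IsTest φ ∧
      eLpNorm (f - φ) p volume ≤ 2⁻¹ ^ n := fun n => by
    obtain ⟨g, h1, h2, h3⟩ := hf.exist_eLpNorm_sub_le hp' hp (ε := (1 / 2) ^ n) (by positivity)
    refine ⟨g, ⟨h2, h1⟩, h3.trans_eq ?_⟩
    rw [ENNReal.ofReal_pow (by norm_num), one_div, ENNReal.ofReal_inv_of_pos two_pos]
    simp
  choose φ h1 h2 using this
  exact ⟨φ, h1, h2⟩

theorem cconv_sub {κ φ ψ : E3 → ℂ} (hκ : LocallyIntegrable κ) (hφ : IsTest φ) (hψ : IsTest ψ) :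
    cconv κ (fun x => φ x - ψ x) = fun x => cconv κ φ x - cconv κ ψ x := by
  funext x
  simp only [cconv_eq, mul_sub]
  exact integral_sub (integrable_mul_comp_sub hκ hφ.continuous hφ.hasCompactSupport x)
    (integrable_mul_comp_sub hκ hψ.continuous hψ.hasCompactSupport x)

theorem IsTest.sub {F : Type*} [NormedAddCommGroup F] [NormedSpace ℝ F] {φ ψ : E3 → F}
    (hφ : IsTest φ) (hψ : IsTest ψ) : IsTest fun x => φ x - ψ x :=
  ⟨hφ.contDiff.sub hψ.contDiff, hφ.hasCompactSupport.sub hψ.hasCompactSupport⟩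

theorem pderiv3_sub {F : Type*} [NormedAddCommGroup F] [NormedSpace ℝ F] {φ ψ : E3 → F}
    (hφ : Differentiable ℝ φ) (hψ : Differentiable ℝ ψ) (k : Fin 3) :
    pderiv3 k (fun x => φ x - ψ x) = fun x => pderiv3 k φ x - pderiv3 k ψ x := by
  funext x
  unfold pderiv3
  rw [fderiv_fun_sub (hφ x) (hψ x)]
  simp

theorem integral_test_mul_pderiv3 {φ ψ : E3 → ℂ} (hφ : IsTest φ) (hψ : IsTest ψ) (k : Fin 3) :
    ∫ x, φ x * pderiv3 k ψ x = -∫ x, pderiv3 k φ x * ψ x :=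
  integral_mul_pderiv3_eq_neg hφ.continuous (hφ.pderiv3 k).continuous
    (fun x => hφ.hasLineDerivAt k x) hψ

namespace IsParametrix

variable {lam : ℂ} {R : ℝ} {E : E3 → ℂ} {E1 : Fin 3 → E3 → ℂ} {η : E3 → ℂ}

/-- Integrating by parts twice and transposing the convolution: φ ↦ ∂ᵢ∂ⱼ(E∗φ) is symmetric on test
functions. This gives the second derivatives of a potential a weak meaning. -/
theorem integral_mul_hessian_comm (h : IsParametrix lam R E E1 η) {φ ψ : E3 → ℂ} (hφ : IsTest φ)
    (hψ : IsTest ψ) (i j : Fin 3) :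
    ∫ x, ψ x * pderiv3 i (pderiv3 j (cconv E φ)) x
      = ∫ x, φ x * pderiv3 i (pderiv3 j (cconv E ψ)) x := by
  have hE := h.integrable.locallyIntegrable
  have t := h.isTest_cconv hφ
  rw [integral_test_mul_pderiv3 hψ (t.pderiv3 j), integral_test_mul_pderiv3 (hψ.pderiv3 i) t,
    neg_neg, h.integral_mul_cconv ((hψ.pderiv3 i).pderiv3 j) hφ.integrable,
    ← _root_.pderiv3_cconv hE (hψ.pderiv3 i), ← _root_.pderiv3_cconv hE hψ,
    (h.isTest_cconv hψ).pderiv3_comm]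

/-- The second derivatives of the volume potential of an `L^p` function belong to `L^p`. -/
theorem exists_hessian (h : IsParametrix lam R E E1 η) {q : ℝ≥0∞} (hp : 1 < p) (hp' : p < ⊤)
    (hpq : p⁻¹ + q⁻¹ = 1) {f : E3 → ℂ} (hf : MemLp f p) (i j : Fin 3) :
    ∃ H : E3 → ℂ, MemLp H p ∧ ∀ φ, IsTest φ →
      ∫ x, φ x * H x = ∫ x, f x * pderiv3 i (pderiv3 j (cconv E φ)) x := by
  obtain ⟨C, hC, hb⟩ := h.exists_eLpNorm_le hp hp'
  obtain ⟨f', hf', hl⟩ := exists_isTest_tendsto hp.le hp'.ne hf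
  have tS : ∀ {φ}, IsTest φ → IsTest (pderiv3 i (pderiv3 j (cconv E φ))) := fun hφ =>
    ((h.isTest_cconv hφ).pderiv3 j).pderiv3 i
  set S : ℕ → E3 → ℂ := fun n => pderiv3 i (pderiv3 j (cconv E (f' n))) with hS
  have hdiff : ∀ n m, S n - S m = pderiv3 i (pderiv3 j (cconv E fun x => f' n x - f' m x)) :=
    fun n m => by
      have t1 := h.isTest_cconv (hf' n)
      have t2 := h.isTest_cconv (hf' m)
      rw [cconv_sub h.integrable.locallyIntegrable (hf' n) (hf' m),
        pderiv3_sub t1.differentiable t2.differentiable,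
        pderiv3_sub (t1.pderiv3 j).differentiable (t2.pderiv3 j).differentiable]
      rfl
  -- Linearity and the L^p bound on test functions make the Hessians of the approximants Cauchy; the
  -- extra +1 in the constant makes the inequality strict even if C = 0.
  have hlt : ∀ N n m : ℕ, N ≤ n → N ≤ m →
      eLpNorm (S n - S m) p volume < (2 * C + 1) * 2⁻¹ ^ N := by
    intro N n m hn hm
    have e1 : ∀ k, N ≤ k → eLpNorm (f - f' k) p volume ≤ 2⁻¹ ^ N := fun k hk =>
      (hl k).trans (pow_le_pow_of_le_one zero_le (by simp) hk)
    have e2 : eLpNorm (fun x => f' n x - f' m x) p volume ≤ 2⁻¹ ^ N + 2⁻¹ ^ N := by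
      have e : (fun x => f' n x - f' m x) = (f - f' m) - (f - f' n) := by
        funext x; simp
      rw [e]
      refine (eLpNorm_sub_le (hf.1.sub (hf' m).continuous.aestronglyMeasurable)
        (hf.1.sub (hf' n).continuous.aestronglyMeasurable) hp.le).trans ?_
      exact add_le_add (e1 m hm) (e1 n hn)
    rw [hdiff]
    have hfin : (2⁻¹ : ℝ≥0∞) ^ N ≠ ⊤ := by simp
    have hpos : (2⁻¹ : ℝ≥0∞) ^ N ≠ 0 := by simp
    calc _ ≤ C * (2⁻¹ ^ N + 2⁻¹ ^ N) :=
          (hb _ ((hf' n).sub (hf' m)) i j).trans (mul_le_mul_right e2 _)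
      _ = 2 * C * 2⁻¹ ^ N := by ring
      _ < 2 * C * 2⁻¹ ^ N + 2⁻¹ ^ N := ENNReal.lt_add_right
          (ENNReal.mul_ne_top (ENNReal.mul_ne_top (by simp) hC) hfin) hpos
      _ = _ := by ring
  have hsum : ∑' N : ℕ, (2 * C + 1) * (2⁻¹ : ℝ≥0∞) ^ N ≠ ⊤ := by
    rw [ENNReal.tsum_mul_left, ENNReal.tsum_geometric]
    refine ENNReal.mul_ne_top (ENNReal.add_ne_top.2 ⟨ENNReal.mul_ne_top (by simp) hC, by simp⟩) ?_
    simp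
  obtain ⟨H, hH, hlim⟩ := Lp.cauchy_complete_eLpNorm hp.le (fun n => (tS (hf' n)).memLp p) hsum hlt
  refine ⟨H, hH, fun φ hφ => ?_⟩
  -- The symmetry of the Hessian operator passes to the limit: on one side in the Hessians, on the
  -- other in the approximants of f.
  have l1 := tendsto_integral_mul_of_eLpNorm hpq (fun n => (tS (hf' n)).memLp p) hH (hφ.memLp q)
    hlim
  have l2 := tendsto_integral_mul_of_eLpNorm hpq (fun n => (hf' n).memLp p) hf ((tS hφ).memLp q) (by
    refine tendsto_of_tendsto_of_tendsto_of_le_of_le tendsto_const_nhds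
      (ENNReal.tendsto_pow_atTop_nhds_zero_of_lt_one (r := 2⁻¹) (by simp)) (fun _ => zero_le)
      fun n => ?_
    change eLpNorm (f' n - f) p volume ≤ _
    rw [eLpNorm_sub_comm]
    exact hl n)
  have e : ∀ n, ∫ x, S n x * φ x = ∫ x, f' n x * pderiv3 i (pderiv3 j (cconv E φ)) x := fun n => by
    rw [← h.integral_mul_hessian_comm (hf' n) hφ i j]
    simp_rw [mul_comm]
    rfl
  have l3 := tendsto_nhds_unique l1 ((funext e) ▸ l2)
  rw [← l3]
  simp_rw [mul_comm]

end IsParametrix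

end CalderonZygmund

/-! ### Weak derivatives in components -/

/-- Test functions with support in `Ω`. -/
structure IsTestOn (Ω : Opens E3) (φ : E3 → ℂ) : Prop where
  isTest : IsTest φ
  tsupport_subset : tsupport φ ⊆ Ω

section Components

variable {Ω : Opens E3} {φ f : E3 → ℂ}

theorem TestFunction.isTestOn (φ : 𝓓(Ω, ℂ)) : IsTestOn Ω φ :=
  ⟨⟨φ.contDiff, φ.hasCompactSupport⟩, φ.tsupport_subset⟩

theorem forall_testFunction_iff {P : (E3 → ℂ) → Prop} :
    (∀ φ : 𝓓(Ω, ℂ), P φ) ↔ ∀ φ, IsTestOn Ω φ → P φ :=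
  ⟨fun h φ hφ => h ⟨φ, hφ.1.contDiff, hφ.1.hasCompactSupport, hφ.2⟩,
    fun h φ => h φ φ.isTestOn⟩

theorem IsTestOn.pderiv3 (hφ : IsTestOn Ω φ) (k : Fin 3) : IsTestOn Ω (pderiv3 k φ) :=
  ⟨hφ.1.pderiv3 k, (tsupport_fderiv_apply_subset ℝ (e3 k)).trans hφ.2⟩

theorem IsTestOn.eq_zero (hφ : IsTestOn Ω φ) {x : E3} (hx : x ∉ Ω) : φ x = 0 :=
  image_eq_zero_of_notMem_tsupport fun h => hx (hφ.2 h)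

theorem IsTestOn.integrable_mul (hφ : IsTestOn Ω φ)
    (hf : LocallyIntegrableOn f (Ω : Set E3)) : Integrable fun x => φ x * f x := by
  rw [← integrableOn_iff_integrable_of_support_subset (s := tsupport φ)
    (fun x hx => subset_tsupport φ fun h => hx (by simp [h]))]
  obtain ⟨C, hC⟩ := hφ.1.hasCompactSupport.exists_bound_of_continuous hφ.1.continuous
  exact Integrable.bdd_mul (c := C) (hf.integrableOn_compact_subset hφ.2 hφ.1.hasCompactSupport)
    hφ.1.continuous.aestronglyMeasurable (Eventually.of_forall fun p => hC p)

theorem IsTestOn.setIntegral_mul (hφ : IsTestOn Ω φ) (f : E3 → ℂ) :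
    ∫ x in (Ω : Set E3), φ x * f x = ∫ x, φ x * f x :=
  setIntegral_eq_integral_of_forall_compl_eq_zero fun x hx => by
    rw [hφ.eq_zero hx, zero_mul]

theorem LocallyIntegrableOn.apply {f : E3 → C3} {s : Set E3} (hf : LocallyIntegrableOn f s)
    (j : Fin 3) : LocallyIntegrableOn (fun x => f x j) s := fun x hx => by
  obtain ⟨t, ht, h⟩ := hf x hx
  exact ⟨t, ht, Integrable.eval h j⟩

/-- With indices modulo 3 the three components of a cross product are one formula, so every curl
identity below is proved for a single j. -/
theorem crossProduct_apply (a b : C3) (j : Fin 3) :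
    crossProduct a b j = a (j + 1) * b (j + 2) - a (j + 2) * b (j + 1) := by
  fin_cases j <;> simp [cross_apply]

theorem fin3_add (j : Fin 3) : j + 1 + 1 = j + 2 ∧ j + 1 + 2 = j ∧ j + 2 + 1 = j ∧
    j + 2 + 2 = j + 1 := by
  revert j; decide

theorem sum_fin3_cyclic {M : Type*} [AddCommMonoid M] (f : Fin 3 → M) (j : Fin 3) :
    ∑ i, f i = f j + f (j + 1) + f (j + 2) := by
  rw [Fin.sum_univ_three]
  fin_cases j
  · rfl
  · change _ = f 1 + f 2 + f 0; abel
  · change _ = f 2 + f 0 + f 1; abel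

theorem locallyIntegrableOn_of_memLp {p : ℝ≥0∞} {f : E3 → C3} (hp : 1 ≤ p)
    (hf : MemLp f p (volume.restrict (Ω : Set E3))) : LocallyIntegrableOn f (Ω : Set E3) :=
  locallyIntegrableOn_of_locallyIntegrable_restrict (hf.locallyIntegrable hp)

/-- The weak curl in components. -/
theorem hasWeakCurl_iff {f c : E3 → C3} : HasWeakCurl Ω f c ↔
    LocallyIntegrableOn f (Ω : Set E3) ∧ LocallyIntegrableOn c (Ω : Set E3) ∧
    ∀ φ, IsTestOn Ω φ → ∀ j, (∫ x, pderiv3 (j + 1) φ x * f x (j + 2))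
      - (∫ x, pderiv3 (j + 2) φ x * f x (j + 1)) = -∫ x, φ x * c x j := by
  unfold HasWeakCurl
  refine and_congr_right fun hf => and_congr_right fun hc => ?_
  refine (forall_testFunction_iff (P := fun φ => ∫ x in (Ω : Set E3), crossProduct (grad3 φ x) (f x)
    = -∫ x in (Ω : Set E3), φ x • c x)).trans ?_
  refine forall_congr' fun φ => forall_congr' fun hφ => ?_
  have i1 : ∀ k j, Integrable fun x => pderiv3 k φ x * f x j := fun k j =>
    (hφ.pderiv3 k).integrable_mul (LocallyIntegrableOn.apply hf j)
  have i2 : ∀ j, Integrable fun x => φ x * c x j := fun j =>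
    hφ.integrable_mul (LocallyIntegrableOn.apply hc j)
  have e1 : ∀ j, (∫ x in (Ω : Set E3), crossProduct (grad3 φ x) (f x)) j
      = (∫ x, pderiv3 (j + 1) φ x * f x (j + 2)) - ∫ x, pderiv3 (j + 2) φ x * f x (j + 1) := by
    intro j
    rw [eval_integral]
    · simp only [crossProduct_apply, grad3]
      rw [integral_sub (i1 _ _).integrableOn (i1 _ _).integrableOn,
        (hφ.pderiv3 _).setIntegral_mul, (hφ.pderiv3 _).setIntegral_mul]
    · intro i
      simp only [crossProduct_apply, grad3]
      exact ((i1 _ _).sub (i1 _ _)).integrableOn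
  have e2 : ∀ j, (-∫ x in (Ω : Set E3), φ x • c x) j = -∫ x, φ x * c x j := by
    intro j
    rw [Pi.neg_apply, eval_integral]
    · simp only [Pi.smul_apply, smul_eq_mul]
      rw [hφ.setIntegral_mul]
    · intro i
      simp only [Pi.smul_apply, smul_eq_mul]
      exact (i2 i).integrableOn
  rw [funext_iff]
  simp only [e1, e2]

end Components

/-! ### The volume potential -/

namespace IsParametrix

variable {lam : ℂ} {R : ℝ} {E : E3 → ℂ} {E1 : Fin 3 → E3 → ℂ} {η : E3 → ℂ}

/-- The components of `T₂` in terms of the parametrix. -/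
noncomputable def potential (lam : ℂ) (E : E3 → ℂ) (E1 : Fin 3 → E3 → ℂ) (G : Fin 3 → E3 → ℂ)
    (j : Fin 3) (x : E3) : ℂ :=
  lam * cconv E (G j) x
    - (cconv (E1 (j + 1)) (G (j + 2)) x - cconv (E1 (j + 2)) (G (j + 1)) x)

variable {G : Fin 3 → E3 → ℂ}

theorem memLp_potential (h : IsParametrix lam R E E1 η) {p : ℝ≥0∞} (hp : 1 < p) (hp' : p < ⊤)
    (hG : ∀ j, Integrable (G j)) (hGp : ∀ j, MemLp (G j) p) (j : Fin 3) :
    MemLp (potential lam E E1 G j) p :=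
  ((memLp_cconv hp hp' h.measurable h.integrable (hG j) (hGp j)).const_mul lam).sub
    ((memLp_cconv hp hp' (h.measurable1 _) (h.integrable1 _) (hG _) (hGp _)).sub
      (memLp_cconv hp hp' (h.measurable1 _) (h.integrable1 _) (hG _) (hGp _)))

/-- All convolutions are transposed onto the test function, so the potential is only ever
differentiated through E∗φ. -/
theorem integral_mul_potential (h : IsParametrix lam R E E1 η) (hG : ∀ j, Integrable (G j))
    {φ : E3 → ℂ} (hφ : IsTest φ) (j : Fin 3) :
    ∫ x, φ x * potential lam E E1 G j x = lam * (∫ x, G j x * cconv E φ x)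
      + (∫ x, G (j + 2) x * pderiv3 (j + 1) (cconv E φ) x)
      - ∫ x, G (j + 1) x * pderiv3 (j + 2) (cconv E φ) x := by
  have i : ∀ {F : E3 → ℂ}, Integrable F → Integrable fun x => φ x * F x := fun hF => by
    obtain ⟨C, hC⟩ := hφ.hasCompactSupport.exists_bound_of_continuous hφ.continuous
    exact Integrable.bdd_mul (c := C) hF hφ.continuous.aestronglyMeasurable
      (Eventually.of_forall fun p => hC p)
  have j0 := i (integrable_cconv h.integrable (hG j))
  have j1 := i (integrable_cconv (h.integrable1 (j + 1)) (hG (j + 2)))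
  have j2 := i (integrable_cconv (h.integrable1 (j + 2)) (hG (j + 1)))
  have e : ∀ x, φ x * potential lam E E1 G j x = lam * (φ x * cconv E (G j) x)
      - (φ x * cconv (E1 (j + 1)) (G (j + 2)) x - φ x * cconv (E1 (j + 2)) (G (j + 1)) x) :=
    fun x => by unfold potential; ring
  simp only [e]
  have j3 : Integrable fun x =>
      φ x * cconv (E1 (j + 1)) (G (j + 2)) x - φ x * cconv (E1 (j + 2)) (G (j + 1)) x := j1.sub j2
  rw [integral_sub (j0.const_mul lam) j3, integral_sub j1 j2, integral_const_mul,
    h.integral_mul_cconv hφ (hG j), h.integral_mul_cconv1 hφ (hG _),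
    h.integral_mul_cconv1 hφ (hG _)]
  ring

/-- The weak curl of the volume potential. -/
theorem integral_curl_potential (h : IsParametrix lam R E E1 η) (hG : ∀ j, Integrable (G j))
    {φ : E3 → ℂ} (hφ : IsTest φ) (hη : ∀ j x, G j x * cconv η φ x = 0) (j : Fin 3) :
    (∫ x, pderiv3 (j + 1) φ x * potential lam E E1 G (j + 2) x)
      - (∫ x, pderiv3 (j + 2) φ x * potential lam E E1 G (j + 1) x)
      = lam * (∫ x, φ x * potential lam E E1 G j x)
        + (∑ i, ∫ x, G i x * pderiv3 i (pderiv3 j (cconv E φ)) x) - ∫ x, φ x * G j x := by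
  obtain ⟨h11, h12, h21, h22⟩ := fin3_add j
  have hE := h.integrable.locallyIntegrable
  have t := h.isTest_cconv hφ
  have iG : ∀ k {F : E3 → ℂ}, IsTest F → Integrable fun x => G k x * F x := fun k F hF => by
    obtain ⟨C, hC⟩ := hF.hasCompactSupport.exists_bound_of_continuous hF.continuous
    have := Integrable.bdd_mul (c := C) (hG k) hF.continuous.aestronglyMeasurable
      (Eventually.of_forall fun p => hC p)
    simpa only [mul_comm] using this
  have i2 : ∀ k, Integrable fun x => G j x * pderiv3 k (pderiv3 k (cconv E φ)) x := fun k =>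
    iG j ((t.pderiv3 k).pderiv3 k)
  have i3 : Integrable fun x => G j x * pderiv3 j (pderiv3 j (cconv E φ)) x
      + G j x * pderiv3 (j + 1) (pderiv3 (j + 1) (cconv E φ)) x := (i2 _).add (i2 _)
  -- This is −Δ paired with the potential: Δ(E∗φ) = φ + η∗φ − λ²E∗φ, where the η-term vanishes
  -- against G by `hη`.
  have hl : (∫ x, G j x * pderiv3 j (pderiv3 j (cconv E φ)) x)
      + (∫ x, G j x * pderiv3 (j + 1) (pderiv3 (j + 1) (cconv E φ)) x)
      + (∫ x, G j x * pderiv3 (j + 2) (pderiv3 (j + 2) (cconv E φ)) x)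
      = (∫ x, φ x * G j x) - lam ^ 2 * ∫ x, G j x * cconv E φ x := by
    rw [← integral_const_mul, ← integral_sub (by simpa only [mul_comm] using iG j hφ)
        ((iG j t).const_mul _),
      ← integral_add (i2 _) (i2 _), ← integral_add i3 (i2 _)]
    refine integral_congr_ae (Eventually.of_forall fun x => ?_)
    have h1 := h.lap3_cconv hφ x
    rw [lap3, sum_fin3_cyclic _ j] at h1
    have h2 := hη j x
    simp only
    linear_combination (G j x) * h1 + h2
  -- The second-order terms combine as curl curl = grad div − Δ, with the j-th pure derivative added
  -- to both; the first-order terms form the curl part of λT, and the −λ² from Δ supplies its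
  -- remaining part.
  rw [h.integral_mul_potential hG (hφ.pderiv3 _), h.integral_mul_potential hG (hφ.pderiv3 _),
    h.integral_mul_potential hG hφ, h11, h12, h21, h22, ← _root_.pderiv3_cconv hE hφ,
    ← _root_.pderiv3_cconv hE hφ, sum_fin3_cyclic _ j, t.pderiv3_comm (j + 1) j,
    t.pderiv3_comm (j + 2) j]
  rw [t.pderiv3_comm j (j + 1), t.pderiv3_comm j (j + 2)]
  linear_combination -hl

end IsParametrix

/-! ### The transform of g on Ω and its weak curl -/

section Teodorescu

variable {Ω : Opens E3} {φ : E3 → ℂ}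

theorem IsTestOn.integral_mul_congr (hφ : IsTestOn Ω φ) {f f' : E3 → ℂ}
    (h : f =ᵐ[volume.restrict (Ω : Set E3)] f') : ∫ x, φ x * f x = ∫ x, φ x * f' x := by
  rw [← hφ.setIntegral_mul, ← hφ.setIntegral_mul]
  refine integral_congr_ae ?_
  filter_upwards [h] with x hx
  rw [hx]

theorem IsParametrix.cconv_remainder_eq_zero {lam : ℂ} {R : ℝ} {E : E3 → ℂ}
    {E1 : Fin 3 → E3 → ℂ} {η : E3 → ℂ} (h : IsParametrix lam R E E1 η)
    (hR : ∀ x ∈ Ω, ∀ y ∈ Ω, ‖x - y‖ < R) (hφ : IsTestOn Ω φ) {x : E3} (hx : x ∈ Ω) :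
    cconv η φ x = 0 := by
  refine integral_eq_zero_of_ae (Eventually.of_forall fun y => ?_)
  by_cases hy : y ∈ Ω
  · simp [h.remainder_near _ (hR x hx y hy)]
  · simp [hφ.eq_zero hy]

/-- The values of `T₂` on `Ω` in terms of a parametrix. -/
theorem IsParametrix.ae_T2 {lam : ℂ} {R : ℝ} {E : E3 → ℂ}
    {E1 : Fin 3 → E3 → ℂ} {η : E3 → ℂ} (h : IsParametrix lam R E E1 η)
    (hR : ∀ x ∈ Ω, ∀ y ∈ Ω, ‖x - y‖ < R) {g : E3 → C3}
    (hG : ∀ j, Integrable ((Ω : Set E3).indicator fun x => g x j)) :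
    ∀ᵐ x ∂(volume.restrict (Ω : Set E3)), IntegrableOn (T2Integrand lam g x) (Ω : Set E3) ∧
      ∀ j, T2 Ω lam g x j
        = potential lam E E1 (fun j => (Ω : Set E3).indicator fun x => g x j) j x := by
  set G : Fin 3 → E3 → ℂ := fun j => (Ω : Set E3).indicator fun x => g x j with hGdef
  have hm := Ω.isOpen.measurableSet
  have a0 : ∀ᵐ x : E3, ∀ j, Integrable fun y => E (x - y) * G j y :=
    ae_all_iff.2 fun j => ae_integrable_cconv h.integrable (hG j)
  have a1 : ∀ᵐ x : E3, ∀ k j, Integrable fun y => E1 k (x - y) * G j y :=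
    ae_all_iff.2 fun k => ae_all_iff.2 fun j => ae_integrable_cconv (h.integrable1 k) (hG j)
  filter_upwards [ae_restrict_of_ae a0, ae_restrict_of_ae a1, ae_restrict_mem hm] with x h0 h1 hx
  have hK : ∀ j, Integrable fun y => lam * (E (x - y) * G j y)
      - (E1 (j + 1) (x - y) * G (j + 2) y - E1 (j + 2) (x - y) * G (j + 1) y) := fun j =>
    ((h0 j).const_mul lam).sub ((h1 _ _).sub (h1 _ _))
  have hne : ∀ᵐ y : E3, y ≠ x := by simp [ae_iff, measure_singleton]
  have heq : ∀ j, (fun y => lam * (E (x - y) * G j y)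
      - (E1 (j + 1) (x - y) * G (j + 2) y - E1 (j + 2) (x - y) * G (j + 1) y))
      =ᵐ[volume.restrict (Ω : Set E3)] fun y => T2Integrand lam g x y j := fun j => by
    filter_upwards [ae_restrict_of_ae hne, ae_restrict_mem hm] with y hy hyΩ
    have hxy : x - y ≠ 0 := sub_ne_zero.2 hy.symm
    have hlt := hR x hx y hyΩ
    simp only [hGdef, Set.indicator_of_mem hyΩ, T2Integrand, Pi.sub_apply, Pi.smul_apply,
      smul_eq_mul, crossProduct_apply, grad3, h.eq_fund _ hlt, h.eq_pderiv3 _ _ hxy hlt]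
    ring
  have hint : ∀ j, IntegrableOn (fun y => T2Integrand lam g x y j) (Ω : Set E3) := fun j =>
    (hK j).integrableOn.congr (heq j)
  refine ⟨Integrable.of_eval hint, fun j => ?_⟩
  have e1 : T2 Ω lam g x j = ∫ y in (Ω : Set E3), T2Integrand lam g x y j := eval_integral hint j
  have e2 : ∫ y, (lam * (E (x - y) * G j y)
      - (E1 (j + 1) (x - y) * G (j + 2) y - E1 (j + 2) (x - y) * G (j + 1) y))
      = potential lam E E1 G j x := by
    have i2 : Integrable fun y =>
        E1 (j + 1) (x - y) * G (j + 2) y - E1 (j + 2) (x - y) * G (j + 1) y :=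
      (h1 _ _).sub (h1 _ _)
    rw [integral_sub ((h0 j).const_mul lam) i2, integral_sub (h1 _ _) (h1 _ _),
      integral_const_mul]
    rfl
  rw [e1, ← integral_congr_ae (heq j), ← e2]
  refine setIntegral_eq_integral_of_forall_compl_eq_zero fun y hy => ?_
  simp [hGdef, Set.indicator_of_notMem hy]

/-- The field `T₂[g]` has a weak curl in `L^p`, which provides a particular solution. -/
theorem exists_weakCurl_T2 (hbdd : Bornology.IsBounded (Ω : Set E3)) {lam : ℂ} (hlam : lam ≠ 0)
    {p q : ℝ≥0∞} (hp : 1 < p) (hp' : p < ⊤) (hpq : p⁻¹ + q⁻¹ = 1) {g : E3 → C3}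
    (hg : MemLp g p (volume.restrict (Ω : Set E3))) :
    (∀ᵐ x ∂(volume.restrict (Ω : Set E3)),
      IntegrableOn (T2Integrand lam g x) (Ω : Set E3)) ∧
    MemLp (T2 Ω lam g) p (volume.restrict (Ω : Set E3)) ∧
    ∃ c : E3 → C3, MemLp c p (volume.restrict (Ω : Set E3)) ∧ HasWeakCurl Ω (T2 Ω lam g) c ∧
      HasWeakCurl Ω (fun x => lam⁻¹ • (g x - c x)) c := by
  -- R exceeds the diameter of Ω, so E equals θ on all differences of points of Ω and the remainder
  -- does not act between them.
  obtain ⟨R, hR0, hR⟩ : ∃ R : ℝ, 0 < R ∧ ∀ x ∈ Ω, ∀ y ∈ Ω, ‖x - y‖ < R := by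
    obtain ⟨C, hC⟩ := Metric.isBounded_iff.1 hbdd
    refine ⟨|C| + 1, by positivity, fun x hx y hy => ?_⟩
    have := hC hx hy
    rw [dist_eq_norm] at this
    linarith [le_abs_self C]
  obtain ⟨E, E1, η, h⟩ := exists_isParametrix lam hR0
  have hm := Ω.isOpen.measurableSet
  set G : Fin 3 → E3 → ℂ := fun j => (Ω : Set E3).indicator fun x => g x j with hGdef
  have hGp : ∀ j, MemLp (G j) p := fun j => (memLp_indicator_iff_restrict hm).2 (hg.eval j)
  have hfin : IsFiniteMeasure (volume.restrict (Ω : Set E3)) :=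
    isFiniteMeasure_restrict.2 hbdd.measure_lt_top.ne
  have hG : ∀ j, Integrable (G j) := fun j =>
    (integrable_indicator_iff hm).2 ((hg.eval j).integrable hp.le)
  have hT := h.ae_T2 hR hG
  have hTj : ∀ j, (fun x => T2 Ω lam g x j) =ᵐ[volume.restrict (Ω : Set E3)]
      IsParametrix.potential lam E E1 G j := fun j => by
    filter_upwards [hT] with x hx using hx.2 j
  have hTp : MemLp (T2 Ω lam g) p (volume.restrict (Ω : Set E3)) :=
    MemLp.of_eval fun j => ((h.memLp_potential hp hp' hG hGp j).restrict _).ae_eq (hTj j).symm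
  -- H i j represents ∂ᵢ∂ⱼ(E∗Gᵢ), so the sum over i is the j-th component of grad div of the
  -- potential.
  choose H hH hHφ using fun i j => h.exists_hessian hp hp' hpq (hGp i) i j
  have hHs : ∀ j, MemLp (fun x => ∑ i, H i j x) p := fun j => memLp_finsetSum _ fun i _ => hH i j
  have hHl : ∀ i j, LocallyIntegrableOn (H i j) (Ω : Set E3) := fun i j =>
    ((hH i j).locallyIntegrable hp.le).locallyIntegrableOn _
  have hHsl : ∀ j, LocallyIntegrableOn (fun x => ∑ i, H i j x) (Ω : Set E3) := fun j =>
    ((hHs j).locallyIntegrable hp.le).locallyIntegrableOn _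
  have hHsφ : ∀ {φ}, IsTestOn Ω φ → ∀ j, ∫ x, φ x * ∑ i, H i j x
      = ∑ i, ∫ x, G i x * pderiv3 i (pderiv3 j (cconv E φ)) x := fun {φ} hφ j => by
    simp only [Finset.mul_sum]
    rw [integral_finsetSum _ fun i _ => hφ.integrable_mul (hHl i j)]
    exact Finset.sum_congr rfl fun i _ => hHφ i j φ hφ.1
  -- The weak curl read off from curl T = g − λT − grad div(E∗G).
  set c : E3 → C3 := fun x j => g x j - lam * T2 Ω lam g x j - ∑ i, H i j x with hc
  have hcp : MemLp c p (volume.restrict (Ω : Set E3)) := MemLp.of_eval fun j =>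
    ((hg.eval j).sub ((hTp.eval j).const_mul lam)).sub ((hHs j).restrict _)
  have lg := locallyIntegrableOn_of_memLp hp.le hg
  have lT := locallyIntegrableOn_of_memLp hp.le hTp
  have lc := locallyIntegrableOn_of_memLp hp.le hcp
  have key : ∀ φ, IsTestOn Ω φ → ∀ j, (∫ x, pderiv3 (j + 1) φ x * T2 Ω lam g x (j + 2))
      - (∫ x, pderiv3 (j + 2) φ x * T2 Ω lam g x (j + 1)) = -∫ x, φ x * c x j := by
    intro φ hφ j
    have i1 := hφ.integrable_mul (LocallyIntegrableOn.apply lg j)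
    have i2 := hφ.integrable_mul (LocallyIntegrableOn.apply lT j)
    have i3 := hφ.integrable_mul (hHsl j)
    have i4 : Integrable fun x => φ x * g x j - lam * (φ x * T2 Ω lam g x j) :=
      i1.sub (i2.const_mul lam)
    have e : ∀ x, φ x * c x j = φ x * g x j - lam * (φ x * T2 Ω lam g x j)
        - φ x * ∑ i, H i j x := fun x => by simp only [hc]; ring
    have eG : ∫ x, φ x * G j x = ∫ x, φ x * g x j := hφ.integral_mul_congr (by
      filter_upwards [ae_restrict_mem hm] with x hx
      simp only [hGdef, Set.indicator_of_mem hx])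
    have hη : ∀ j x, G j x * cconv η φ x = 0 := fun j x => by
      by_cases hx : x ∈ (Ω : Set E3)
      · rw [h.cconv_remainder_eq_zero hR hφ hx, mul_zero]
      · simp only [hGdef, Set.indicator_of_notMem hx, zero_mul]
    simp only [e]
    rw [integral_sub i4 i3, integral_sub i1 (i2.const_mul lam), integral_const_mul,
      (hφ.pderiv3 _).integral_mul_congr (hTj _), (hφ.pderiv3 _).integral_mul_congr (hTj _),
      hφ.integral_mul_congr (hTj _), h.integral_curl_potential hG hφ.1 hη, hHsφ hφ, eG]
    ring
  refine ⟨hT.mono fun x hx => hx.1, hTp, c, hcp, hasWeakCurl_iff.2 ⟨lT, lc, key⟩, ?_⟩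
  have hw : MemLp (fun x => lam⁻¹ • (g x - c x)) p (volume.restrict (Ω : Set E3)) :=
    (hg.sub hcp).const_smul lam⁻¹
  refine hasWeakCurl_iff.2 ⟨locallyIntegrableOn_of_memLp hp.le hw, lc, fun φ hφ j => ?_⟩
  rw [← key φ hφ j]
  -- By the choice of c, (g − c)/λ = T + (grad div(E∗G))/λ. Mixed derivatives of E∗φ commute, so the
  -- gradient has no weak curl and this field has the same curl c as T.
  have e : ∀ {ψ}, IsTestOn Ω ψ → ∀ j, ∫ x, ψ x * (lam⁻¹ • (g x - c x)) j
      = (∫ x, ψ x * T2 Ω lam g x j)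
        + lam⁻¹ * ∑ i, ∫ x, G i x * pderiv3 i (pderiv3 j (cconv E ψ)) x := fun {ψ} hψ j => by
    rw [← hHsφ hψ, ← integral_const_mul, ← integral_add
      (hψ.integrable_mul (LocallyIntegrableOn.apply lT j))
      ((hψ.integrable_mul (hHsl j)).const_mul _)]
    refine integral_congr_ae (Eventually.of_forall fun x => ?_)
    simp only [hc, Pi.smul_apply, Pi.sub_apply, smul_eq_mul]
    field_simp
    ring
  rw [e (hφ.pderiv3 _), e (hφ.pderiv3 _), ← pderiv3_cconv h.integrable.locallyIntegrable hφ.1,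
    ← pderiv3_cconv h.integrable.locallyIntegrable hφ.1,
    (h.isTest_cconv hφ.1).pderiv3_comm (j + 2) (j + 1)]
  ring

end Teodorescu

/-! ### Weyl's lemma -/

section Weyl

variable {Ω : Opens E3} {lam : ℂ}

theorem ae_eq_zero_of_forall_isTestOn {f : E3 → ℂ} {U : Set E3} (hU : IsOpen U)
    (hf : LocallyIntegrableOn f U)
    (h : ∀ φ : E3 → ℂ, IsTest φ → tsupport φ ⊆ U → ∫ x, φ x * f x = 0) :
    ∀ᵐ x, x ∈ U → f x = 0 := by
  refine hU.ae_eq_zero_of_integral_contDiff_smul_eq_zero hf fun g h1 h2 h3 => ?_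
  have hφ : IsTest fun x => (g x : ℂ) := IsTest.clm_comp Complex.ofRealCLM ⟨h1, h2⟩
  have hs : tsupport (fun x => (g x : ℂ)) ⊆ U :=
    (tsupport_comp_subset (g := fun r : ℝ => (r : ℂ)) Complex.ofReal_zero g).trans h3
  simpa using h _ hφ hs

theorem cconv_eq_zero_of_lt {κ φ : E3 → ℂ} {r s : ℝ} {x₀ : E3} (hκ : ∀ z, r < ‖z‖ → κ z = 0)
    (hφ : ∀ y, s < ‖y - x₀‖ → φ y = 0) {x : E3} (hx : r + s < ‖x - x₀‖) : cconv κ φ x = 0 := by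
  refine integral_eq_zero_of_ae (Eventually.of_forall fun y => ?_)
  by_cases hy : s < ‖y - x₀‖
  · simp [hφ y hy]
  · have h1 : r < ‖x - y‖ := by
      have := norm_add_le (x - y) (y - x₀)
      rw [sub_add_sub_cancel] at this
      linarith
    simp [hκ _ h1]

/-- Weyl's lemma near a point: a weak solution of the Helmholtz equation is smooth. -/
theorem exists_contDiff_ae_eq_ball {f : E3 → ℂ} (hf : LocallyIntegrableOn f (Ω : Set E3))
    (h : ∀ φ, IsTestOn Ω φ → ∫ x, (lap3 φ x + lam ^ 2 * φ x) * f x = 0) {x₀ : E3} {r : ℝ}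
    (hr : 0 < r) (hball : Metric.closedBall x₀ (4 * r) ⊆ Ω) :
    ∃ u : E3 → ℂ, ContDiff ℝ ((⊤ : ℕ∞) : WithTop ℕ∞) u ∧
      ∀ᵐ x, x ∈ Metric.ball x₀ r → f x = u x := by
  obtain ⟨E, E1, η, hE⟩ := exists_isParametrix lam hr
  -- Truncation makes f globally integrable, so η∗F is smooth on the whole space.
  set F := (Metric.closedBall x₀ (4 * r)).indicator f with hF
  have hFi : Integrable F := (integrable_indicator_iff Metric.isClosed_closedBall.measurableSet).2
    (hf.integrableOn_compact_subset hball (isCompact_closedBall _ _))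
  have hu : ContDiff ℝ ((⊤ : ℕ∞) : WithTop ℕ∞) (cconv η F) :=
    contDiff_cconv_left hE.test hFi.locallyIntegrable
  refine ⟨fun x => -cconv η F x, hu.neg, ?_⟩
  have hloc : LocallyIntegrableOn (fun x => f x + cconv η F x) (Metric.ball x₀ r) :=
    (hf.mono_set ((Metric.ball_subset_closedBall.trans
      (Metric.closedBall_subset_closedBall (by linarith))).trans hball)).add
      (hu.continuous.locallyIntegrable.locallyIntegrableOn _)
  -- Let φ be supported in the ball of radius r. E and η vanish beyond 2r, so E∗φ and η∗φ vanish
  -- beyond 3r and are admissible. Testing with E∗φ gives 0 = ∫ fφ + ∫ f(η∗φ) = ∫ φ(f + η∗F), hence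
  -- f = −η∗F on the small ball.
  have key := ae_eq_zero_of_forall_isTestOn Metric.isOpen_ball hloc fun φ hφ hs => by
    have hφ0 : ∀ y, r < ‖y - x₀‖ → φ y = 0 := fun y hy =>
      image_eq_zero_of_notMem_tsupport fun hy' => by
        have := hs hy'
        rw [mem_ball_iff_norm] at this
        linarith
    have hsub : ∀ {ψ : E3 → ℂ}, (∀ y, 3 * r < ‖y - x₀‖ → ψ y = 0) →
        tsupport ψ ⊆ Metric.closedBall x₀ (4 * r) := fun {ψ} h0 => by
      refine closure_minimal (fun y hy => ?_) Metric.isClosed_closedBall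
      rw [mem_closedBall_iff_norm]
      by_contra hlt
      exact hy (h0 y (by linarith))
    have s1 : IsTestOn Ω (cconv E φ) := ⟨hE.isTest_cconv hφ,
      (hsub fun y hy => cconv_eq_zero_of_lt hE.eq_zero hφ0 (by linarith)).trans hball⟩
    have t2 : IsTest (cconv η φ) :=
      isTest_cconv hE.test.integrable.locallyIntegrable hE.test.hasCompactSupport hφ
    have hη0 : ∀ y, 3 * r < ‖y - x₀‖ → cconv η φ y = 0 := fun y hy =>
      cconv_eq_zero_of_lt hE.remainder_far hφ0 (by linarith)
    have s2 : IsTestOn Ω (cconv η φ) := ⟨t2, (hsub hη0).trans hball⟩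
    have s3 : IsTestOn Ω φ := ⟨hφ, (hsub fun y hy => hφ0 y (by linarith)).trans hball⟩
    have h1 := h _ s1
    have e1 : ∀ x, (lap3 (cconv E φ) x + lam ^ 2 * cconv E φ x) * f x
        = φ x * f x + cconv η φ x * f x := fun x => by rw [hE.lap3_cconv hφ]; ring
    simp only [e1] at h1
    rw [integral_add (s3.integrable_mul hf) (s2.integrable_mul hf)] at h1
    have e2 : ∫ x, cconv η φ x * f x = ∫ x, φ x * cconv η F x := by
      rw [hE.integral_mul_cconv_remainder hφ hFi]
      refine integral_congr_ae (Eventually.of_forall fun x => ?_)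
      by_cases hx : x ∈ Metric.closedBall x₀ (4 * r)
      · simp only [hF, Set.indicator_of_mem hx]; ring
      · have : cconv η φ x = 0 := image_eq_zero_of_notMem_tsupport fun hx' => hx (hsub hη0 hx')
        simp [this]
    have i3 : Integrable fun x => φ x * cconv η F x :=
      (hφ.continuous.mul hu.continuous).integrable_of_hasCompactSupport
        hφ.hasCompactSupport.mul_right
    simp only [mul_add]
    rw [integral_add (s3.integrable_mul hf) i3, ← e2, h1]
  filter_upwards [key] with x hx hxb
  exact eq_neg_of_add_eq_zero_left (hx hxb)

/-- The set of disagreement is open and null, and nonempty open sets have positive measure. -/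
theorem eqOn_of_ae_eq {F : Type*} [TopologicalSpace F] [T2Space F] {u v : E3 → F} {U : Set E3}
    (hU : IsOpen U) (hu : Continuous u) (hv : Continuous v) (h : ∀ᵐ x, x ∈ U → u x = v x) :
    Set.EqOn u v U := by
  have hV : IsOpen (U ∩ {x | u x ≠ v x}) := hU.inter (isOpen_ne_fun hu hv)
  have h0 : volume (U ∩ {x | u x ≠ v x}) = 0 := by
    rw [ae_iff] at h
    refine measure_mono_null (fun x hx => ?_) h
    simpa using hx
  have := hV.measure_eq_zero_iff volume |>.1 h0
  intro x hx
  by_contra hne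
  exact (this ▸ (⟨hx, hne⟩ : x ∈ U ∩ {x | u x ≠ v x}) : x ∈ (∅ : Set E3))

/-- A locally null set is null, by second countability. -/
theorem ae_of_forall_ball {P : E3 → Prop} (h : ∀ x ∈ Ω, ∃ r > 0, ∀ᵐ y, y ∈ Metric.ball x r → P y) :
    ∀ᵐ x, x ∈ Ω → P x := by
  rw [ae_iff]
  refine measure_null_of_locally_null _ fun x hx => ?_
  simp only [Classical.not_imp, Set.mem_ofPred_eq] at hx
  obtain ⟨r, hr, hb⟩ := h x hx.1
  refine ⟨_, inter_mem_nhdsWithin _ (Metric.ball_mem_nhds x hr), ?_⟩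
  rw [ae_iff] at hb
  refine measure_mono_null (fun y hy => ?_) hb
  simp only [Classical.not_imp, Set.mem_ofPred_eq, Set.mem_inter_iff] at hy ⊢
  exact ⟨hy.2, hy.1.2⟩

/-- Weyl's lemma for the Helmholtz equation. -/
theorem exists_contDiffOn_ae_eq {f : E3 → ℂ} (hf : LocallyIntegrableOn f (Ω : Set E3))
    (h : ∀ φ, IsTestOn Ω φ → ∫ x, (lap3 φ x + lam ^ 2 * φ x) * f x = 0) :
    ∃ u : E3 → ℂ, ContDiffOn ℝ 1 u (Ω : Set E3) ∧ ∀ᵐ x, x ∈ Ω → f x = u x := by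
  have hloc : ∀ x : E3, ∃ r : ℝ, ∃ u : E3 → ℂ, x ∈ Ω → 0 < r ∧
      ContDiff ℝ ((⊤ : ℕ∞) : WithTop ℕ∞) u ∧ ∀ᵐ y, y ∈ Metric.ball x r → f y = u y := by
    intro x
    by_cases hx : x ∈ Ω
    · obtain ⟨ε, hε, hb⟩ := Metric.isOpen_iff.1 Ω.isOpen x hx
      obtain ⟨u, hu, hae⟩ := exists_contDiff_ae_eq_ball hf h (x₀ := x) (r := ε / 5)
        (by positivity) ((Metric.closedBall_subset_ball (by linarith)).trans hb)
      exact ⟨ε / 5, u, fun _ => ⟨by positivity, hu, hae⟩⟩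
    · exact ⟨0, 0, fun h => absurd h hx⟩
  choose r U hU using hloc
  -- The local smooth representatives agree on overlaps, so the diagonal choice U x x coincides near
  -- each point with a single one of them.
  have heq : ∀ x ∈ Ω, ∀ y ∈ Ω, y ∈ Metric.ball x (r x) → U y y = U x y := by
    intro x hx y hy hyx
    obtain ⟨rx, cx, ax⟩ := hU x hx
    obtain ⟨ry, cy, ay⟩ := hU y hy
    refine eqOn_of_ae_eq (Metric.isOpen_ball.inter Metric.isOpen_ball) cy.continuous cx.continuous
      ?_ ⟨hyx, Metric.mem_ball_self ry⟩
    filter_upwards [ax, ay] with z hzx hzy hz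
    rw [← hzx hz.1, ← hzy hz.2]
  refine ⟨fun x => U x x, fun x hx => ?_, ?_⟩
  · obtain ⟨rx, cx, -⟩ := hU x hx
    refine ContDiffAt.contDiffWithinAt ?_
    refine (cx.contDiffAt.of_le (by exact_mod_cast le_top)).congr_of_eventuallyEq ?_
    filter_upwards [Metric.ball_mem_nhds x rx, Ω.isOpen.mem_nhds hx] with y hy hyΩ
    exact heq x hx y hyΩ hy
  · have : ∀ᵐ x, x ∈ Ω → x ∈ Ω → f x = U x x := ae_of_forall_ball fun x hx => by
      obtain ⟨rx, -, ax⟩ := hU x hx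
      refine ⟨r x, rx, ?_⟩
      filter_upwards [ax] with y hy hyx hyΩ
      rw [hy hyx, heq x hx y hyΩ hyx]
    filter_upwards [this] with x hx hxΩ using hx hxΩ hxΩ

end Weyl

/-! ### Force-free fields -/

section ForceFree

variable {Ω : Opens E3} {lam : ℂ}

theorem curl3_apply (u : E3 → C3) (x : E3) (j : Fin 3) :
    curl3 u x j = pderiv3 (j + 1) u x (j + 2) - pderiv3 (j + 2) u x (j + 1) := by
  fin_cases j <;> rfl

theorem pderiv3_apply {u : E3 → C3} {x : E3} (hu : DifferentiableAt ℝ u x) (k j : Fin 3) :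
    pderiv3 k u x j = pderiv3 k (fun x => u x j) x := by
  unfold pderiv3
  rw [fderiv_apply hu]
  rfl

theorem IsTestOn.integral_pderiv3_mul {φ u : E3 → ℂ} (hφ : IsTestOn Ω φ)
    (hu : ContDiffOn ℝ 1 u (Ω : Set E3)) (k : Fin 3) :
    ∫ x, _root_.pderiv3 k φ x * u x = -∫ x, φ x * _root_.pderiv3 k u x := by
  have hc : ContinuousOn (_root_.pderiv3 k u) (Ω : Set E3) :=
    (hu.continuousOn_fderiv_of_isOpen Ω.isOpen (by simp)).clm_apply continuousOn_const
  have l1 : LocallyIntegrableOn u (Ω : Set E3) :=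
    hu.continuousOn.locallyIntegrableOn Ω.isOpen.measurableSet
  have l2 : LocallyIntegrableOn (_root_.pderiv3 k u) (Ω : Set E3) :=
    hc.locallyIntegrableOn Ω.isOpen.measurableSet
  have := integral_bilinear_hasLineDerivAt_right_eq_neg_left_of_integrable (μ := volume)
    (f := u) (f' := _root_.pderiv3 k u) (g := φ) (g' := _root_.pderiv3 k φ) (v := e3 k)
    (B := ContinuousLinearMap.mul ℝ ℂ)
    (by simpa only [ContinuousLinearMap.mul_apply', mul_comm] using hφ.integrable_mul l2)
    (by simpa only [ContinuousLinearMap.mul_apply', mul_comm] using (hφ.pderiv3 k).integrable_mul l1)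
    (by simpa only [ContinuousLinearMap.mul_apply', mul_comm] using hφ.integrable_mul l1)
    (fun x hx => ((hu.differentiableOn (by simp)).differentiableAt
      (Ω.isOpen.mem_nhds (hφ.2 hx))).hasFDerivAt.hasLineDerivAt _)
    (fun x _ => hφ.1.hasLineDerivAt k x)
  simpa only [ContinuousLinearMap.mul_apply', mul_comm] using this

/-- The weak curl of a continuously differentiable field, tested. -/
theorem integral_curl3 {u : E3 → C3} (hu : ContDiffOn ℝ 1 u (Ω : Set E3)) {φ : E3 → ℂ}
    (hφ : IsTestOn Ω φ) (j : Fin 3) :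
    (∫ x, pderiv3 (j + 1) φ x * u x (j + 2)) - (∫ x, pderiv3 (j + 2) φ x * u x (j + 1))
      = -∫ x, φ x * curl3 u x j := by
  have huj : ∀ j, ContDiffOn ℝ 1 (fun x => u x j) (Ω : Set E3) := fun j => contDiffOn_pi.1 hu j
  have hc : ∀ k j, LocallyIntegrableOn (pderiv3 k fun x => u x j) (Ω : Set E3) := fun k j =>
    ContinuousOn.locallyIntegrableOn (((huj j).continuousOn_fderiv_of_isOpen Ω.isOpen
      (by simp)).clm_apply continuousOn_const) Ω.isOpen.measurableSet
  rw [hφ.integral_pderiv3_mul (huj _), hφ.integral_pderiv3_mul (huj _)]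
  rw [← neg_sub', neg_inj, ← integral_sub (hφ.integrable_mul (hc _ _)) (hφ.integrable_mul (hc _ _))]
  refine integral_congr_ae (Eventually.of_forall fun x => ?_)
  by_cases hx : x ∈ Ω
  · have hd : DifferentiableAt ℝ u x :=
      (hu.differentiableOn (by simp)).differentiableAt (Ω.isOpen.mem_nhds hx)
    simp only [curl3_apply, pderiv3_apply hd, mul_sub]
  · simp [hφ.eq_zero hx]

theorem IsForceFree.hasWeakCurl {u : E3 → C3} (hu : IsForceFree Ω lam u) :
    HasWeakCurl Ω u fun x => -(lam • u x) := by
  have hl : LocallyIntegrableOn u (Ω : Set E3) :=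
    hu.1.continuousOn.locallyIntegrableOn Ω.isOpen.measurableSet
  have hl2 : LocallyIntegrableOn (fun x => -(lam • u x)) (Ω : Set E3) :=
    (hu.1.continuousOn.const_smul lam).neg.locallyIntegrableOn Ω.isOpen.measurableSet
  refine hasWeakCurl_iff.2 ⟨hl, hl2, fun φ hφ j => ?_⟩
  rw [integral_curl3 hu.1 hφ, neg_inj]
  refine integral_congr_ae (Eventually.of_forall fun x => ?_)
  by_cases hx : x ∈ Ω
  · simp only [eq_neg_of_add_eq_zero_left (hu.2 x hx)]
  · simp [hφ.eq_zero hx]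

/-- Regularity of weak force-free fields. -/
theorem exists_isForceFree (hlam : lam ≠ 0) {v : E3 → C3}
    (hv : HasWeakCurl Ω v fun x => -(lam • v x)) :
    ∃ u, IsForceFree Ω lam u ∧ v =ᵐ[volume.restrict (Ω : Set E3)] u := by
  obtain ⟨hl, -, h⟩ := hasWeakCurl_iff.1 hv
  have h' : ∀ φ, IsTestOn Ω φ → ∀ j, (∫ x, pderiv3 (j + 1) φ x * v x (j + 2))
      - (∫ x, pderiv3 (j + 2) φ x * v x (j + 1)) = lam * ∫ x, φ x * v x j := fun φ hφ j => by
    rw [h φ hφ j, ← integral_neg, ← integral_const_mul]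
    refine integral_congr_ae (Eventually.of_forall fun x => ?_)
    simp only [Pi.neg_apply, Pi.smul_apply, smul_eq_mul]
    ring
  have lj := LocallyIntegrableOn.apply hl
  -- Testing component j with ∂ⱼφ and summing cancels all mixed derivatives: λ div v = 0, and λ ≠ 0.
  have hdiv : ∀ φ, IsTestOn Ω φ → ∀ j, (∫ x, pderiv3 j φ x * v x j)
      + (∫ x, pderiv3 (j + 1) φ x * v x (j + 1)) + (∫ x, pderiv3 (j + 2) φ x * v x (j + 2)) = 0 := by
    intro φ hφ j
    obtain ⟨h11, h12, h21, h22⟩ := fin3_add j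
    have h0 := h' _ (hφ.pderiv3 j) j
    have h1 := h' _ (hφ.pderiv3 (j + 1)) (j + 1)
    have h2 := h' _ (hφ.pderiv3 (j + 2)) (j + 2)
    simp only [h11, h12, h21, h22] at h1 h2
    rw [hφ.1.pderiv3_comm (j + 1) j, hφ.1.pderiv3_comm (j + 2) j] at h0
    rw [hφ.1.pderiv3_comm (j + 2) (j + 1)] at h1
    refine (mul_eq_zero.1 ?_).resolve_left hlam
    linear_combination -h0 - h1 - h2
  -- Applying the equation twice gives curl curl v = λ²v, and curl curl = −Δ because v is
  -- divergence-free. In weak form, components j + 2 and j + 1 are tested with ∂ⱼ₊₁φ and ∂ⱼ₊₂φ.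
  have helm : ∀ φ, IsTestOn Ω φ → ∀ j, ∫ x, (lap3 φ x + lam ^ 2 * φ x) * v x j = 0 := by
    intro φ hφ j
    obtain ⟨h11, h12, h21, h22⟩ := fin3_add j
    have i : ∀ k, Integrable fun x => pderiv3 k (pderiv3 k φ) x * v x j := fun k =>
      ((hφ.pderiv3 k).pderiv3 k).integrable_mul (lj j)
    have i0 := (hφ.integrable_mul (lj j)).const_mul (lam ^ 2)
    have e : ∀ x, (lap3 φ x + lam ^ 2 * φ x) * v x j
        = (∑ k, pderiv3 k (pderiv3 k φ) x * v x j) + lam ^ 2 * (φ x * v x j) := fun x => by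
      rw [lap3, ← Finset.sum_mul]; ring
    simp only [e]
    rw [integral_add (integrable_finsetSum _ fun k _ => i k) i0,
      integral_finsetSum _ fun k _ => i k, integral_const_mul, sum_fin3_cyclic _ j]
    have h0 := h' _ hφ j
    have h1 := h' _ (hφ.pderiv3 (j + 1)) (j + 2)
    have h2 := h' _ (hφ.pderiv3 (j + 2)) (j + 1)
    have h3 := hdiv _ (hφ.pderiv3 j) j
    simp only [h11, h12, h21, h22] at h1 h2
    rw [hφ.1.pderiv3_comm (j + 1) j, hφ.1.pderiv3_comm (j + 2) j] at h3
    linear_combination h3 - lam * h0 - h1 + h2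
  choose u hu hae using fun j => exists_contDiffOn_ae_eq (lj j) fun φ hφ => helm φ hφ j
  set w : E3 → C3 := fun x j => u j x with hw
  have hvw : v =ᵐ[volume.restrict (Ω : Set E3)] w := by
    have := ae_all_iff.2 hae
    rw [EventuallyEq, ae_restrict_iff' Ω.isOpen.measurableSet]
    filter_upwards [this] with x hx hxΩ
    exact funext fun j => hx j hxΩ
  have hw1 : ContDiffOn ℝ 1 w (Ω : Set E3) := contDiffOn_pi.2 hu
  refine ⟨w, ⟨hw1, ?_⟩, hvw⟩
  have hcurl : ∀ j, ContinuousOn (fun x => curl3 w x j) (Ω : Set E3) := fun j => by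
    have hd : ContinuousOn (fderiv ℝ w) (Ω : Set E3) :=
      hw1.continuousOn_fderiv_of_isOpen Ω.isOpen (by simp)
    have hp : ∀ k j, ContinuousOn (fun x => pderiv3 k w x j) (Ω : Set E3) := fun k j =>
      continuousOn_pi.1 (hd.clm_apply continuousOn_const) j
    simp only [curl3_apply]
    exact (hp _ _).sub (hp _ _)
  have hcw : ∀ j, ContinuousOn (fun x => curl3 w x j + lam * w x j) (Ω : Set E3) := fun j =>
    (hcurl j).add (continuousOn_const.mul (hu j).continuousOn)
  -- The regular representative satisfies the equation weakly, hence almost everywhere; continuity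
  -- of curl w + λw then gives it at every point.
  have hz : ∀ j, ∀ᵐ x, x ∈ (Ω : Set E3) → curl3 w x j + lam * w x j = 0 := fun j => by
    refine ae_eq_zero_of_forall_isTestOn Ω.isOpen
      ((hcw j).locallyIntegrableOn Ω.isOpen.measurableSet) fun φ hφ hs => ?_
    have hφ' : IsTestOn Ω φ := ⟨hφ, hs⟩
    have e : ∀ {ψ}, IsTestOn Ω ψ → ∀ j, ∫ x, ψ x * v x j = ∫ x, ψ x * w x j := fun hψ j =>
      hψ.integral_mul_congr (hvw.mono fun x hx => by simp only [hx])
    have h1 := h' φ hφ' j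
    have lw : LocallyIntegrableOn (fun x => w x j) (Ω : Set E3) :=
      (hu j).continuousOn.locallyIntegrableOn Ω.isOpen.measurableSet
    have lc : LocallyIntegrableOn (fun x => curl3 w x j) (Ω : Set E3) :=
      (hcurl j).locallyIntegrableOn Ω.isOpen.measurableSet
    rw [e (hφ'.pderiv3 _), e (hφ'.pderiv3 _), e hφ', integral_curl3 hw1 hφ'] at h1
    have e2 : ∀ x, φ x * (curl3 w x j + lam * w x j) = φ x * curl3 w x j + lam * (φ x * w x j) :=
      fun x => by ring
    simp only [e2]
    rw [integral_add (hφ'.integrable_mul lc) ((hφ'.integrable_mul lw).const_mul _),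
      integral_const_mul, ← h1]
    ring
  intro x hx
  funext j
  have hV : IsOpen ((Ω : Set E3) ∩ (fun x => curl3 w x j + lam * w x j) ⁻¹' {0}ᶜ) :=
    (hcw j).isOpen_inter_preimage Ω.isOpen isOpen_compl_singleton
  have h0 : volume ((Ω : Set E3) ∩ (fun x => curl3 w x j + lam * w x j) ⁻¹' {0}ᶜ) = 0 := by
    have := hz j
    rw [ae_iff] at this
    refine measure_mono_null (fun y hy => ?_) this
    simpa using hy
  have hem := hV.measure_eq_zero_iff volume |>.1 h0
  by_contra hne
  exact (hem ▸ (⟨hx, hne⟩ : x ∈ (Ω : Set E3) ∩ (fun x => curl3 w x j + lam * w x j) ⁻¹' {0}ᶜ) :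
    x ∈ (∅ : Set E3))

end ForceFree

/-! ### Weak solutions -/

section WeakSolutions

variable {Ω : Opens E3} {p q : ℝ≥0∞} {lam : ℂ}

theorem memW01_test (φ : 𝓓(Ω, ℂ)) : MemW01 Ω q φ (grad3 φ) := by
  have ht := φ.isTestOn.isTest
  refine ⟨(ht.memLp q).restrict _, MemLp.of_eval fun j => ((ht.pderiv3 j).memLp q).restrict _,
    fun _ => φ, ?_, ?_⟩ <;> simp

theorem memLp_grad3_test (φ : 𝓓(Ω, ℂ)) : MemLp (grad3 φ) q (volume.restrict (Ω : Set E3)) :=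
  (memW01_test φ).2.1

/-- Bilinear identities which hold for test functions extend to `W₀^{1,q}`. -/
theorem MemW01.integral_eq {v : E3 → ℂ} {V : E3 → C3} (hv : MemW01 Ω q v V)
    (hqp : q⁻¹ + p⁻¹ = 1) {a : Fin 3 → E3 → ℂ} {b : E3 → ℂ}
    (ha : ∀ j, MemLp (a j) p (volume.restrict (Ω : Set E3)))
    (hb : MemLp b p (volume.restrict (Ω : Set E3)))
    (h : ∀ φ : 𝓓(Ω, ℂ), ∑ j, ∫ x in (Ω : Set E3), grad3 φ x j * a j x
      = ∫ x in (Ω : Set E3), φ x * b x) :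
    ∑ j, ∫ x in (Ω : Set E3), V x j * a j x = ∫ x in (Ω : Set E3), v x * b x := by
  obtain ⟨h1, h2, φ, l1, l2⟩ := hv
  have t1 : Tendsto (fun n => ∫ x in (Ω : Set E3), φ n x * b x) atTop
      (nhds (∫ x in (Ω : Set E3), v x * b x)) :=
    tendsto_integral_mul_of_eLpNorm hqp (fun n => (memW01_test (φ n)).1) h1 hb l1
  have t2 : ∀ j, Tendsto (fun n => ∫ x in (Ω : Set E3), grad3 (φ n) x j * a j x) atTop
      (nhds (∫ x in (Ω : Set E3), V x j * a j x)) := fun j => by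
    refine tendsto_integral_mul_of_eLpNorm hqp (fun n => (memLp_grad3_test (φ n)).eval j)
      (h2.eval j) (ha j) ?_
    refine tendsto_of_tendsto_of_tendsto_of_le_of_le tendsto_const_nhds l2 (fun _ => zero_le)
      fun n => eLpNorm_mono fun x => ?_
    exact norm_le_pi_norm (grad3 (φ n) x - V x) j
  exact tendsto_nhds_unique (tendsto_finsetSum _ fun j _ => t2 j)
    (t1.congr fun n => (h (φ n)).symm)

theorem integral_mul_memLp {μ : Measure E3} (hqp : q⁻¹ + p⁻¹ = 1) {f h : E3 → ℂ}
    (hf : MemLp f q μ) (hh : MemLp h p μ) : Integrable (fun x => f x * h x) μ := by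
  have : ENNReal.HolderTriple q p 1 := ⟨by rw [hqp, inv_one]⟩
  exact hf.integrable_mul hh

theorem integral_smul_apply (hqp : q⁻¹ + p⁻¹ = 1) {v : E3 → ℂ} {w : E3 → C3}
    (hv : MemLp v q (volume.restrict (Ω : Set E3))) (hw : MemLp w p (volume.restrict (Ω : Set E3)))
    (j : Fin 3) : (∫ x in (Ω : Set E3), v x • w x) j = ∫ x in (Ω : Set E3), v x * w x j :=
  eval_integral (fun j => integral_mul_memLp hqp hv (hw.eval j)) j

theorem integral_crossProduct_apply (hqp : q⁻¹ + p⁻¹ = 1) {V w : E3 → C3}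
    (hV : MemLp V q (volume.restrict (Ω : Set E3))) (hw : MemLp w p (volume.restrict (Ω : Set E3)))
    (j : Fin 3) : (∫ x in (Ω : Set E3), crossProduct (V x) (w x)) j
      = (∫ x in (Ω : Set E3), V x (j + 1) * w x (j + 2))
        - ∫ x in (Ω : Set E3), V x (j + 2) * w x (j + 1) := by
  have i : ∀ k l, Integrable (fun x => V x k * w x l) (volume.restrict (Ω : Set E3)) := fun k l =>
    integral_mul_memLp hqp (hV.eval k) (hw.eval l)
  rw [eval_integral]
  · simp only [crossProduct_apply]
    rw [integral_sub (i _ _) (i _ _)]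
  · intro j
    simp only [crossProduct_apply]
    exact (i _ _).sub (i _ _)

theorem integral_dotProduct_eq_sum (hqp : q⁻¹ + p⁻¹ = 1) {V w : E3 → C3}
    (hV : MemLp V q (volume.restrict (Ω : Set E3)))
    (hw : MemLp w p (volume.restrict (Ω : Set E3))) :
    ∫ x in (Ω : Set E3), V x ⬝ᵥ w x = ∑ j, ∫ x in (Ω : Set E3), V x j * w x j :=
  integral_finsetSum _ fun j _ => integral_mul_memLp hqp (hV.eval j) (hw.eval j)

/-- Weak solutions are the distributional solutions in `L^p`. -/
theorem isWeakSolution_iff (hp : 1 ≤ p) (hqp : q⁻¹ + p⁻¹ = 1) {g w : E3 → C3}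
    (hg : MemLp g p (volume.restrict (Ω : Set E3))) :
    IsWeakSolution Ω p q lam g w ↔ MemLp w p (volume.restrict (Ω : Set E3)) ∧
      HasWeakCurl Ω w fun x => g x - lam • w x := by
  refine and_congr_right fun hw => ?_
  have hb : MemLp (fun x => lam • w x - g x) p (volume.restrict (Ω : Set E3)) :=
    (hw.const_smul lam).sub hg
  have hb' : MemLp (fun x => g x - lam • w x) p (volume.restrict (Ω : Set E3)) :=
    hg.sub (hw.const_smul lam)
  have hneg : ∀ v : E3 → ℂ, ∫ x in (Ω : Set E3), v x • (lam • w x - g x)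
      = -∫ x in (Ω : Set E3), v x • (g x - lam • w x) := fun v => by
    rw [← integral_neg]
    congr 1
    funext x
    rw [← smul_neg, neg_sub]
  constructor
  · intro h
    refine ⟨locallyIntegrableOn_of_memLp hp hw, locallyIntegrableOn_of_memLp hp hb', fun φ => ?_⟩
    rw [h φ _ (memW01_test φ), hneg]
  · rintro ⟨-, -, h⟩ v V hv
    funext j
    obtain ⟨h11, h12, h21, h22⟩ := fin3_add j
    rw [integral_crossProduct_apply hqp hv.2.1 hw, integral_smul_apply hqp hv.1 hb]
    -- The j-th component of V × w as a linear form in V, the shape to which the density lemma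
    -- applies.
    let a : Fin 3 → E3 → ℂ := fun k x =>
      if k = j + 1 then w x (j + 2) else if k = j + 2 then -w x (j + 1) else 0
    have n1 : j + 2 ≠ j + 1 := by revert j; decide
    have n2 : j ≠ j + 1 := by revert j; decide
    have n3 : j ≠ j + 2 := by revert j; decide
    have sum : ∀ V : E3 → C3, ∑ k, ∫ x in (Ω : Set E3), V x k * a k x
        = (∫ x in (Ω : Set E3), V x (j + 1) * w x (j + 2))
          - ∫ x in (Ω : Set E3), V x (j + 2) * w x (j + 1) := fun V => by
      rw [sum_fin3_cyclic _ j]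
      simp [a, n1, n2, n3, integral_neg, sub_eq_add_neg]
    rw [← sum V]
    refine hv.integral_eq hqp (b := fun x => (lam • w x - g x) j) (fun k => ?_) (hb.eval j)
      fun φ => ?_
    · simp only [a]
      split_ifs
      · exact hw.eval _
      · exact (hw.eval _).neg
      · exact MemLp.zero
    · rw [sum, ← integral_crossProduct_apply hqp (memLp_grad3_test φ) hw,
        ← integral_smul_apply hqp (memW01_test φ).1 hb, h φ, hneg]

theorem HasWeakCurl.sub {f f' c c' : E3 → C3} (h : HasWeakCurl Ω f c) (h' : HasWeakCurl Ω f' c') :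
    HasWeakCurl Ω (fun x => f x - f' x) fun x => c x - c' x := by
  obtain ⟨l1, l2, h⟩ := hasWeakCurl_iff.1 h
  obtain ⟨l1', l2', h'⟩ := hasWeakCurl_iff.1 h'
  refine hasWeakCurl_iff.2 ⟨l1.sub l1', l2.sub l2', fun φ hφ j => ?_⟩
  have e : ∀ {ψ : E3 → ℂ} {f f' : E3 → C3}, LocallyIntegrableOn f (Ω : Set E3) →
      LocallyIntegrableOn f' (Ω : Set E3) → IsTestOn Ω ψ → ∀ j, ∫ x, ψ x * (f x - f' x) j
      = (∫ x, ψ x * f x j) - ∫ x, ψ x * f' x j := fun hf hf' hψ j => by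
    simp only [Pi.sub_apply, mul_sub]
    exact integral_sub (hψ.integrable_mul (LocallyIntegrableOn.apply hf j))
      (hψ.integrable_mul (LocallyIntegrableOn.apply hf' j))
  rw [e l1 l1' (hφ.pderiv3 _), e l1 l1' (hφ.pderiv3 _), e l2 l2' hφ]
  linear_combination h φ hφ j - h' φ hφ j

theorem HasWeakCurl.neg {f c : E3 → C3} (h : HasWeakCurl Ω f c) :
    HasWeakCurl Ω (fun x => -f x) fun x => -c x := by
  obtain ⟨l1, l2, h⟩ := hasWeakCurl_iff.1 h
  refine hasWeakCurl_iff.2 ⟨l1.neg, l2.neg, fun φ hφ j => ?_⟩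
  simp only [Pi.neg_apply, mul_neg, integral_neg]
  linear_combination -h φ hφ j

theorem HasWeakCurl.congr {f f' c c' : E3 → C3} (h : HasWeakCurl Ω f c)
    (hf : f =ᵐ[volume.restrict (Ω : Set E3)] f') (hc : c =ᵐ[volume.restrict (Ω : Set E3)] c') :
    HasWeakCurl Ω f' c' := by
  obtain ⟨l1, l2, h⟩ := h
  have hl : ∀ {f f' : E3 → C3}, LocallyIntegrableOn f (Ω : Set E3) →
      f =ᵐ[volume.restrict (Ω : Set E3)] f' → LocallyIntegrableOn f' (Ω : Set E3) := by
    intro f f' hl hff x hx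
    obtain ⟨t, ht, hi⟩ := hl x hx
    refine ⟨t ∩ Ω, inter_mem ht self_mem_nhdsWithin, ?_⟩
    exact (hi.mono_set Set.inter_subset_left).congr
      (ae_mono (Measure.restrict_mono Set.inter_subset_right le_rfl) hff)
  refine ⟨hl l1 hf, hl l2 hc, fun φ => ?_⟩
  have e1 : ∫ x in (Ω : Set E3), crossProduct (grad3 φ x) (f' x)
      = ∫ x in (Ω : Set E3), crossProduct (grad3 φ x) (f x) :=
    integral_congr_ae (by filter_upwards [hf] with x hx; rw [hx])
  have e2 : ∫ x in (Ω : Set E3), φ x • c' x = ∫ x in (Ω : Set E3), φ x • c x :=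
    integral_congr_ae (by filter_upwards [hc] with x hx; rw [hx])
  rw [e1, e2, h φ]

/-- Distributional solutions differ from a particular one by a force-free field. -/
theorem hasWeakCurl_solution_iff (hlam : lam ≠ 0) {g w₀ w : E3 → C3}
    (h₀ : HasWeakCurl Ω w₀ fun x => g x - lam • w₀ x) :
    HasWeakCurl Ω w (fun x => g x - lam • w x) ↔ ∃ u : E3 → C3, IsForceFree Ω lam u ∧
      w =ᵐ[volume.restrict (Ω : Set E3)] fun x => w₀ x + u x := by
  constructor
  · intro h
    have h1 := h.sub h₀
    have e : (fun x => g x - lam • w x - (g x - lam • w₀ x)) = fun x => -(lam • (w x - w₀ x)) := by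
      funext x; rw [smul_sub]; abel
    rw [e] at h1
    obtain ⟨u, hu, hae⟩ := exists_isForceFree hlam h1
    exact ⟨u, hu, hae.mono fun x hx => by simp only [← hx]; abel⟩
  · rintro ⟨u, hu, hae⟩
    refine (h₀.sub hu.hasWeakCurl.neg).congr (hae.mono fun x hx => ?_) (hae.mono fun x hx => ?_)
    · simp only [hx, sub_neg_eq_add]
    · simp only [hx, smul_add]; abel

/-- The divergence of a weak solution. -/
theorem IsWeakSolution.integral_grad_dotProduct (hp : 1 ≤ p) (hqp : q⁻¹ + p⁻¹ = 1)
    (hlam : lam ≠ 0) {g w : E3 → C3} (hg : MemLp g p (volume.restrict (Ω : Set E3)))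
    (h : IsWeakSolution Ω p q lam g w) {d : E3 → ℂ}
    (hd : MemLp d p (volume.restrict (Ω : Set E3))) (hgd : HasWeakDiv Ω g d) {v : E3 → ℂ}
    {V : E3 → C3} (hv : MemW01 Ω q v V) :
    ∫ x in (Ω : Set E3), V x ⬝ᵥ w x = ∫ x in (Ω : Set E3), -(lam⁻¹ * d x) * v x := by
  have hw := h.1
  obtain ⟨-, -, hc⟩ := hasWeakCurl_iff.1 ((isWeakSolution_iff hp hqp hg).1 h).2
  have lg := locallyIntegrableOn_of_memLp hp hg
  have lw := locallyIntegrableOn_of_memLp hp hw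
  rw [integral_dotProduct_eq_sum hqp hv.2.1 hw]
  have e : ∫ x in (Ω : Set E3), -(lam⁻¹ * d x) * v x
      = ∫ x in (Ω : Set E3), v x * -(lam⁻¹ * d x) := by simp_rw [mul_comm]
  rw [e]
  refine hv.integral_eq hqp (a := fun j x => w x j) (fun j => hw.eval j) (hd.const_mul lam⁻¹).neg
    fun φ => ?_
  have hφ := φ.isTestOn
  have h1 : ∑ j, ∫ x in (Ω : Set E3), grad3 φ x j * g x j = -∫ x in (Ω : Set E3), φ x * d x := by
    rw [← integral_dotProduct_eq_sum hqp (memLp_grad3_test φ) hg]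
    exact hgd.2.2 φ
  have h2 : ∀ f : E3 → C3, ∑ j, ∫ x in (Ω : Set E3), grad3 φ x j * f x j
      = (∫ x, pderiv3 0 φ x * f x 0) + (∫ x, pderiv3 1 φ x * f x 1)
        + ∫ x, pderiv3 2 φ x * f x 2 := fun f => by
    rw [Fin.sum_univ_three]
    simp only [grad3]
    rw [(hφ.pderiv3 0).setIntegral_mul, (hφ.pderiv3 1).setIntegral_mul,
      (hφ.pderiv3 2).setIntegral_mul]
  -- The curl equation with test function ∂ⱼφ in component j. Summed over j the left sides cancel by
  -- symmetry of second derivatives, leaving λ div w = div g.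
  have h3 : ∀ j, (∫ x, pderiv3 (j + 1) (pderiv3 j φ) x * w x (j + 2))
      - (∫ x, pderiv3 (j + 2) (pderiv3 j φ) x * w x (j + 1))
      = lam * (∫ x, pderiv3 j φ x * w x j) - ∫ x, pderiv3 j φ x * g x j := fun j => by
    rw [hc _ (hφ.pderiv3 j) j]
    have i1 := (hφ.pderiv3 j).integrable_mul (LocallyIntegrableOn.apply lg j)
    have i2 := (hφ.pderiv3 j).integrable_mul (LocallyIntegrableOn.apply lw j)
    simp only [Pi.sub_apply, Pi.smul_apply, smul_eq_mul, mul_sub, mul_left_comm _ lam]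
    rw [integral_sub i1 (i2.const_mul lam), integral_const_mul]
    ring
  have k0 : (∫ x, pderiv3 1 (pderiv3 0 φ) x * w x 2) - (∫ x, pderiv3 2 (pderiv3 0 φ) x * w x 1)
      = lam * (∫ x, pderiv3 0 φ x * w x 0) - ∫ x, pderiv3 0 φ x * g x 0 := h3 0
  have k1 : (∫ x, pderiv3 2 (pderiv3 1 φ) x * w x 0) - (∫ x, pderiv3 0 (pderiv3 1 φ) x * w x 2)
      = lam * (∫ x, pderiv3 1 φ x * w x 1) - ∫ x, pderiv3 1 φ x * g x 1 := h3 1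
  have k2 : (∫ x, pderiv3 0 (pderiv3 2 φ) x * w x 1) - (∫ x, pderiv3 1 (pderiv3 2 φ) x * w x 0)
      = lam * (∫ x, pderiv3 2 φ x * w x 2) - ∫ x, pderiv3 2 φ x * g x 2 := h3 2
  rw [hφ.1.pderiv3_comm 0 1] at k1
  rw [hφ.1.pderiv3_comm 0 2, hφ.1.pderiv3_comm 1 2] at k2
  have e3 : ∫ x in (Ω : Set E3), φ x * -(lam⁻¹ * d x)
      = -(lam⁻¹ * ∫ x in (Ω : Set E3), φ x * d x) := by
    rw [← integral_const_mul, ← integral_neg]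
    congr 1
    funext x
    ring
  rw [e3]
  refine mul_left_cancel₀ hlam ?_
  rw [mul_neg, mul_inv_cancel_left₀ hlam, ← h1, h2, h2]
  linear_combination -k0 - k1 - k2

/-- By uniqueness, any weak divergence of g coincides with the L^p one in the definition of
`MemWDiv`, and so is itself in L^p. -/
theorem HasWeakDiv.ae_eq {f : E3 → C3} {d d' : E3 → ℂ} (h : HasWeakDiv Ω f d)
    (h' : HasWeakDiv Ω f d') : d =ᵐ[volume.restrict (Ω : Set E3)] d' := by
  rw [EventuallyEq, ae_restrict_iff' Ω.isOpen.measurableSet]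
  have := ae_eq_zero_of_forall_isTestOn Ω.isOpen (h.2.1.sub h'.2.1) fun φ hφ hs => by
    have hφ' : IsTestOn Ω φ := ⟨hφ, hs⟩
    simp only [Pi.sub_apply, mul_sub]
    rw [integral_sub (hφ'.integrable_mul h.2.1) (hφ'.integrable_mul h'.2.1),
      ← hφ'.setIntegral_mul, ← hφ'.setIntegral_mul]
    have h1 := h.2.2 ⟨φ, hφ.contDiff, hφ.hasCompactSupport, hs⟩
    have h2 := h'.2.2 ⟨φ, hφ.contDiff, hφ.hasCompactSupport, hs⟩
    rw [h1, neg_inj] at h2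
    exact sub_eq_zero.2 h2
  filter_upwards [this] with x hx hxΩ
  exact sub_eq_zero.1 (hx hxΩ)

end WeakSolutions

theorem mainTheorem1 (Ω : Opens E3) (hconn : IsConnected (Ω : Set E3))
    (hbdd : Bornology.IsBounded (Ω : Set E3)) (hbdry : HasLiapunovBoundary (Ω : Set E3))
    (lam : ℂ) (hlam : lam ≠ 0)
    (p q : ℝ≥0∞) (hp : 1 < p) (hp' : p < ⊤) (hpq : p⁻¹ + q⁻¹ = 1)
    (g : E3 → C3) (hg : MemWDiv Ω p g) :
    (∀ᵐ x ∂(volume.restrict (Ω : Set E3)),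
      IntegrableOn (T2Integrand lam g x) (Ω : Set E3)) ∧
    MemLp (T2 Ω lam g) p (volume.restrict (Ω : Set E3)) ∧
    ∃ c : E3 → C3, MemLp c p (volume.restrict (Ω : Set E3)) ∧ HasWeakCurl Ω (T2 Ω lam g) c ∧
      -- general weak solution in `L^p`
      (∀ w : E3 → C3, IsWeakSolution Ω p q lam g w ↔
        ∃ u : E3 → C3, IsForceFree Ω lam u ∧ MemLp u p (volume.restrict (Ω : Set E3)) ∧
          w =ᵐ[volume.restrict (Ω : Set E3)] fun x => lam⁻¹ • (g x - c x) + u x) ∧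
      -- the weak solutions are those of the system with `g₀ = -(div g) / lam`
      (∀ d : E3 → ℂ, HasWeakDiv Ω g d → ∀ w : E3 → C3,
        (IsWeakSolution Ω p q lam g w ↔
          IsWeakSystemSolution Ω p q lam (fun x => -(lam⁻¹ * d x)) g w)) ∧
      -- general distributional solution, with no growth condition at the boundary
      (∀ w : E3 → C3, HasWeakCurl Ω w (fun x => g x - lam • w x) ↔
        ∃ u : E3 → C3, IsForceFree Ω lam u ∧
          w =ᵐ[volume.restrict (Ω : Set E3)] fun x => lam⁻¹ • (g x - c x) + u x) := by
  obtain ⟨hgp, d₀, hd₀, hgd₀⟩ := hg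
  have hqp : q⁻¹ + p⁻¹ = 1 := by rw [add_comm]; exact hpq
  obtain ⟨hint, hT, c, hc, hcT, hc₀⟩ := exists_weakCurl_T2 hbdd hlam hp hp' hpq hgp
  have hw₀ : MemLp (fun x => lam⁻¹ • (g x - c x)) p (volume.restrict (Ω : Set E3)) :=
    (hgp.sub hc).const_smul lam⁻¹
  -- For w₀ = (g − c)/λ one has g − λw₀ = c, so the curl identity for w₀ says that it solves the
  -- equation.
  have h₀ : HasWeakCurl Ω (fun x => lam⁻¹ • (g x - c x))
      fun x => g x - lam • lam⁻¹ • (g x - c x) := by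
    simp only [smul_inv_smul₀ hlam, sub_sub_cancel]
    exact hc₀
  have hsol := fun w => hasWeakCurl_solution_iff (w := w) hlam h₀
  refine ⟨hint, hT, c, hc, hcT, fun w => ?_, fun d hd w => ⟨fun h => ⟨h.1, fun v V hv => ?_⟩,
    fun h => ⟨h.1, fun v V hv => (h.2 v V hv).2⟩⟩, hsol⟩
  · rw [isWeakSolution_iff hp.le hqp hgp, hsol]
    constructor
    · rintro ⟨hw, u, hu, hae⟩
      -- The particular solution is in L^p, so w is in L^p exactly when the force-free part is.
      refine ⟨u, hu, (hw.sub hw₀).ae_eq (hae.mono fun x hx => ?_), hae⟩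
      rw [Pi.sub_apply, hx, add_sub_cancel_left]
    · rintro ⟨u, hu, hup, hae⟩
      exact ⟨(hw₀.add hup).ae_eq hae.symm, u, hu, hae⟩
  · have hdp : MemLp d p (volume.restrict (Ω : Set E3)) := hd₀.ae_eq (hgd₀.ae_eq hd)
    exact ⟨h.integral_grad_dotProduct hp.le hqp hlam hgp hdp hd hv, h.2 v V hv⟩
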